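/- Let $R=\bigoplus_{n\ge 0}R_n$ be a standard graded commutative ring: $R_0$ is Noetherian and $R$ is generated as an $R_0$-algebra by finitely many elements of degree one. Assume that $R_0$ is local, and put $R_+=\bigoplus_{n\ge 1}R_n$. Let $M\neq 0$ be a finitely generated $\mathbb Z$-graded $R$-module and let $\mathfrak a\subsetneq R$ be a proper homogeneous ideal. For a homogeneous ideal $\mathfrak c$ let $H^i_{\mathfrak c}(M)=\bigoplus_{n\in\mathbb Z}H^i_{\mathfrak c}(M)_n$ be the $i$-th graded local cohomology module (the $i$-th right derived functor of the $\mathfrak c$-torsion functor $\Gamma_{\mathfrak c}$ on graded $R$-modules), and set $$\operatorname{cd}(\mathfrak c,M)=\sup\{i: H^i_{\mathfrak c}(M)\neq 0\},\qquad f^{R_+}_{\mathfrak c}(M)=\sup\{k\in\mathbb N_0: R_+\subseteq\sqrt{0:_R H^i_{\mathfrak c}(M)}\ \text{for all } i<k\}.$$ A graded module $N=\bigoplus_{n\in\mathbb Z}N_n$ is called tame if the set $\{n\in\mathbb Z: N_n=0,\ N_{n+1}\neq 0\}$ is finite. Assume that $\operatorname{cd}(R_+,M)\neq 0$ and that at least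 one of the following holds: (i) $M$ is relative Cohen–Macaulay with respect to $R_+$, i.e. there is an $n\in\mathbb N_0$ with $H^i_{R_+}(M)=0$ for all $i\neq n$; (ii) $\mathfrak a$ is h-linked with $R_+$ over $M$, i.e. $\mathfrak aM\neq M\neq R_+M$ and there is an ideal $I\subseteq\mathfrak a\cap R_+$, generated by an $M$-regular sequence of homogeneous elements, such that $R_+M=IM:_M\mathfrak a$ and $\mathfrak aM=IM:_MR_+$. Then $\operatorname{cd}(R_+,M)$ is a positive integer, $f^{R_+}_{\mathfrak a+R_+}(M)<\infty$, and $H^{\operatorname{cd}(R_+,M)}_{\mathfrak a+R_+}(M)$ is tame. -/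

import Mathlib

universe u

section GradedModules

variable {R : Type u} [CommRing R]

/-- A `ℤ`-graded module over the `ℕ`-graded ring `R = ⨁ n, 𝒜 n`. -/
structure GrMod (𝒜 : ℕ → AddSubgroup R) where
  carrier : Type u
  [grp : AddCommGroup carrier]
  [mod : Module R carrier]
  /-- the homogeneous components -/
  deg : ℤ → AddSubgroup carrier
  isInternal : DirectSum.IsInternal deg
  smul_mem : ∀ (i : ℕ) (j : ℤ) (r : R) (x : carrier),
    r ∈ 𝒜 i → x ∈ deg j → r • x ∈ deg ((i : ℤ) + j)

instance {𝒜 : ℕ → AddSubgroup R} : CoeSort (GrMod 𝒜) (Type u) := ⟨GrMod.carrier⟩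

attribute [instance] GrMod.grp GrMod.mod

variable {𝒜 : ℕ → AddSubgroup R}

/-- Homogeneous homomorphisms of degree zero. -/
def IsGrHom {M N : GrMod 𝒜} (f : M →ₗ[R] N) : Prop :=
  ∀ (n : ℤ) (x : M), x ∈ M.deg n → f x ∈ N.deg n

/-- Injective objects of the category of graded modules and homogeneous homomorphisms of
degree zero. -/
def IsGrInjective (E : GrMod 𝒜) : Prop :=
  ∀ (X Y : GrMod 𝒜) (i : X →ₗ[R] Y) (g : X →ₗ[R] E), IsGrHom i → Function.Injective i →
    IsGrHom g → ∃ h : Y →ₗ[R] E, IsGrHom h ∧ ∀ x, h (i x) = g x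

/-- Injective resolutions `0 → M → E⁰ → E¹ → ⋯` in the category of graded modules. -/
structure GrInjRes (M : GrMod 𝒜) where
  obj : ℕ → GrMod 𝒜
  inj : ∀ i, IsGrInjective (obj i)
  ε : M →ₗ[R] obj 0
  ε_grHom : IsGrHom ε
  ε_injective : Function.Injective ε
  d : ∀ i, obj i →ₗ[R] obj (i + 1)
  d_grHom : ∀ i, IsGrHom (d i)
  exact_zero : Function.Exact ε (d 0)
  exact_succ : ∀ i, Function.Exact (d i) (d (i + 1))

end GradedModules

/-! ### Every graded module has a graded injective resolution -/

section Existence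

variable {R : Type u} [CommRing R]

theorem isInternal_of_proj {C : Type u} [AddCommGroup C] (deg : ℤ → AddSubgroup C)
    (P : C →+ (ℤ →₀ C)) (hmem : ∀ x n, P x n ∈ deg n)
    (hsum : ∀ x, (P x).sum (fun _ c => c) = x)
    (hP : ∀ n, ∀ x ∈ deg n, P x = Finsupp.single n x) : DirectSum.IsInternal deg := by
  classical
  have key : ∀ f : DirectSum ℤ (fun i => deg i), ∀ n,
      P (DirectSum.coeAddMonoidHom deg f) n = (f n : C) := by
    intro f n
    induction f using DirectSum.induction_on with
    | zero => simp
    | of i x =>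
      rw [DirectSum.coeAddMonoidHom_of, hP i x x.2, DirectSum.coe_of_apply,
        Finsupp.single_apply]
      split_ifs <;> rfl
    | add x y hx hy => simp [hx, hy]
  constructor
  · intro f g hfg
    refine DFinsupp.ext fun n => Subtype.ext ?_
    have h1 := key f n
    have h2 := key g n
    rw [← h1, ← h2, hfg]
  · intro x
    refine ⟨∑ n ∈ (P x).support, DirectSum.of (fun i => deg i) n ⟨P x n, hmem x n⟩, ?_⟩
    rw [map_sum]
    simp only [DirectSum.coeAddMonoidHom_of]
    exact hsum x

theorem exists_proj {C : Type u} [AddCommGroup C] (deg : ℤ → AddSubgroup C)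
    (h : DirectSum.IsInternal deg) :
    ∃ P : C →+ (ℤ →₀ C), (∀ x n, P x n ∈ deg n) ∧
      (∀ x, (P x).sum (fun _ c => c) = x) ∧
      (∀ n, ∀ x ∈ deg n, P x = Finsupp.single n x) := by
  classical
  let e : DirectSum ℤ (fun i => deg i) ≃+ C :=
    AddEquiv.ofBijective (DirectSum.coeAddMonoidHom deg) h
  let Q : DirectSum ℤ (fun i => deg i) →+ (ℤ →₀ C) :=
    DirectSum.toAddMonoid fun i => (Finsupp.singleAddHom i).comp (deg i).subtype
  have hQ : ∀ i (x : deg i), Q (DirectSum.of (fun i => deg i) i x) = Finsupp.single i (x : C) := by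
    intro i x
    simp [Q]
  have he : ∀ i (x : deg i), e (DirectSum.of (fun i => deg i) i x) = (x : C) := by
    intro i x
    exact DirectSum.coeAddMonoidHom_of deg i x
  refine ⟨Q.comp e.symm.toAddMonoidHom, ?_, ?_, ?_⟩
  · intro x n
    obtain ⟨f, rfl⟩ := e.surjective x
    simp only [AddMonoidHom.comp_apply, AddEquiv.coe_toAddMonoidHom, AddEquiv.symm_apply_apply]
    induction f using DirectSum.induction_on with
    | zero => simp
    | of i x =>
      rw [hQ, Finsupp.single_apply]
      split_ifs with hi
      · subst hi; exact x.2
      · exact (deg n).zero_mem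
    | add x y hx hy => rw [map_add]; exact (deg n).add_mem hx hy
  · intro x
    obtain ⟨f, rfl⟩ := e.surjective x
    simp only [AddMonoidHom.comp_apply, AddEquiv.coe_toAddMonoidHom, AddEquiv.symm_apply_apply]
    induction f using DirectSum.induction_on with
    | zero => simp
    | of i x => rw [hQ, he, Finsupp.sum_single_index rfl]
    | add x y hx hy =>
      rw [map_add, map_add, Finsupp.sum_add_index' (fun _ => rfl) (fun _ _ _ => rfl), hx, hy]
  · intro n x hx
    have : x = e (DirectSum.of (fun i => deg i) n ⟨x, hx⟩) := (he n ⟨x, hx⟩).symm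
    rw [AddMonoidHom.comp_apply]
    conv_lhs => rw [this]
    simp [hQ]

variable {𝒜 : ℕ → AddSubgroup R}

theorem IsGrHom.proj_comm {M N : GrMod 𝒜} {f : M →ₗ[R] N} (hf : IsGrHom f)
    {P : M →+ (ℤ →₀ M)} {Q : N →+ (ℤ →₀ N)}
    (hPm : ∀ x n, P x n ∈ M.deg n) (hPs : ∀ x, (P x).sum (fun _ c => c) = x)
    (hQ : ∀ n, ∀ x ∈ N.deg n, Q x = Finsupp.single n x) (x : M) (n : ℤ) :
    Q (f x) n = f (P x n) := by
  classical
  conv_lhs => rw [← hPs x]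
  rw [Finsupp.sum, map_sum, map_sum, Finsupp.finsetSum_apply]
  have : ∀ k ∈ (P x).support, Q (f (P x k)) n = if k = n then f (P x n) else 0 := by
    intro k _
    rw [hQ k _ (hf k _ (hPm x k)), Finsupp.single_apply]
    split_ifs with h
    · rw [h]
    · rfl
  rw [Finset.sum_congr rfl this, Finset.sum_ite_eq']
  split_ifs with h
  · rfl
  · rw [Finsupp.notMem_support_iff.mp h, map_zero]

/-- The cokernel of a homogeneous homomorphism of degree zero. -/
noncomputable def grCoker {M N : GrMod 𝒜} (f : M →ₗ[R] N) (hf : IsGrHom f) : GrMod 𝒜 where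
  carrier := N ⧸ LinearMap.range f
  deg n := (N.deg n).map (LinearMap.range f).mkQ.toAddMonoidHom
  isInternal := by
    classical
    obtain ⟨P, hPm, hPs, hP⟩ := exists_proj M.deg M.isInternal
    obtain ⟨Q, hQm, hQs, hQ⟩ := exists_proj N.deg N.isInternal
    let q : N →+ N ⧸ LinearMap.range f := (LinearMap.range f).mkQ.toAddMonoidHom
    let T : N →+ (ℤ →₀ N ⧸ LinearMap.range f) := (Finsupp.mapRange.addMonoidHom q).comp Q
    have hT : ∀ x n, T x n = q (Q x n) := fun x n => by simp [T]
    have hq0 : ∀ x ∈ LinearMap.range f, q x = 0 := fun x hx =>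
      (Submodule.Quotient.mk_eq_zero _).mpr hx
    let T' : (N ⧸ LinearMap.range f) →+ (ℤ →₀ N ⧸ LinearMap.range f) :=
      QuotientAddGroup.lift (LinearMap.range f).toAddSubgroup T (by
        rintro _ ⟨x, rfl⟩
        ext n
        rw [hT, hf.proj_comm hPm hPs hQ]
        exact hq0 _ ⟨_, rfl⟩)
    have hT' : ∀ x, T' (q x) = T x := fun x => rfl
    have hsurj : Function.Surjective q := Submodule.mkQ_surjective _
    refine isInternal_of_proj _ T' ?_ ?_ ?_
    · intro x n
      obtain ⟨y, rfl⟩ := hsurj x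
      rw [hT', hT]
      exact ⟨_, hQm y n, rfl⟩
    · intro x
      obtain ⟨y, rfl⟩ := hsurj x
      rw [hT']
      change (Finsupp.mapRange q (map_zero q) (Q y)).sum _ = _
      rw [Finsupp.sum_mapRange_index (fun _ => rfl)]
      conv_rhs => rw [← hQs y]
      rw [Finsupp.sum, Finsupp.sum, map_sum]
    · rintro n _ ⟨y, hy, rfl⟩
      change T' (q y) = Finsupp.single n (q y)
      rw [hT']
      ext k
      rw [hT, hQ n y hy, Finsupp.single_apply, Finsupp.single_apply]
      split_ifs
      · rfl
      · exact map_zero q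
  smul_mem := by
    rintro i j r _ hr ⟨y, hy, rfl⟩
    exact ⟨r • y, N.smul_mem i j r y hr hy, rfl⟩

theorem grCoker_mkQ_grHom {M N : GrMod 𝒜} (f : M →ₗ[R] N) (hf : IsGrHom f) :
    IsGrHom (M := N) (N := grCoker f hf) (LinearMap.range f).mkQ :=
  fun _ x hx => ⟨x, hx, rfl⟩

/-- Multiplication by the homogeneous element `r` of degree `k` on `⨁ n, Q Tⁿ`:
`q Tⁿ ↦ (r q) Tⁿ⁺ᵏ`. -/
noncomputable def laurentMulFun {Q : Type u} [AddCommGroup Q] [Module R Q]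
    (k : ℕ) (r : R) : Module.End ℤ (ℤ →₀ Q) :=
  (Finsupp.liftAddHom fun n : ℤ =>
    (Finsupp.singleAddHom ((k : ℤ) + n)).comp (DistribSMul.toAddMonoidHom Q r)).toIntLinearMap

theorem laurentMulFun_single {Q : Type u} [AddCommGroup Q] [Module R Q]
    (k : ℕ) (r : R) (n : ℤ) (q : Q) :
    laurentMulFun k r (Finsupp.single n q) = Finsupp.single ((k : ℤ) + n) (r • q) := by
  simp [laurentMulFun]

theorem laurentEnd_ext {Q : Type u} [AddCommGroup Q] {f g : Module.End ℤ (ℤ →₀ Q)}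
    (h : ∀ n q, f (Finsupp.single n q) = g (Finsupp.single n q)) : f = g :=
  Finsupp.lhom_ext h

/-- `laurentMulFun` on the homogeneous elements of degree `k`, as an additive map. -/
noncomputable def laurentMul (𝒜 : ℕ → AddSubgroup R) (Q : Type u) [AddCommGroup Q] [Module R Q]
    (k : ℕ) : 𝒜 k →+ Module.End ℤ (ℤ →₀ Q) where
  toFun r := laurentMulFun k (r : R)
  map_zero' := laurentEnd_ext fun n q => by
    rw [laurentMulFun_single]
    simp
  map_add' r s := laurentEnd_ext fun n q => by
    rw [LinearMap.add_apply, laurentMulFun_single, laurentMulFun_single, laurentMulFun_single]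
    simp [add_smul]

theorem laurentMul_single (Q : Type u) [AddCommGroup Q] [Module R Q]
    (k : ℕ) (r : 𝒜 k) (n : ℤ) (q : Q) :
    laurentMul 𝒜 Q k r (Finsupp.single n q) = Finsupp.single ((k : ℤ) + n) ((r : R) • q) :=
  laurentMulFun_single k (r : R) n q

variable [GradedRing 𝒜]

/-- The action of `R` on `⨁ n, Q Tⁿ`. -/
noncomputable def laurentAction (𝒜 : ℕ → AddSubgroup R) [GradedRing 𝒜]
    (Q : Type u) [AddCommGroup Q] [Module R Q] : R →+* Module.End ℤ (ℤ →₀ Q) :=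
  (DirectSum.toSemiring (laurentMul 𝒜 Q)
    (laurentEnd_ext fun n q => by
      rw [laurentMul_single]
      simp)
    (fun a b => laurentEnd_ext fun n q => by
      rw [Module.End.mul_apply, laurentMul_single, laurentMul_single, laurentMul_single]
      simp [mul_smul, add_assoc])).comp
    (DirectSum.decomposeRingEquiv 𝒜).toRingHom

theorem laurentAction_single (Q : Type u) [AddCommGroup Q] [Module R Q]
    (k : ℕ) (r : R) (hr : r ∈ 𝒜 k) (n : ℤ) (q : Q) :
    laurentAction 𝒜 Q r (Finsupp.single n q) = Finsupp.single ((k : ℤ) + n) (r • q) := by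
  have h : DirectSum.decomposeRingEquiv 𝒜 r = DirectSum.of (fun i => 𝒜 i) k ⟨r, hr⟩ :=
    DirectSum.decompose_of_mem 𝒜 hr
  simp only [laurentAction, RingHom.comp_apply, RingEquiv.toRingHom_eq_coe, RingHom.coe_coe]
  rw [h, DirectSum.toSemiring_of, laurentMul_single]

/-- The graded module `⨁ n, Q Tⁿ`, where `r ∈ R` of degree `k` acts by `q Tⁿ ↦ (r q) Tⁿ⁺ᵏ`. -/
noncomputable def laurentGrMod (𝒜 : ℕ → AddSubgroup R) [GradedRing 𝒜]
    (Q : Type u) [AddCommGroup Q] [Module R Q] : GrMod 𝒜 where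
  carrier := ℤ →₀ Q
  mod := Module.compHom (ℤ →₀ Q) (laurentAction 𝒜 Q)
  deg n := (Finsupp.singleAddHom n : Q →+ (ℤ →₀ Q)).range
  isInternal := by
    classical
    let P : (ℤ →₀ Q) →+ (ℤ →₀ (ℤ →₀ Q)) :=
      Finsupp.liftAddHom fun n => (Finsupp.singleAddHom n).comp (Finsupp.singleAddHom n)
    have hP : ∀ n q, P (Finsupp.single n q) = Finsupp.single n (Finsupp.single n q) := by
      intro n q
      simp [P]
    refine isInternal_of_proj _ P ?_ ?_ ?_
    · intro x n
      induction x using Finsupp.induction_linear with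
      | zero => simp
      | add x y hx hy => rw [map_add]; exact AddSubgroup.add_mem _ hx hy
      | single k q =>
        rw [hP, Finsupp.single_apply]
        split_ifs with h
        · subst h; exact ⟨q, rfl⟩
        · exact AddSubgroup.zero_mem _
    · intro x
      induction x using Finsupp.induction_linear with
      | zero => simp
      | add x y hx hy =>
        rw [map_add, Finsupp.sum_add_index' (fun _ => rfl) (fun _ _ _ => rfl), hx, hy]
      | single k q => rw [hP, Finsupp.sum_single_index rfl]
    · rintro n _ ⟨q, rfl⟩
      exact hP n q
  smul_mem := by
    rintro i j r _ hr ⟨q, rfl⟩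
    exact ⟨r • q, (laurentAction_single Q i r hr j q).symm⟩

theorem laurentGrMod_smul_single (Q : Type u) [AddCommGroup Q] [Module R Q]
    (k : ℕ) (r : R) (hr : r ∈ 𝒜 k) (n : ℤ) (q : Q) :
    r • (show laurentGrMod 𝒜 Q from Finsupp.single n q) =
      (show laurentGrMod 𝒜 Q from Finsupp.single ((k : ℤ) + n) (r • q)) :=
  laurentAction_single Q k r hr n q

/-- Additive maps that respect the action of homogeneous elements on homogeneous elements
are linear. -/
theorem smul_comm_of_homogeneous (N : GrMod 𝒜) {L : Type u} [AddCommGroup L] [Module R L]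
    (f : N →+ L)
    (hf : ∀ (i : ℕ) (j : ℤ) (r : R) (x : N), r ∈ 𝒜 i → x ∈ N.deg j → f (r • x) = r • f x)
    (r : R) (x : N) : f (r • x) = r • f x := by
  classical
  obtain ⟨P, hPm, hPs, -⟩ := exists_proj N.deg N.isInternal
  have h1 : ∀ (i : ℕ) (r : R) (x : N), r ∈ 𝒜 i → f (r • x) = r • f x := by
    intro i r x hr
    rw [← hPs x, Finsupp.sum, Finset.smul_sum, map_sum, map_sum, Finset.smul_sum]
    exact Finset.sum_congr rfl fun j _ => hf i j r _ hr (hPm x j)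
  rw [← DirectSum.sum_support_decompose 𝒜 r, Finset.sum_smul, Finset.sum_smul, map_sum]
  exact Finset.sum_congr rfl fun i _ => h1 i _ x (SetLike.coe_mem _)

/-- A linear map `φ : N → Q` gives the homogeneous map `N → ⨁ n, Q Tⁿ`, `x ↦ ∑ φ(xₙ) Tⁿ`. -/
theorem exists_grHom_of_linear (N : GrMod 𝒜) {Q : Type u} [AddCommGroup Q] [Module R Q]
    (φ : N →ₗ[R] Q) :
    ∃ h : N →ₗ[R] laurentGrMod 𝒜 Q, IsGrHom h ∧
      ∀ n, ∀ x ∈ N.deg n, h x = (Finsupp.single n (φ x) : ℤ →₀ Q) := by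
  classical
  obtain ⟨P, hPm, hPs, hP⟩ := exists_proj N.deg N.isInternal
  let h₀ : N →+ laurentGrMod 𝒜 Q :=
    (Finsupp.mapRange.addMonoidHom φ.toAddMonoidHom : (ℤ →₀ N) →+ (ℤ →₀ Q)).comp P
  have hh : ∀ n, ∀ x ∈ N.deg n, h₀ x = (Finsupp.single n (φ x) : ℤ →₀ Q) := by
    intro n x hx
    change Finsupp.mapRange φ (map_zero φ) (P x) = _
    rw [hP n x hx, Finsupp.mapRange_single]
  refine ⟨{ h₀ with map_smul' := ?_ }, ?_, hh⟩
  · refine smul_comm_of_homogeneous N h₀ ?_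
    intro i j r x hr hx
    rw [hh _ _ (N.smul_mem i j r x hr hx), hh _ _ hx, map_smul]
    exact (laurentGrMod_smul_single Q i r hr j (φ x)).symm
  · intro n x hx
    exact ⟨φ x, (hh n x hx).symm⟩

theorem laurentGrMod_injective (Q : Type u) [AddCommGroup Q] [Module R Q]
    [Module.Injective R Q] : IsGrInjective (laurentGrMod 𝒜 Q) := by
  classical
  intro X Y i g hi hinj hg
  let s : laurentGrMod 𝒜 Q →+ Q :=
    (Finsupp.liftAddHom fun _ => AddMonoidHom.id Q : (ℤ →₀ Q) →+ Q)
  have hs : ∀ n (q : Q), s (show laurentGrMod 𝒜 Q from Finsupp.single n q) = q := by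
    intro n q
    change (Finsupp.liftAddHom fun _ => AddMonoidHom.id Q : (ℤ →₀ Q) →+ Q) (Finsupp.single n q) = q
    simp
  have hslin : ∀ (r : R) x, s (r • x) = r • s x := by
    refine smul_comm_of_homogeneous _ s ?_
    rintro k j r _ hr ⟨q, rfl⟩
    refine (congrArg s (laurentGrMod_smul_single Q k r hr j q)).trans ?_
    rw [hs]
    exact congrArg (r • ·) (hs j q).symm
  let σ : laurentGrMod 𝒜 Q →ₗ[R] Q := { s with map_smul' := hslin }
  obtain ⟨φ, hφ⟩ := Module.Injective.out (R := R) (Q := Q) i hinj (σ.comp g)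
  obtain ⟨h, hh, hhs⟩ := exists_grHom_of_linear Y φ
  refine ⟨h, hh, fun x => ?_⟩
  obtain ⟨P, hPm, hPs, -⟩ := exists_proj X.deg X.isInternal
  have hom : ∀ n, ∀ x ∈ X.deg n, h (i x) = g x := by
    intro n x hx
    rw [hhs n _ (hi n x hx), hφ]
    obtain ⟨q, hq⟩ := hg n x hx
    have : σ (g x) = q := by
      rw [← hq]; exact hs n q
    rw [LinearMap.comp_apply, this]
    exact hq
  rw [← hPs x, Finsupp.sum, map_sum, map_sum, map_sum]
  exact Finset.sum_congr rfl fun n _ => hom n _ (hPm x n)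

/-- The category of graded modules has enough injectives. -/
theorem exists_grInjective_embedding (M : GrMod 𝒜) :
    ∃ (E : GrMod 𝒜) (ι : M →ₗ[R] E), IsGrInjective E ∧ IsGrHom ι ∧ Function.Injective ι := by
  classical
  let Q := CategoryTheory.Injective.under (ModuleCat.of R M)
  let j : M →ₗ[R] Q := (CategoryTheory.Injective.ι (ModuleCat.of R M)).hom
  have hj : Function.Injective j :=
    (ModuleCat.mono_iff_injective _).mp inferInstance
  have : Module.Injective R Q := Module.injective_module_of_injective_object R Q
      (inj := inferInstanceAs (CategoryTheory.Injective
        (CategoryTheory.Injective.under (ModuleCat.of R M))))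
  obtain ⟨h, hh, hhs⟩ := exists_grHom_of_linear M j
  refine ⟨laurentGrMod 𝒜 Q, h, laurentGrMod_injective Q, hh, ?_⟩
  obtain ⟨P, hPm, hPs, -⟩ := exists_proj M.deg M.isInternal
  obtain ⟨P', hPm', hPs', hP'⟩ := exists_proj (laurentGrMod 𝒜 Q).deg (laurentGrMod 𝒜 Q).isInternal
  rw [injective_iff_map_eq_zero]
  intro x hx
  have h0 : ∀ n, P x n = 0 := by
    intro n
    have h1 : h (P x n) = 0 := by
      rw [← hh.proj_comm hPm hPs hP', hx, map_zero]; rfl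
    rw [hhs n _ (hPm x n)] at h1
    have h2 : j (P x n) = 0 := Finsupp.single_eq_zero.mp h1
    exact (map_eq_zero_iff j hj).mp h2
  rw [← hPs x, Finsupp.sum]
  exact Finset.sum_eq_zero fun n _ => h0 n

/-- A stage of the construction of an injective resolution: a homogeneous homomorphism. -/
structure GrArrow (𝒜 : ℕ → AddSubgroup R) where
  src : GrMod 𝒜
  tgt : GrMod 𝒜
  map : src →ₗ[R] tgt
  grHom : IsGrHom map
  inj : IsGrInjective tgt

theorem GrArrow.exists_next (A : GrArrow 𝒜) :
    ∃ (E : GrMod 𝒜) (g : A.tgt →ₗ[R] E), IsGrInjective E ∧ IsGrHom g ∧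
      Function.Exact A.map g := by
  obtain ⟨E, ι, hE, hι, hinj⟩ := exists_grInjective_embedding (grCoker A.map A.grHom)
  let π : A.tgt →ₗ[R] grCoker A.map A.grHom := (LinearMap.range A.map).mkQ
  refine ⟨E, ι.comp π, hE,
    fun n x hx => hι n _ (grCoker_mkQ_grHom A.map A.grHom n x hx), fun y => ?_⟩
  rw [LinearMap.comp_apply, map_eq_zero_iff ι hinj]
  exact Submodule.Quotient.mk_eq_zero _

/-- The next stage. -/
noncomputable def GrArrow.next (A : GrArrow 𝒜) : GrArrow 𝒜 where
  src := A.tgt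
  tgt := A.exists_next.choose
  map := A.exists_next.choose_spec.choose
  grHom := A.exists_next.choose_spec.choose_spec.2.1
  inj := A.exists_next.choose_spec.choose_spec.1

theorem GrArrow.next_exact (A : GrArrow 𝒜) : Function.Exact A.map A.next.map :=
  A.exists_next.choose_spec.choose_spec.2.2

/-- The iterated construction. -/
noncomputable def GrArrow.iter (A : GrArrow 𝒜) : ℕ → GrArrow 𝒜
  | 0 => A
  | n + 1 => (A.iter n).next

theorem GrInjRes.nonempty (M : GrMod 𝒜) : Nonempty (GrInjRes M) := by
  obtain ⟨E, ι, hE, hι, hinj⟩ := exists_grInjective_embedding M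
  let A : GrArrow 𝒜 := ⟨M, E, ι, hι, hE⟩
  exact ⟨{
    obj := fun i => (A.iter i).tgt
    inj := fun i => (A.iter i).inj
    ε := ι
    ε_grHom := hι
    ε_injective := hinj
    d := fun i => (A.iter i).next.map
    d_grHom := fun i => (A.iter i).next.grHom
    exact_zero := A.next_exact
    exact_succ := fun i => (A.iter (i + 1)).next_exact }⟩

end Existence

/-! ### Graded local cohomology -/

section LocalCohomology

variable {R : Type u} [CommRing R]

/-- The `𝔞`-torsion submodule `Γ_𝔞(N)`, the elements annihilated by a power of `𝔞`. -/
def gammaTorsion (a : Ideal R) (N : Type u) [AddCommGroup N] [Module R N] : Submodule R N where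
  carrier := {x | ∃ k : ℕ, ∀ r ∈ a ^ k, r • x = 0}
  zero_mem' := ⟨0, fun r _ => smul_zero r⟩
  add_mem' := by
    rintro x y ⟨k, hk⟩ ⟨l, hl⟩
    refine ⟨k + l, fun r hr => ?_⟩
    rw [smul_add, hk r (Ideal.pow_le_pow_right (Nat.le_add_right k l) hr),
      hl r (Ideal.pow_le_pow_right (Nat.le_add_left l k) hr), add_zero]
  smul_mem' := by
    rintro c x ⟨k, hk⟩
    exact ⟨k, fun r hr => by rw [smul_comm, hk r hr, smul_zero]⟩

variable {𝒜 : ℕ → AddSubgroup R}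

/-- The cocycles of the complex `Γ_𝔞(E⁰) → Γ_𝔞(E¹) → ⋯` in degree `i`. -/
def GrInjRes.cocycles {M : GrMod 𝒜} (J : GrInjRes M) (a : Ideal R) (i : ℕ) :
    Submodule R (J.obj i) :=
  gammaTorsion a (J.obj i) ⊓ LinearMap.ker (J.d i)

/-- The coboundaries of the complex `Γ_𝔞(E⁰) → Γ_𝔞(E¹) → ⋯` in degree `i`. -/
def GrInjRes.coboundaries {M : GrMod 𝒜} (J : GrInjRes M) (a : Ideal R) :
    ∀ i : ℕ, Submodule R (J.obj i)
  | 0 => ⊥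
  | i + 1 => (gammaTorsion a (J.obj i)).map (J.d i)

variable [GradedRing 𝒜]

/-- A graded injective resolution of `M`. -/
noncomputable def GrMod.injRes (M : GrMod 𝒜) : GrInjRes M :=
  Classical.choice (GrInjRes.nonempty M)

/-- The local cohomology module `Hⁱ_𝔞(M)`: the `i`-th right derived functor of `Γ_𝔞` on the
category of graded modules. -/
abbrev grLocalCohomology (M : GrMod 𝒜) (a : Ideal R) (i : ℕ) : Type u :=
  M.injRes.cocycles a i ⧸
    (M.injRes.coboundaries a i).comap (M.injRes.cocycles a i).subtype

/-- The graded component `Hⁱ_𝔞(M)ₙ`: the classes of the homogeneous cocycles of degree `n`. -/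
noncomputable def grLocalCohomologyDeg (M : GrMod 𝒜) (a : Ideal R) (i : ℕ) (n : ℤ) :
    AddSubgroup (grLocalCohomology M a i) :=
  (((M.injRes.obj i).deg n).comap (M.injRes.cocycles a i).subtype.toAddMonoidHom).map
    (Submodule.mkQ ((M.injRes.coboundaries a i).comap
      (M.injRes.cocycles a i).subtype)).toAddMonoidHom

/-- The cohomological dimension `cd(𝔞, M) = sup {i | Hⁱ_𝔞(M) ≠ 0}`, with `sup ∅ = -∞`. -/
noncomputable def cohomDim (a : Ideal R) (M : GrMod 𝒜) : WithBot ℕ∞ :=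
  ⨆ (i : ℕ) (_ : Nontrivial (grLocalCohomology M a i)), ((i : ℕ∞) : WithBot ℕ∞)

/-- The `𝔟`-finiteness dimension of `M` with respect to `𝔞`:
`sup {k | 𝔟 ⊆ √(0 : Hⁱ_𝔞(M)) for all i < k}`. -/
noncomputable def finitenessDim (b a : Ideal R) (M : GrMod 𝒜) : ℕ∞ :=
  ⨆ (k : ℕ) (_ : ∀ i < k, b ≤ (Module.annihilator R (grLocalCohomology M a i)).radical), (k : ℕ∞)

/-- `M` is relative Cohen–Macaulay with respect to `𝔞`. -/
def IsRelativeCM (a : Ideal R) (M : GrMod 𝒜) : Prop :=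
  ∃ n : ℕ, ∀ i : ℕ, i ≠ n → Subsingleton (grLocalCohomology M a i)

/-- A family of components `(Nₙ)` is tame if `{n | Nₙ = 0, Nₙ₊₁ ≠ 0}` is finite. -/
def IsTame {N : Type u} [AddCommGroup N] (deg : ℤ → AddSubgroup N) : Prop :=
  {n : ℤ | deg n = ⊥ ∧ deg (n + 1) ≠ ⊥}.Finite

end LocalCohomology

section Linkage

variable {R : Type u} [CommRing R]

/-- `N :_M 𝔞 = {x ∈ M | 𝔞 x ⊆ N}`. -/
def colonIn {M : Type u} [AddCommGroup M] [Module R M] (N : Submodule R M) (a : Ideal R) :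
    Submodule R M where
  carrier := {x | ∀ r ∈ a, r • x ∈ N}
  zero_mem' := fun r _ => by rw [smul_zero]; exact N.zero_mem
  add_mem' := fun hx hy r hr => by rw [smul_add]; exact N.add_mem (hx r hr) (hy r hr)
  smul_mem' := fun c x hx r hr => by rw [smul_comm]; exact N.smul_mem c (hx r hr)

/-- The ideals `𝔞` and `𝔟` are homogeneously linked by `I` over `M`. -/
structure IsHLinked (𝒜 : ℕ → AddSubgroup R) [GradedRing 𝒜] (M : GrMod 𝒜) (I a b : Ideal R) :
    Prop where
  left_homogeneous : a.IsHomogeneous 𝒜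
  right_homogeneous : b.IsHomogeneous 𝒜
  left_ne_top : a • (⊤ : Submodule R M) ≠ ⊤
  right_ne_top : b • (⊤ : Submodule R M) ≠ ⊤
  le_inf : I ≤ a ⊓ b
  exists_regular : ∃ rs : List R, (∀ r ∈ rs, SetLike.IsHomogeneousElem 𝒜 r) ∧
    RingTheory.Sequence.IsRegular M rs ∧ I = Ideal.ofList rs
  right_eq : b • (⊤ : Submodule R M) = colonIn (I • (⊤ : Submodule R M)) a
  left_eq : a • (⊤ : Submodule R M) = colonIn (I • (⊤ : Submodule R M)) b

/-- `R` is generated as an `R₀`-algebra by finitely many elements of degree one. -/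
def IsStandardGraded (𝒜 : ℕ → AddSubgroup R) [GradedRing 𝒜] : Prop :=
  ∃ s : Finset R, (∀ x ∈ s, x ∈ 𝒜 1) ∧ Algebra.adjoin (𝒜 0) (s : Set R) = ⊤

end Linkage

/-! Write 𝔟 = 𝔞 + R₊. Everything is a question about single components Hⁱ(M)ₙ: they vanish when the
homogeneous cocycles of degree n are coboundaries, and any graded injective resolution may be used
to test this (`GrMod.vanishes_iff`). Two exact sequences do the work: the long exact sequence of 0 →
M(-d) → M → M/xM → 0 for an M-regular x of degree d, and the comparison of an ideal with the ideal
enlarged by one generator (`GrMod.vanishes_sup_span_succ`). `GrMod.graded_induction` combines them: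
dividing by Γ_{R₊}(M) affects the components in a bounded range of degrees only, and if Γ_{R₊}(M) =
0, prime avoidance gives regular elements in every large degree.

Since M ≠ 0, some Hⁱ_{R₊}(M) is nonzero, and i is bounded by the number of generators of R₊. Hence c
= cd(R₊, M) is a natural number, and it is positive by assumption.

Finiteness: suppose R₊ acts nilpotently on every Hⁱ_𝔟(M). Dividing by high powers of a regular
element shows that each Hⁱ_𝔟(M)ₙ is zero for n ≪ 0, and it is always zero for n ≫ 0. Were M not
R₊-torsion, one could form a bounded quotient with a nonzero component in a degree where all its
local cohomology vanishes; truncation and Nakayama over the local ring R₀ exclude this. So M is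
R₊-torsion, and H^c_{R₊}(M) = 0 because c > 0, which is absurd.

Tameness: because H^c_𝔟(M)ₙ = 0 for n ≫ 0, it is enough that the components for n ≪ 0 are all zero
or all nonzero. If Hⁱ_{R₊}(M) = 0 for i < c, the same holds for 𝔟, and `GrMod.vanishes_dichotomy`
applies at c. This covers the relative Cohen–Macaulay case. In the remaining linked case the regular
sequence generating I is shorter than c. Linkage forces Hⁱ_{𝔞 ∩ R₊}(M) = 0 beyond the length of that
sequence, so by Mayer–Vietoris H^c_𝔟(M) maps onto H^c_{R₊}(M), whose components are nonzero for n ≪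
0 (`GrMod.exists_not_vanishes_lt`). -/

/-! ### Graded modules: components, shifts, graded submodules, direct sums. -/

section Basics

variable {R : Type u} [CommRing R] {𝒜 : ℕ → AddSubgroup R}

/-- The projection of a graded module, viewed as a finitely supported function of the degree. -/
noncomputable def GrMod.comps (M : GrMod 𝒜) : M →+ (ℤ →₀ M) :=
  (exists_proj M.deg M.isInternal).choose

/-- The homogeneous component of degree `n`. -/
noncomputable def GrMod.proj (M : GrMod 𝒜) (n : ℤ) : M →+ M :=
  (Finsupp.applyAddHom n).comp M.comps

namespace GrMod

variable (M : GrMod 𝒜)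

theorem comps_apply (x : M) (n : ℤ) : M.comps x n = M.proj n x := rfl

theorem proj_mem (x : M) (n : ℤ) : M.proj n x ∈ M.deg n :=
  (exists_proj M.deg M.isInternal).choose_spec.1 x n

theorem sum_proj (x : M) : ∑ n ∈ (M.comps x).support, M.proj n x = x :=
  (exists_proj M.deg M.isInternal).choose_spec.2.1 x

theorem comps_of_mem {x : M} {n : ℤ} (hx : x ∈ M.deg n) : M.comps x = Finsupp.single n x :=
  (exists_proj M.deg M.isInternal).choose_spec.2.2 n x hx

theorem proj_of_mem {x : M} {n : ℤ} (hx : x ∈ M.deg n) : M.proj n x = x := by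
  rw [← comps_apply, M.comps_of_mem hx, Finsupp.single_eq_same]

theorem proj_of_mem_ne {x : M} {n m : ℤ} (hx : x ∈ M.deg n) (h : m ≠ n) : M.proj m x = 0 := by
  rw [← comps_apply, M.comps_of_mem hx, Finsupp.single_eq_of_ne h]

theorem eq_zero_of_proj {x : M} (h : ∀ n, M.proj n x = 0) : x = 0 := by
  rw [← M.sum_proj x]
  exact Finset.sum_eq_zero fun n _ => h n

theorem mem_of_proj_mem {S : AddSubgroup M} {x : M} (h : ∀ n, M.proj n x ∈ S) : x ∈ S := by
  rw [← M.sum_proj x]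
  exact S.sum_mem fun n _ => h n

theorem mem_deg_of_proj {x : M} {n : ℤ} (h : ∀ m ≠ n, M.proj m x = 0) : x ∈ M.deg n := by
  refine M.mem_of_proj_mem fun m => ?_
  by_cases hm : m = n
  · subst hm; exact M.proj_mem x m
  · rw [h m hm]; exact zero_mem _

theorem proj_smul {k : ℕ} {r : R} (hr : r ∈ 𝒜 k) (x : M) (n : ℤ) :
    M.proj ((k : ℤ) + n) (r • x) = r • M.proj n x := by
  classical
  conv_lhs => rw [← M.sum_proj x, Finset.smul_sum, map_sum]
  have : ∀ m ∈ (M.comps x).support, M.proj ((k : ℤ) + n) (r • M.proj m x) =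
      if m = n then r • M.proj n x else 0 := by
    intro m _
    have h1 := M.smul_mem k m r _ hr (M.proj_mem x m)
    split_ifs with h
    · subst h; exact M.proj_of_mem h1
    · exact M.proj_of_mem_ne h1 (by omega)
  rw [Finset.sum_congr rfl this, Finset.sum_ite_eq']
  split_ifs with h
  · rfl
  · rw [← comps_apply, Finsupp.notMem_support_iff.mp h, smul_zero]

theorem proj_smul_eq {k : ℕ} {r : R} (hr : r ∈ 𝒜 k) (x : M) (n : ℤ) :
    M.proj n (r • x) = r • M.proj (n - k) x := by
  rw [← M.proj_smul hr, add_sub_cancel]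

end GrMod

theorem IsGrHom.map_proj {M N : GrMod 𝒜} {f : M →ₗ[R] N} (hf : IsGrHom f) (x : M) (n : ℤ) :
    N.proj n (f x) = f (M.proj n x) :=
  hf.proj_comm (P := M.comps) (Q := N.comps) (fun x n => M.proj_mem x n) (fun x => M.sum_proj x)
    (fun _ _ hx => N.comps_of_mem hx) x n

theorem IsGrHom.comp {M N L : GrMod 𝒜} {g : N →ₗ[R] L} {f : M →ₗ[R] N} (hg : IsGrHom g)
    (hf : IsGrHom f) : IsGrHom (g ∘ₗ f) := fun n x hx => hg n _ (hf n x hx)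

theorem IsGrHom.id (M : GrMod 𝒜) : IsGrHom (LinearMap.id : M →ₗ[R] M) := fun _ _ hx => hx

theorem IsGrHom.neg {M N : GrMod 𝒜} {f : M →ₗ[R] N} (hf : IsGrHom f) :
    IsGrHom (-f) := fun n x hx => neg_mem (hf n x hx)

theorem IsGrHom.sub {M N : GrMod 𝒜} {f g : M →ₗ[R] N} (hf : IsGrHom f) (hg : IsGrHom g) :
    IsGrHom (f - g) := fun n x hx => sub_mem (hf n x hx) (hg n x hx)

theorem IsGrHom.exists_of_map_eq {M N : GrMod 𝒜} {f : M →ₗ[R] N} (hf : IsGrHom f) {x : M} {y : N}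
    {n : ℤ} (hy : y ∈ N.deg n) (h : f x = y) : f (M.proj n x) = y := by
  rw [← hf.map_proj, h, N.proj_of_mem hy]

/-- The shifted module `M(k)`. -/
abbrev GrMod.shift (M : GrMod 𝒜) (k : ℤ) : GrMod 𝒜 where
  carrier := M
  deg n := M.deg (n + k)
  isInternal := by
    classical
    let P : M →+ (ℤ →₀ M) :=
      (Finsupp.domCongr (Equiv.subRight k) : (ℤ →₀ M) ≃+ (ℤ →₀ M)).toAddMonoidHom.comp M.comps
    have hP : ∀ x n, P x n = M.proj (n + k) x := fun x n => by
      simp [P, Finsupp.equivMapDomain_apply, GrMod.comps_apply]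
    refine isInternal_of_proj _ P ?_ ?_ ?_
    · intro x n; rw [hP]; exact M.proj_mem _ _
    · intro x
      change (Finsupp.equivMapDomain (Equiv.subRight k) (M.comps x)).sum _ = x
      rw [Finsupp.sum_equivMapDomain]
      exact M.sum_proj x
    · intro n x hx
      ext m
      rw [hP, Finsupp.single_apply]
      split_ifs with h
      · subst h; exact M.proj_of_mem hx
      · exact M.proj_of_mem_ne hx (by omega)
  smul_mem i j r x hr hx := by
    have := M.smul_mem i (j + k) r x hr hx
    rwa [← add_assoc] at this

/-- A submodule that contains the homogeneous components of its elements. -/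
def GrMod.IsGrSub (M : GrMod 𝒜) (P : Submodule R M) : Prop := ∀ x ∈ P, ∀ n, M.proj n x ∈ P

/-- A graded submodule as a graded module. -/
noncomputable abbrev GrMod.sub (M : GrMod 𝒜) (P : Submodule R M) (hP : M.IsGrSub P) : GrMod 𝒜 where
  carrier := P
  deg n := (M.deg n).comap P.subtype.toAddMonoidHom
  isInternal := by
    classical
    let T : P →+ (ℤ →₀ P) :=
      { toFun := fun x => Finsupp.onFinset (M.comps (x : M)).support
          (fun n => (⟨M.proj n x, hP x x.2 n⟩ : P)) (fun n hn => by
            rw [Finsupp.mem_support_iff, GrMod.comps_apply]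
            exact fun h => hn (Subtype.ext h))
        map_zero' := by ext n; simp
        map_add' := fun x y => by ext n; simp }
    have hT : ∀ x n, ((T x n : P) : M) = M.proj n x := fun x n => rfl
    refine isInternal_of_proj _ T ?_ ?_ ?_
    · intro x n; exact M.proj_mem _ _
    · intro x
      apply Subtype.ext
      change P.subtype ((T x).sum fun _ c => c) = _
      rw [Finsupp.sum_of_support_subset (s := (M.comps (x : M)).support) _ ?_ _ (fun _ _ => rfl),
        map_sum]
      · exact M.sum_proj x
      · intro n hn
        rw [Finsupp.mem_support_iff] at hn ⊢
        exact fun h => hn (Subtype.ext h)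
    · intro n x hx
      ext m
      rw [hT, Finsupp.single_apply]
      split_ifs with h
      · subst h; exact M.proj_of_mem hx
      · exact M.proj_of_mem_ne (n := n) hx (Ne.symm h)
  smul_mem i j r x hr hx := M.smul_mem i j r x hr hx

theorem GrMod.sub_subtype_grHom (M : GrMod 𝒜) (P : Submodule R M) (hP : M.IsGrSub P) :
    IsGrHom (M := M.sub P hP) (N := M) P.subtype := fun _ _ hx => hx

/-- The direct sum of two graded modules. -/
noncomputable abbrev GrMod.prod (M N : GrMod 𝒜) : GrMod 𝒜 where
  carrier := M × N
  deg n := (M.deg n).prod (N.deg n)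
  isInternal := by
    classical
    let T : M × N →+ (ℤ →₀ M × N) :=
      ((Finsupp.mapRange.addMonoidHom (AddMonoidHom.inl M N)).comp M.comps).coprod
        ((Finsupp.mapRange.addMonoidHom (AddMonoidHom.inr M N)).comp N.comps)
    have hT : ∀ x n, T x n = (M.proj n x.1, N.proj n x.2) := fun x n => by
      simp [T, GrMod.comps_apply]
    refine isInternal_of_proj _ T ?_ ?_ ?_
    · intro x n; rw [hT]; exact ⟨M.proj_mem _ _, N.proj_mem _ _⟩
    · rintro ⟨x, y⟩
      rw [Finsupp.sum_of_support_subset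
        (s := (M.comps x).support ∪ (N.comps y).support) _ ?_ _ (fun _ _ => rfl)]
      · simp only [hT]
        ext
        · rw [Prod.fst_sum]
          conv_rhs => rw [← M.sum_proj x]
          refine (Finset.sum_subset Finset.subset_union_left fun n _ hn => ?_).symm
          rw [← GrMod.comps_apply]; exact Finsupp.notMem_support_iff.mp hn
        · rw [Prod.snd_sum]
          conv_rhs => rw [← N.sum_proj y]
          refine (Finset.sum_subset Finset.subset_union_right fun n _ hn => ?_).symm
          rw [← GrMod.comps_apply]; exact Finsupp.notMem_support_iff.mp hn
      · intro n hn
        by_contra h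
        rw [Finset.mem_union, not_or, Finsupp.notMem_support_iff, Finsupp.notMem_support_iff,
          GrMod.comps_apply, GrMod.comps_apply] at h
        rw [Finsupp.mem_support_iff, hT] at hn
        exact hn (Prod.ext h.1 h.2)
    · rintro n ⟨x, y⟩ ⟨hx, hy⟩
      refine Finsupp.ext fun m => ?_
      rw [hT, Finsupp.single_apply]
      split_ifs with h
      · subst h; exact Prod.ext (M.proj_of_mem hx) (N.proj_of_mem hy)
      · exact Prod.ext (M.proj_of_mem_ne hx (Ne.symm h)) (N.proj_of_mem_ne hy (Ne.symm h))
  smul_mem i j r x hr hx := ⟨M.smul_mem i j r _ hr hx.1, N.smul_mem i j r _ hr hx.2⟩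

theorem IsGrInjective.prod {M N : GrMod 𝒜} (hM : IsGrInjective M) (hN : IsGrInjective N) :
    IsGrInjective (M.prod N) := by
  intro X Y i g hi hinj hg
  obtain ⟨h₁, hh₁, e₁⟩ := hM X Y i (LinearMap.fst R M N ∘ₗ g) hi hinj fun n x hx => (hg n x hx).1
  obtain ⟨h₂, hh₂, e₂⟩ := hN X Y i (LinearMap.snd R M N ∘ₗ g) hi hinj fun n x hx => (hg n x hx).2
  exact ⟨h₁.prod h₂, fun n x hx => ⟨hh₁ n x hx, hh₂ n x hx⟩,
    fun x => Prod.ext (e₁ x) (e₂ x)⟩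

theorem IsGrInjective.shift {E : GrMod 𝒜} (hE : IsGrInjective E) (k : ℤ) :
    IsGrInjective (E.shift k) := by
  intro X Y i g hi hinj hg
  obtain ⟨h, hh, e⟩ := hE (X.shift (-k)) (Y.shift (-k)) i g (fun n x hx => hi _ x hx) hinj
    (fun n x hx => by
      have := hg _ x hx
      change g x ∈ E.deg _ at this
      rwa [neg_add_cancel_right] at this)
  refine ⟨h, fun n x hx => hh (n + k) x ?_, e⟩
  change x ∈ Y.deg _
  rwa [add_neg_cancel_right]

/-- A map to an injective module factors through any map with smaller kernel. -/
theorem IsGrInjective.exists_factor {X Y E : GrMod 𝒜} (hE : IsGrInjective E) {w : X →ₗ[R] Y}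
    {g : X →ₗ[R] E} (hw : IsGrHom w) (hg : IsGrHom g) (hker : ∀ x, w x = 0 → g x = 0) :
    ∃ h : Y →ₗ[R] E, IsGrHom h ∧ ∀ x, h (w x) = g x := by
  have hP : Y.IsGrSub (LinearMap.range w) := by
    rintro _ ⟨x, rfl⟩ n
    exact ⟨_, (hw.map_proj x n).symm⟩
  let g' : LinearMap.range w →ₗ[R] E :=
    ((LinearMap.ker w).liftQ g hker) ∘ₗ w.quotKerEquivRange.symm.toLinearMap
  have hg' : ∀ x, g' ⟨w x, x, rfl⟩ = g x := by
    intro x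
    have : w.quotKerEquivRange.symm ⟨w x, x, rfl⟩ = (LinearMap.ker w).mkQ x := by
      rw [LinearEquiv.symm_apply_eq]; rfl
    simp only [g', LinearMap.comp_apply, LinearEquiv.coe_coe, this]
    rfl
  obtain ⟨h, hh, e⟩ := hE (Y.sub _ hP) Y (LinearMap.range w).subtype g'
    (Y.sub_subtype_grHom _ hP) Subtype.val_injective (by
      rintro n ⟨y, x, rfl⟩ hx
      have hx' : w (X.proj n x) = w x := hw.exists_of_map_eq hx rfl
      have : (⟨w x, x, rfl⟩ : LinearMap.range w) = ⟨w (X.proj n x), _, rfl⟩ := Subtype.ext hx'.symm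
      have h2 := hg n _ (X.proj_mem x n)
      rw [← hg'] at h2
      exact (congrArg (· ∈ E.deg n) (congrArg g' this)).mpr h2)
  exact ⟨h, hh, fun x => (e ⟨w x, x, rfl⟩).trans (hg' x)⟩

end Basics

/-! ### Torsion submodules with respect to ideals. -/

section Torsion

variable {R : Type u} [CommRing R]

theorem map_mem_gammaTorsion {a : Ideal R} {M N : Type u} [AddCommGroup M] [Module R M]
    [AddCommGroup N] [Module R N] (f : M →ₗ[R] N) {x : M} (hx : x ∈ gammaTorsion a M) :
    f x ∈ gammaTorsion a N := by
  obtain ⟨k, hk⟩ := hx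
  exact ⟨k, fun r hr => by rw [← map_smul, hk r hr, map_zero]⟩

theorem gammaTorsion_anti {a b : Ideal R} (h : a ≤ b) (M : Type u) [AddCommGroup M] [Module R M] :
    gammaTorsion b M ≤ gammaTorsion a M := by
  rintro x ⟨k, hk⟩
  exact ⟨k, fun r hr => hk r (Ideal.pow_right_mono h k hr)⟩

theorem gammaTorsion_sup (a b : Ideal R) (M : Type u) [AddCommGroup M] [Module R M] :
    gammaTorsion (a ⊔ b) M = gammaTorsion a M ⊓ gammaTorsion b M := by
  apply le_antisymm
  · exact le_inf (gammaTorsion_anti le_sup_left M) (gammaTorsion_anti le_sup_right M)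
  · rintro x ⟨⟨k, hk⟩, ⟨l, hl⟩⟩
    refine ⟨k + l, fun r hr => ?_⟩
    obtain ⟨s, hs, t, ht, rfl⟩ := Submodule.mem_sup.mp (Ideal.sup_pow_add_le_pow_sup_pow hr)
    rw [add_smul, hk s hs, hl t ht, add_zero]

theorem mem_gammaTorsion_span_singleton {r : R} {M : Type u} [AddCommGroup M] [Module R M] {x : M} :
    x ∈ gammaTorsion (Ideal.span {r}) M ↔ ∃ k : ℕ, r ^ k • x = 0 := by
  constructor
  · rintro ⟨k, hk⟩
    exact ⟨k, hk _ (Ideal.pow_mem_pow (Ideal.mem_span_singleton_self r) k)⟩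
  · rintro ⟨k, hk⟩
    refine ⟨k, fun s hs => ?_⟩
    rw [Ideal.span_singleton_pow, Ideal.mem_span_singleton'] at hs
    obtain ⟨t, rfl⟩ := hs
    rw [mul_smul, hk, smul_zero]

theorem gammaTorsion_bot (M : Type u) [AddCommGroup M] [Module R M] :
    gammaTorsion (⊥ : Ideal R) M = ⊤ :=
  eq_top_iff.mpr fun x _ => ⟨1, fun r hr => by
    rw [pow_one] at hr; rw [(Submodule.mem_bot R).mp hr, zero_smul]⟩

theorem exists_pow_smul_of_mem_gammaTorsion {a : Ideal R} {r : R} (hr : r ∈ a) {M : Type u}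
    [AddCommGroup M] [Module R M] {x : M} (hx : x ∈ gammaTorsion a M) : ∃ k : ℕ, r ^ k • x = 0 := by
  obtain ⟨k, hk⟩ := hx
  exact ⟨k, hk _ (Ideal.pow_mem_pow hr k)⟩

variable {𝒜 : ℕ → AddSubgroup R} [GradedRing 𝒜]

theorem Ideal.IsHomogeneous.pow {a : Ideal R} (ha : a.IsHomogeneous 𝒜) (k : ℕ) :
    (a ^ k).IsHomogeneous 𝒜 := by
  induction k with
  | zero => rw [pow_zero, Ideal.one_eq_top]; exact Ideal.IsHomogeneous.top 𝒜
  | succ k ih => rw [pow_succ]; exact ih.mul ha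

/-- A homogeneous ideal kills the homogeneous components of the elements it kills. -/
theorem GrMod.smul_proj_eq_zero (M : GrMod 𝒜) {a : Ideal R} (ha : a.IsHomogeneous 𝒜) {x : M}
    (hx : ∀ r ∈ a, r • x = 0) (n : ℤ) : ∀ r ∈ a, r • M.proj n x = 0 := by
  classical
  intro r hr
  rw [← DirectSum.sum_support_decompose 𝒜 r, Finset.sum_smul]
  refine Finset.sum_eq_zero fun i _ => ?_
  rw [← M.proj_smul (SetLike.coe_mem _), hx _ (ha i hr), map_zero]

theorem GrMod.isGrSub_gammaTorsion (M : GrMod 𝒜) {a : Ideal R} (ha : a.IsHomogeneous 𝒜) :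
    M.IsGrSub (gammaTorsion a M) := by
  rintro x ⟨k, hk⟩ n
  exact ⟨k, M.smul_proj_eq_zero (ha.pow k) hk n⟩

end Torsion

/-! ### A graded form of Baer's criterion. -/

section IdealExtension

variable {R : Type u} [CommRing R] {𝒜 : ℕ → AddSubgroup R} [GradedRing 𝒜]

/-- The homogeneous components of `R` indexed by the integers. -/
def ringDeg (𝒜 : ℕ → AddSubgroup R) : ℤ → AddSubgroup R
  | Int.ofNat k => 𝒜 k
  | Int.negSucc _ => ⊥

/-- The ring `R` as a graded module. -/
noncomputable abbrev ringGrMod (𝒜 : ℕ → AddSubgroup R) [GradedRing 𝒜] : GrMod 𝒜 where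
  carrier := R
  deg := ringDeg 𝒜
  isInternal := by
    classical
    let T₀ : DirectSum ℕ (fun i => 𝒜 i) →+ (ℤ →₀ R) :=
      DirectSum.toAddMonoid fun i => (Finsupp.singleAddHom (i : ℤ)).comp (𝒜 i).subtype
    let T : R →+ (ℤ →₀ R) := T₀.comp (DirectSum.decomposeAddEquiv 𝒜).toAddMonoidHom
    have hT : ∀ k, ∀ r ∈ 𝒜 k, T r = Finsupp.single (k : ℤ) r := by
      intro k r hr
      have : DirectSum.decompose 𝒜 r = DirectSum.of (fun i => 𝒜 i) k ⟨r, hr⟩ :=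
        DirectSum.decompose_of_mem 𝒜 hr
      simp [T, T₀, this]
    refine isInternal_of_proj _ T ?_ ?_ ?_
    · intro x n
      induction x using DirectSum.Decomposition.inductionOn 𝒜 with
      | zero => simp
      | homogeneous r =>
        rw [hT _ _ r.2, Finsupp.single_apply]
        split_ifs with h
        · subst h; exact r.2
        · exact zero_mem _
      | add x y hx hy => rw [map_add]; exact add_mem hx hy
    · intro x
      induction x using DirectSum.Decomposition.inductionOn 𝒜 with
      | zero => simp
      | homogeneous r => rw [hT _ _ r.2, Finsupp.sum_single_index rfl]
      | add x y hx hy =>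
        rw [map_add, Finsupp.sum_add_index' (fun _ => rfl) (fun _ _ _ => rfl), hx, hy]
    · rintro (n | n) x hx
      · exact hT n x hx
      · rw [show x = 0 from hx]; simp
  smul_mem := by
    rintro i (j | j) r x hr hx
    · exact SetLike.GradedMul.mul_mem (A := 𝒜) hr hx
    · rw [show x = 0 from hx, smul_zero]; exact zero_mem _

/-- A homogeneous linear map of degree `n` from a homogeneous ideal to an injective module is the
multiplication with an element of degree `n`. -/
theorem IsGrInjective.exists_eq_smul {E : GrMod 𝒜} (hE : IsGrInjective E) {c : Ideal R}
    (hc : c.IsHomogeneous 𝒜) (n : ℤ) (f : c →ₗ[R] E)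
    (hf : ∀ (k : ℕ) (r : c), (r : R) ∈ 𝒜 k → f r ∈ E.deg ((k : ℤ) + n)) :
    ∃ e ∈ E.deg n, ∀ r : c, f r = (r : R) • e := by
  classical
  have hproj : ∀ (r : R) (k : ℕ), (ringGrMod 𝒜).proj (k : ℤ) r =
      (DirectSum.decompose 𝒜 r k : R) := by
    intro r k
    induction r using DirectSum.Decomposition.inductionOn 𝒜 with
    | zero => simp
    | @homogeneous i r =>
      have hr : (r : R) ∈ (ringGrMod 𝒜).deg (i : ℤ) := r.2
      by_cases h : i = k
      · subst h
        rw [(ringGrMod 𝒜).proj_of_mem hr, DirectSum.decompose_of_mem_same 𝒜 r.2]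
      · rw [(ringGrMod 𝒜).proj_of_mem_ne hr (by simpa using Ne.symm h), DirectSum.decompose_of_mem_ne 𝒜 r.2 h]
    | add x y hx hy =>
      have := map_add ((ringGrMod 𝒜).proj (k : ℤ)) x y
      rw [DirectSum.decompose_add, DirectSum.add_apply, AddSubgroup.coe_add, ← hx, ← hy]
      exact this
  have hc' : (ringGrMod 𝒜).IsGrSub c := by
    rintro x hx (k | k)
    · have := hproj x k
      rw [Int.ofNat_eq_natCast, this]; exact hc k hx
    · have : (ringGrMod 𝒜).proj (Int.negSucc k) x = 0 := (ringGrMod 𝒜).proj_mem x (Int.negSucc k)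
      rw [this]; exact zero_mem _
  obtain ⟨h, hh, e⟩ := hE.shift n ((ringGrMod 𝒜).sub c hc') (ringGrMod 𝒜) c.subtype f
    ((ringGrMod 𝒜).sub_subtype_grHom c hc') Subtype.val_injective (by
      rintro (k | k) r hr
      · exact hf k r hr
      · obtain rfl : r = 0 := Subtype.ext hr
        exact (map_zero f).symm ▸ zero_mem (E.deg _))
  refine ⟨h (1 : R), ?_, fun r => ?_⟩
  · have := hh 0 (1 : R) (SetLike.one_mem_graded 𝒜)
    change _ ∈ E.deg _ at this
    rwa [zero_add] at this
  · have h2 := h.map_smul (r : R) (1 : R)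
    have h3 : ((r : R) • (1 : R) : ringGrMod 𝒜) = c.subtype r := mul_one _
    exact (e r).symm.trans ((congrArg h h3.symm).trans h2)

end IdealExtension

/-- Dependent choice; it drives the recursive constructions of chain maps, homotopies and horseshoe
differentials, each of which extends a map one degree at a time. -/
theorem exists_dependent_seq {α : ℕ → Type*} (a₀ : α 0) (r : ∀ i, α i → α (i + 1) → Prop)
    (h : ∀ i a, ∃ b, r i a b) : ∃ f : ∀ i, α i, f 0 = a₀ ∧ ∀ i, r i (f i) (f (i + 1)) := by
  choose F hF using h
  exact ⟨fun i => Nat.rec a₀ (fun i a => F i a) i, rfl, fun i => hF i _⟩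

/-! ### Comparison of injective resolutions. -/

section Lifts

variable {R : Type u} [CommRing R] {𝒜 : ℕ → AddSubgroup R}

theorem GrInjRes.d_ε {M : GrMod 𝒜} (J : GrInjRes M) (x : M) : J.d 0 (J.ε x) = 0 :=
  (J.exact_zero _).mpr ⟨x, rfl⟩

theorem GrInjRes.d_d {M : GrMod 𝒜} (J : GrInjRes M) (i : ℕ) (x : J.obj i) :
    J.d (i + 1) (J.d i x) = 0 :=
  (J.exact_succ i _).mpr ⟨x, rfl⟩

/-- Homogeneous chain maps between resolutions that lift `f`. -/
structure GrLift {M N : GrMod 𝒜} (J : GrInjRes M) (K : GrInjRes N) (f : M →ₗ[R] N) where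
  map : ∀ i, J.obj i →ₗ[R] K.obj i
  grHom : ∀ i, IsGrHom (map i)
  comm_ε : ∀ x, map 0 (J.ε x) = K.ε (f x)
  comm_d : ∀ i x, map (i + 1) (J.d i x) = K.d i (map i x)

variable {M N L : GrMod 𝒜} {J : GrInjRes M} {K : GrInjRes N} {f : M →ₗ[R] N}

theorem GrLift.nonempty (J : GrInjRes M) (K : GrInjRes N) (hf : IsGrHom f) :
    Nonempty (GrLift J K f) := by
  -- The invariant stored with φ says that d ∘ φ kills ker d, which is what `exists_factor` needs to
  -- produce the next map.
  let α : ℕ → Type u := fun i =>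
    {φ : J.obj i →ₗ[R] K.obj i // IsGrHom φ ∧ ∀ x, J.d i x = 0 → K.d i (φ x) = 0}
  obtain ⟨φ₀, h₀, e₀⟩ := (K.inj 0).exists_factor J.ε_grHom (K.ε_grHom.comp hf) (fun x hx => by
    rw [(map_eq_zero_iff _ J.ε_injective).mp hx, map_zero])
  have h₀' : ∀ x, J.d 0 x = 0 → K.d 0 (φ₀ x) = 0 := by
    intro x hx
    obtain ⟨m, rfl⟩ := (J.exact_zero x).mp hx
    rw [e₀]
    exact K.d_ε _
  obtain ⟨φ, hφ₀, hφ⟩ := exists_dependent_seq (α := α) ⟨φ₀, h₀, h₀'⟩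
    (fun i a b => ∀ x, b.1 (J.d i x) = K.d i (a.1 x)) (by
      rintro i ⟨φ, hφ, hk⟩
      obtain ⟨ψ, hψ, e⟩ := (K.inj (i + 1)).exists_factor (J.d_grHom i) ((K.d_grHom i).comp hφ) hk
      refine ⟨⟨ψ, hψ, fun x hx => ?_⟩, e⟩
      obtain ⟨y, rfl⟩ := (J.exact_succ i x).mp hx
      rw [e]
      exact K.d_d i _)
  refine ⟨⟨fun i => (φ i).1, fun i => (φ i).2.1, fun x => ?_, hφ⟩⟩
  rw [hφ₀]
  exact e₀ x

/-- The identity lift. -/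
def GrLift.id (J : GrInjRes M) : GrLift J J LinearMap.id where
  map _ := LinearMap.id
  grHom _ := IsGrHom.id _
  comm_ε _ := rfl
  comm_d _ _ := rfl

/-- The composition of lifts. -/
def GrLift.comp {P : GrInjRes L} {g : N →ₗ[R] L} (ψ : GrLift K P g) (φ : GrLift J K f) :
    GrLift J P (g ∘ₗ f) where
  map i := ψ.map i ∘ₗ φ.map i
  grHom i := (ψ.grHom i).comp (φ.grHom i)
  comm_ε x := by simp [φ.comm_ε, ψ.comm_ε]
  comm_d i x := by simp [φ.comm_d, ψ.comm_d]

theorem GrLift.map_cocycles (φ : GrLift J K f) {a : Ideal R} {i : ℕ} {z : J.obj i}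
    (hz : z ∈ J.cocycles a i) : φ.map i z ∈ K.cocycles a i := by
  refine ⟨map_mem_gammaTorsion _ hz.1, ?_⟩
  have h2 : J.d i z = 0 := hz.2
  change K.d i _ = 0
  rw [← φ.comm_d, h2, map_zero]

theorem GrLift.map_coboundaries (φ : GrLift J K f) {a : Ideal R} {i : ℕ} {z : J.obj i}
    (hz : z ∈ J.coboundaries a i) : φ.map i z ∈ K.coboundaries a i := by
  cases i with
  | zero =>
    rw [show z = 0 from hz, map_zero]
    exact zero_mem _
  | succ i =>
    obtain ⟨x, hx, rfl⟩ := hz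
    rw [φ.comm_d]
    exact ⟨_, map_mem_gammaTorsion _ hx, rfl⟩

/-- Two lifts of the same map are homotopic. -/
theorem GrLift.exists_homotopy (φ ψ : GrLift J K f) :
    ∃ s : ∀ i, J.obj (i + 1) →ₗ[R] K.obj i,
      (∀ x, s 0 (J.d 0 x) = φ.map 0 x - ψ.map 0 x) ∧
      ∀ i x, s (i + 1) (J.d (i + 1) x) = φ.map (i + 1) x - ψ.map (i + 1) x - K.d i (s i x) := by
  -- The invariant d s d = d (φ - ψ) makes φ - ψ - d s vanish on the image of d in the next degree,
  -- so that it factors through the next differential.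
  let α : ℕ → Type u := fun i =>
    {s : J.obj (i + 1) →ₗ[R] K.obj i // IsGrHom s ∧
      ∀ x, K.d i (s (J.d i x)) = K.d i (φ.map i x - ψ.map i x)}
  obtain ⟨s₀, h₀, e₀⟩ := (K.inj 0).exists_factor (J.d_grHom 0) ((φ.grHom 0).sub (ψ.grHom 0))
    (fun x hx => by
      obtain ⟨m, rfl⟩ := (J.exact_zero x).mp hx
      rw [LinearMap.sub_apply, φ.comm_ε, ψ.comm_ε, sub_self])
  obtain ⟨s, hs₀, hs⟩ := exists_dependent_seq (α := α) ⟨s₀, h₀, fun x => by rw [e₀]; rfl⟩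
    (fun i a b => ∀ x, b.1 (J.d (i + 1) x) =
      φ.map (i + 1) x - ψ.map (i + 1) x - K.d i (a.1 x)) (by
      rintro i ⟨s, hs, hk⟩
      obtain ⟨t, ht, e⟩ := (K.inj (i + 1)).exists_factor (J.d_grHom (i + 1))
        (((φ.grHom (i + 1)).sub (ψ.grHom (i + 1))).sub ((K.d_grHom i).comp hs)) (fun x hx => by
          obtain ⟨y, rfl⟩ := (J.exact_succ i x).mp hx
          rw [LinearMap.sub_apply, LinearMap.sub_apply, LinearMap.comp_apply, hk, φ.comm_d,
            ψ.comm_d, map_sub, sub_self])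
      refine ⟨⟨t, ht, fun x => ?_⟩, fun x => by rw [e]; rfl⟩
      rw [e, LinearMap.sub_apply, map_sub, LinearMap.comp_apply, K.d_d, sub_zero]
      rfl)
  refine ⟨fun i => (s i).1, fun x => ?_, hs⟩
  beta_reduce
  rw [hs₀]
  exact e₀ x

/-- A homotopy is linear and so preserves torsion: on a cocycle the difference of the lifts is the
differential of a torsion element. This makes the induced maps on cohomology independent of the
lift. -/
theorem GrLift.sub_mem_coboundaries (φ ψ : GrLift J K f) {a : Ideal R} {i : ℕ} {z : J.obj i}
    (hz : z ∈ J.cocycles a i) : φ.map i z - ψ.map i z ∈ K.coboundaries a i := by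
  obtain ⟨s, hs₀, hs⟩ := φ.exists_homotopy ψ
  have h2 : J.d i z = 0 := hz.2
  cases i with
  | zero =>
    rw [← hs₀, h2, map_zero]
    exact zero_mem _
  | succ i =>
    have := hs i z
    rw [h2, map_zero, eq_comm, sub_eq_zero] at this
    rw [this]
    exact ⟨_, map_mem_gammaTorsion _ hz.1, rfl⟩

theorem GrLift.congr_coboundaries {g : M →ₗ[R] N} (φ : GrLift J K f) (ψ : GrLift J K g)
    (h : ∀ x, f x = g x) {a : Ideal R} {i : ℕ} {z : J.obj i} (hz : z ∈ J.cocycles a i) :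
    φ.map i z - ψ.map i z ∈ K.coboundaries a i := by
  obtain rfl : f = g := LinearMap.ext h
  exact φ.sub_mem_coboundaries ψ hz

/-- The shift of a resolution. -/
def GrInjRes.shift (J : GrInjRes M) (k : ℤ) : GrInjRes (M.shift k) where
  obj i := (J.obj i).shift k
  inj i := (J.inj i).shift k
  ε := J.ε
  ε_grHom _ x hx := J.ε_grHom _ x hx
  ε_injective := J.ε_injective
  d i := J.d i
  d_grHom i _ x hx := J.d_grHom i _ x hx
  exact_zero := J.exact_zero
  exact_succ i := J.exact_succ i

theorem smul_grHom (M : GrMod 𝒜) {d : ℕ} {x : R} (hx : x ∈ 𝒜 d) :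
    IsGrHom (M := M.shift (-d)) (N := M) (LinearMap.lsmul R M x) := by
  intro n m hm
  have h := M.smul_mem d (n + -d) x m hx hm
  rwa [show (d : ℤ) + (n + -d) = n by ring] at h

/-- Multiplication by a homogeneous element as a lift. -/
def GrLift.smul (J : GrInjRes M) {d : ℕ} {x : R} (hx : x ∈ 𝒜 d) :
    GrLift (J.shift (-d)) J (LinearMap.lsmul R M x) where
  map i := LinearMap.lsmul R (J.obj i) x
  grHom i := smul_grHom (J.obj i) hx
  comm_ε m := (map_smul J.ε x m).symm
  comm_d i e := (map_smul (J.d i) x e).symm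

end Lifts

/-! ### The horseshoe lemma. -/

section Horseshoe

variable {R : Type u} [CommRing R] {𝒜 : ℕ → AddSubgroup R}

/-- Short exact sequences of graded modules. -/
structure GrShortExact {M' M M'' : GrMod 𝒜} (f : M' →ₗ[R] M) (g : M →ₗ[R] M'') : Prop where
  f_grHom : IsGrHom f
  g_grHom : IsGrHom g
  injective : Function.Injective f
  surjective : Function.Surjective g
  exact : Function.Exact f g

variable {M' M M'' : GrMod 𝒜} {f : M' →ₗ[R] M} {g : M →ₗ[R] M''}

/-- The differential on E' ⊕ E'' will be (p, q) ↦ (d'p + θq, d''q). The signs in the relations for θ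
are those that make it square to zero, and `ev` is the first coordinate of the augmentation. -/
theorem GrShortExact.exists_horseshoe (h : GrShortExact f g) (J' : GrInjRes M')
    (J'' : GrInjRes M'') :
    ∃ (ev : M →ₗ[R] J'.obj 0) (θ : ∀ i, J''.obj i →ₗ[R] J'.obj (i + 1)),
      IsGrHom ev ∧ (∀ i, IsGrHom (θ i)) ∧ (∀ x, ev (f x) = J'.ε x) ∧
      (∀ x, θ 0 (J''.ε (g x)) = -J'.d 0 (ev x)) ∧
      ∀ i x, θ (i + 1) (J''.d i x) = -J'.d (i + 1) (θ i x) := by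
  obtain ⟨ev, hev, eev⟩ := (J'.inj 0).exists_factor h.f_grHom J'.ε_grHom (fun x hx => by
    rw [(map_eq_zero_iff _ h.injective).mp hx, map_zero])
  obtain ⟨θ₀, hθ₀, eθ₀⟩ := (J'.inj 1).exists_factor (J''.ε_grHom.comp h.g_grHom)
    ((J'.d_grHom 0).comp hev).neg (fun x hx => by
      have hx' : g x = 0 := (map_eq_zero_iff _ J''.ε_injective).mp hx
      obtain ⟨y, rfl⟩ := (h.exact x).mp hx'
      rw [LinearMap.neg_apply, LinearMap.comp_apply, eev, J'.d_ε, neg_zero])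
  let α : ℕ → Type u := fun i =>
    {θ : J''.obj i →ₗ[R] J'.obj (i + 1) // IsGrHom θ ∧
      ∀ x, J''.d i x = 0 → J'.d (i + 1) (θ x) = 0}
  obtain ⟨θ, hs₀, hs⟩ := exists_dependent_seq (α := α) ⟨θ₀, hθ₀, fun x hx => by
      obtain ⟨y, rfl⟩ := (J''.exact_zero x).mp hx
      obtain ⟨m, rfl⟩ := h.surjective y
      have := eθ₀ m
      rw [LinearMap.comp_apply] at this
      rw [this, LinearMap.neg_apply, map_neg, LinearMap.comp_apply, J'.d_d, neg_zero]⟩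
    (fun i a b => ∀ x, b.1 (J''.d i x) = -J'.d (i + 1) (a.1 x)) (by
      rintro i ⟨θ, hθ, hk⟩
      obtain ⟨t, ht, e⟩ := (J'.inj (i + 1 + 1)).exists_factor (J''.d_grHom i)
        ((J'.d_grHom (i + 1)).comp hθ).neg (fun x hx => by
          rw [LinearMap.neg_apply, LinearMap.comp_apply, hk x hx, neg_zero])
      refine ⟨⟨t, ht, fun x hx => ?_⟩, e⟩
      obtain ⟨y, rfl⟩ := (J''.exact_succ i x).mp hx
      rw [e, LinearMap.neg_apply, map_neg, LinearMap.comp_apply, J'.d_d, neg_zero])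
  refine ⟨ev, fun i => (θ i).1, hev, fun i => (θ i).2.1, eev, fun x => ?_, hs⟩
  beta_reduce
  rw [hs₀]
  exact eθ₀ x

/-- The resolution `E' ⊕ E''` of the middle term of a short exact sequence. -/
noncomputable def GrShortExact.horseshoe (h : GrShortExact f g) {J' : GrInjRes M'}
    {J'' : GrInjRes M''} {ev : M →ₗ[R] J'.obj 0} {θ : ∀ i, J''.obj i →ₗ[R] J'.obj (i + 1)}
    (hev : IsGrHom ev) (hθ : ∀ i, IsGrHom (θ i)) (hevf : ∀ x, ev (f x) = J'.ε x)
    (hθ₀ : ∀ x, θ 0 (J''.ε (g x)) = -J'.d 0 (ev x))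
    (hθs : ∀ i x, θ (i + 1) (J''.d i x) = -J'.d (i + 1) (θ i x)) : GrInjRes M where
  obj i := (J'.obj i).prod (J''.obj i)
  inj i := (J'.inj i).prod (J''.inj i)
  ε := ev.prod (J''.ε ∘ₗ g)
  ε_grHom n x hx := ⟨hev n x hx, J''.ε_grHom n _ (h.g_grHom n x hx)⟩
  ε_injective := by
    rw [injective_iff_map_eq_zero]
    intro x hx
    have h1 : ev x = 0 := congrArg Prod.fst hx
    have h2 : J''.ε (g x) = 0 := congrArg Prod.snd hx
    obtain ⟨y, rfl⟩ := (h.exact x).mp ((map_eq_zero_iff _ J''.ε_injective).mp h2)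
    rw [hevf] at h1
    rw [(map_eq_zero_iff _ J'.ε_injective).mp h1, map_zero]
  d i := ((J'.d i).coprod (θ i)).prod (J''.d i ∘ₗ LinearMap.snd R (J'.obj i) (J''.obj i))
  d_grHom i n x hx :=
    ⟨add_mem (J'.d_grHom i n _ hx.1) (hθ i n _ hx.2), J''.d_grHom i n _ hx.2⟩
  exact_zero := by
    rintro ⟨p, q⟩
    constructor
    · intro hx
      have h1 : J'.d 0 p + θ 0 q = 0 := congrArg Prod.fst hx
      have h2 : J''.d 0 q = 0 := congrArg Prod.snd hx
      obtain ⟨y, rfl⟩ := (J''.exact_zero q).mp h2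
      obtain ⟨m, rfl⟩ := h.surjective y
      rw [hθ₀, ← sub_eq_add_neg, ← map_sub] at h1
      obtain ⟨m', hm'⟩ := (J'.exact_zero _).mp h1
      refine ⟨m + f m', Prod.ext ?_ ?_⟩
      · change ev (m + f m') = p
        rw [map_add, hevf, hm']; abel
      · change J''.ε (g (m + f m')) = J''.ε (g m)
        rw [map_add, h.exact.apply_apply_eq_zero, add_zero]
    · rintro ⟨m, hm⟩
      rw [← hm]
      refine Prod.ext ?_ ?_
      · change J'.d 0 (ev m) + θ 0 (J''.ε (g m)) = 0
        rw [hθ₀, add_neg_cancel]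
      · exact J''.d_ε _
  exact_succ i := by
    rintro ⟨p, q⟩
    constructor
    · intro hx
      have h1 : J'.d (i + 1) p + θ (i + 1) q = 0 := congrArg Prod.fst hx
      have h2 : J''.d (i + 1) q = 0 := congrArg Prod.snd hx
      obtain ⟨w, rfl⟩ := (J''.exact_succ i q).mp h2
      rw [hθs, ← sub_eq_add_neg, ← map_sub] at h1
      obtain ⟨v, hv⟩ := (J'.exact_succ i _).mp h1
      refine ⟨(v, w), Prod.ext ?_ rfl⟩
      change J'.d i v + θ i w = p
      rw [hv, sub_add_cancel]
    · rintro ⟨⟨v, w⟩, hm⟩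
      rw [← hm]
      refine Prod.ext ?_ ?_
      · change J'.d (i + 1) (J'.d i v + θ i w) + θ (i + 1) (J''.d i w) = 0
        rw [map_add, J'.d_d, hθs, zero_add, add_neg_cancel]
      · exact J''.d_d i w

end Horseshoe

/-! ### The long exact cohomology sequence. -/

section LongExact

variable {R : Type u} [CommRing R] {𝒜 : ℕ → AddSubgroup R}
  {M' M M'' : GrMod 𝒜} {f : M' →ₗ[R] M} {g : M →ₗ[R] M''}
  {J' : GrInjRes M'} {J : GrInjRes M} {J'' : GrInjRes M''}

theorem GrLift.sub_comp_mem_coboundaries {N : GrMod 𝒜} {K : GrInjRes N} {e : M →ₗ[R] N}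
    {e' : N →ₗ[R] M} (α : GrLift J K e) (β : GrLift K J e') (he : ∀ x, e' (e x) = x)
    {a : Ideal R} {i : ℕ} {z : J.obj i} (hz : z ∈ J.cocycles a i) :
    z - β.map i (α.map i z) ∈ J.coboundaries a i :=
  (GrLift.id J).congr_coboundaries (β.comp α) (fun x => (he x).symm) hz

/-- The exactness of the long cohomology sequence, in terms of cocycles and coboundaries. -/
theorem GrShortExact.long_exact (h : GrShortExact f g) (φ : GrLift J' J f) (ψ : GrLift J J'' g) :
    (∀ (a : Ideal R) (i : ℕ), ∀ z ∈ J.cocycles a i, ψ.map i z ∈ J''.coboundaries a i →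
      ∃ w ∈ J'.cocycles a i, z - φ.map i w ∈ J.coboundaries a i) ∧
    (∀ a : Ideal R, ∀ z ∈ J'.cocycles a 0, φ.map 0 z ∈ J.coboundaries a 0 → z = 0) ∧
    ∃ δ : ∀ i, J''.obj i →ₗ[R] J'.obj (i + 1), ∀ i, IsGrHom (δ i) ∧ ∀ a : Ideal R,
      (∀ z ∈ J''.cocycles a i, δ i z ∈ J'.cocycles a (i + 1)) ∧
      (∀ z ∈ J''.coboundaries a i, δ i z ∈ J'.coboundaries a (i + 1)) ∧
      (∀ z ∈ J''.cocycles a i, δ i z ∈ J'.coboundaries a (i + 1) →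
        ∃ w ∈ J.cocycles a i, z - ψ.map i w ∈ J''.coboundaries a i) ∧
      (∀ z ∈ J'.cocycles a (i + 1), φ.map (i + 1) z ∈ J.coboundaries a (i + 1) →
        ∃ w ∈ J''.cocycles a i, z - δ i w ∈ J'.coboundaries a (i + 1)) := by
  obtain ⟨ev, θ, hev, hθ, hevf, hθ₀, hθs⟩ := h.exists_horseshoe J' J''
  let H : GrInjRes M := h.horseshoe hev hθ hevf hθ₀ hθs
  let inc : GrLift J' H f :=
    { map := fun i => LinearMap.inl R (J'.obj i) (J''.obj i)
      grHom := fun i n x hx => ⟨hx, zero_mem _⟩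
      comm_ε := fun x => Prod.ext (hevf x).symm (by
        change (0 : J''.obj 0) = J''.ε (g (f x))
        rw [h.exact.apply_apply_eq_zero, map_zero])
      comm_d := fun i x => Prod.ext (by
        change J'.d i x = J'.d i x + θ i 0
        rw [map_zero, add_zero]) (map_zero (J''.d i)).symm }
  let pr : GrLift H J'' g :=
    { map := fun i => LinearMap.snd R (J'.obj i) (J''.obj i)
      grHom := fun i n x hx => hx.2
      comm_ε := fun x => rfl
      comm_d := fun i x => rfl }
  have hinc : ∀ i x, inc.map i x = (x, 0) := fun i x => rfl
  have hpr : ∀ i (x : J'.obj i × J''.obj i), pr.map i x = x.2 := fun i x => rfl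
  have hd : ∀ i p q, H.d i (p, q) = (J'.d i p + θ i q, J''.d i q) := fun i p q => rfl
  have hpair : ∀ (a : Ideal R) i (p : J'.obj i) (q : J''.obj i), p ∈ gammaTorsion a (J'.obj i) →
      q ∈ gammaTorsion a (J''.obj i) →
      (show H.obj i from (p, q)) ∈ gammaTorsion a (H.obj i) := by
    intro a i p q hp hq
    have h1 := map_mem_gammaTorsion (LinearMap.inl R (J'.obj i) (J''.obj i)) hp
    have h2 := map_mem_gammaTorsion (LinearMap.inr R (J'.obj i) (J''.obj i)) hq
    have := add_mem h1 h2
    rw [LinearMap.inl_apply, LinearMap.inr_apply, Prod.mk_add_mk, add_zero, zero_add] at this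
    exact this
  -- Exactness is explicit on the horseshoe resolution H, where θ is the connecting map. The lifts α
  -- and β of the identity transport it to the given resolution J, modulo coboundaries.
  obtain ⟨α⟩ := GrLift.nonempty J H (IsGrHom.id M)
  obtain ⟨β⟩ := GrLift.nonempty H J (IsGrHom.id M)
  have hJ : ∀ {a : Ideal R} {i} {z : J.obj i}, z ∈ J.cocycles a i →
      z - β.map i (α.map i z) ∈ J.coboundaries a i :=
    fun hz => α.sub_comp_mem_coboundaries β (fun _ => rfl) hz
  have hprψ : ∀ {a : Ideal R} {i} {z : J.obj i}, z ∈ J.cocycles a i →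
      ψ.map i z - pr.map i (α.map i z) ∈ J''.coboundaries a i :=
    fun hz => ψ.congr_coboundaries (pr.comp α) (fun _ => rfl) hz
  have hψβ : ∀ {a : Ideal R} {i} {z : H.obj i}, z ∈ H.cocycles a i →
      pr.map i z - ψ.map i (β.map i z) ∈ J''.coboundaries a i :=
    fun hz => pr.congr_coboundaries (ψ.comp β) (fun _ => rfl) hz
  have hβinc : ∀ {a : Ideal R} {i} {z : J'.obj i}, z ∈ J'.cocycles a i →
      β.map i (inc.map i z) - φ.map i z ∈ J.coboundaries a i :=
    fun hz => (β.comp inc).congr_coboundaries φ (fun _ => rfl) hz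
  have hincφ : ∀ {a : Ideal R} {i} {z : J'.obj i}, z ∈ J'.cocycles a i →
      inc.map i z - α.map i (φ.map i z) ∈ H.coboundaries a i :=
    fun hz => inc.congr_coboundaries (α.comp φ) (fun _ => rfl) hz
  have hincB : ∀ {a : Ideal R} {i} {z : J'.obj i}, z ∈ J'.cocycles a i →
      φ.map i z ∈ J.coboundaries a i → inc.map i z ∈ H.coboundaries a i := by
    intro a i z hz hB
    have := add_mem (hincφ hz) (α.map_coboundaries hB)
    rwa [sub_add_cancel] at this
  refine ⟨?_, ?_, θ, fun i => ⟨hθ i, fun a => ⟨?_, ?_, ?_, ?_⟩⟩⟩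
  · intro a i z hz hψz
    have hαz := α.map_cocycles hz
    have hq : pr.map i (α.map i z) ∈ J''.coboundaries a i := by
      have := sub_mem hψz (hprψ hz)
      rwa [sub_sub_cancel] at this
    suffices ∃ w ∈ J'.cocycles a i, α.map i z - inc.map i w ∈ H.coboundaries a i by
      obtain ⟨w, hw, hb⟩ := this
      refine ⟨w, hw, ?_⟩
      have := add_mem (add_mem (hJ hz) (β.map_coboundaries hb)) (hβinc hw)
      rw [map_sub] at this
      convert this using 1
      abel
    rcases hαz' : α.map i z with ⟨p, q⟩
    rw [hαz'] at hαz hq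
    rw [hpr] at hq
    have hdp : J'.d i p + θ i q = 0 := congrArg Prod.fst hαz.2
    have hpΓ : p ∈ gammaTorsion a (J'.obj i) :=
      map_mem_gammaTorsion (LinearMap.fst R (J'.obj i) (J''.obj i)) hαz.1
    cases i with
    | zero =>
      obtain rfl : q = 0 := hq
      rw [map_zero, add_zero] at hdp
      refine ⟨p, ⟨hpΓ, hdp⟩, ?_⟩
      exact sub_eq_zero.mpr rfl
    | succ i =>
      obtain ⟨w, hw, rfl⟩ := hq
      rw [hθs, ← sub_eq_add_neg, ← map_sub] at hdp
      refine ⟨p - θ i w, ⟨sub_mem hpΓ (map_mem_gammaTorsion _ hw), hdp⟩,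
        (show H.obj i from (0, w)), hpair a i _ _ (zero_mem _) hw, ?_⟩
      rw [hd, hinc, map_zero, zero_add]
      refine Prod.ext ?_ ?_
      · change θ i w = p - (p - θ i w)
        abel
      · change J''.d i w = J''.d i w - 0
        abel
  · intro a z hz hB
    have : inc.map 0 z = 0 := hincB hz hB
    exact congrArg Prod.fst this
  · intro z hz
    refine ⟨map_mem_gammaTorsion _ hz.1, ?_⟩
    have h2 : J''.d i z = 0 := hz.2
    have := hθs i z
    rw [h2, map_zero] at this
    exact neg_eq_zero.mp this.symm
  · intro z hz
    cases i with
    | zero => rw [show z = 0 from hz, map_zero]; exact zero_mem _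
    | succ i =>
      obtain ⟨w, hw, rfl⟩ := hz
      rw [hθs]
      exact neg_mem ⟨_, map_mem_gammaTorsion _ hw, rfl⟩
  · rintro z hz ⟨w, hw, hwz⟩
    have hc : (show H.obj i from (-w, z)) ∈ H.cocycles a i := by
      refine ⟨hpair a i _ _ (neg_mem hw) hz.1, ?_⟩
      refine Prod.ext ?_ hz.2
      change J'.d i (-w) + θ i z = 0
      rw [map_neg, hwz, neg_add_cancel]
    exact ⟨β.map i _, β.map_cocycles hc, hψβ hc⟩
  · intro z hz hB
    obtain ⟨⟨p, q⟩, hpq, hdpq⟩ := hincB hz hB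
    have h1 : J'.d i p + θ i q = z := congrArg Prod.fst hdpq
    have h2 : J''.d i q = 0 := congrArg Prod.snd hdpq
    refine ⟨q, ⟨map_mem_gammaTorsion (LinearMap.snd R (J'.obj i) (J''.obj i)) hpq, h2⟩,
      p, map_mem_gammaTorsion (LinearMap.fst R (J'.obj i) (J''.obj i)) hpq, ?_⟩
    rw [← h1, add_sub_cancel_right]

end LongExact

/-! ### Vanishing of one component, computed on a resolution. -/

section

variable {R : Type u} [CommRing R] {𝒜 : ℕ → AddSubgroup R}

/-- The vanishing of the component `Hⁱ_𝔞(M)ₙ`, computed with the resolution `J`. -/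
def GrInjRes.Vanishes {M : GrMod 𝒜} (J : GrInjRes M) (a : Ideal R) (i : ℕ) (n : ℤ) : Prop :=
  ∀ z ∈ J.cocycles a i, z ∈ (J.obj i).deg n → z ∈ J.coboundaries a i

theorem GrInjRes.Vanishes.of_res {M : GrMod 𝒜} {J K : GrInjRes M} {a : Ideal R} {i : ℕ} {n : ℤ}
    (h : J.Vanishes a i n) : K.Vanishes a i n := by
  obtain ⟨α⟩ := GrLift.nonempty K J (IsGrHom.id M)
  obtain ⟨β⟩ := GrLift.nonempty J K (IsGrHom.id M)
  intro z hz hn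
  have h1 := α.sub_comp_mem_coboundaries β (fun _ => rfl) hz
  have h2 := β.map_coboundaries (h _ (α.map_cocycles hz) (α.grHom i n z hn))
  have := add_mem h1 h2
  rwa [sub_add_cancel] at this

theorem GrShortExact.coker {M' M : GrMod 𝒜} {f : M' →ₗ[R] M} (hf : IsGrHom f)
    (hinj : Function.Injective f) :
    GrShortExact (M'' := grCoker f hf) f (LinearMap.range f).mkQ where
  f_grHom := hf
  g_grHom := grCoker_mkQ_grHom f hf
  injective := hinj
  surjective := Submodule.mkQ_surjective _
  exact := by
    intro y
    exact Submodule.Quotient.mk_eq_zero _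

/-- The graded module `M / x M` for a homogeneous element `x`. -/
noncomputable def GrMod.modSMul (M : GrMod 𝒜) {d : ℕ} {x : R} (hx : x ∈ 𝒜 d) : GrMod 𝒜 :=
  grCoker (M := M.shift (-d)) (N := M) (LinearMap.lsmul R M x) (smul_grHom M hx)

theorem GrMod.shortExact_modSMul (M : GrMod 𝒜) {d : ℕ} {x : R} (hx : x ∈ 𝒜 d)
    (hreg : IsSMulRegular M x) :
    GrShortExact (M' := M.shift (-d)) (M := M) (M'' := M.modSMul hx) (LinearMap.lsmul R M x)
      (LinearMap.range (LinearMap.lsmul R M x)).mkQ :=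
  GrShortExact.coker (M' := M.shift (-d)) (smul_grHom M hx) hreg

end

/-! ### Vanishing of components along short exact sequences. -/

section Vanishing

variable {R : Type u} [CommRing R] {𝒜 : ℕ → AddSubgroup R} [GradedRing 𝒜]

theorem GrInjRes.isGrSub_cocycles {M : GrMod 𝒜} (J : GrInjRes M) {a : Ideal R}
    (ha : a.IsHomogeneous 𝒜) (i : ℕ) : (J.obj i).IsGrSub (J.cocycles a i) := by
  intro z hz n
  have h2 : J.d i z = 0 := hz.2
  refine ⟨(J.obj i).isGrSub_gammaTorsion ha z hz.1 n, ?_⟩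
  change J.d i _ = 0
  rw [← (J.d_grHom i).map_proj, h2, map_zero]

theorem GrInjRes.isGrSub_coboundaries {M : GrMod 𝒜} (J : GrInjRes M) {a : Ideal R}
    (ha : a.IsHomogeneous 𝒜) (i : ℕ) : (J.obj i).IsGrSub (J.coboundaries a i) := by
  cases i with
  | zero =>
    intro z hz n
    rw [show z = 0 from hz, map_zero]
    exact zero_mem _
  | succ i =>
    rintro _ ⟨w, hw, rfl⟩ n
    rw [(J.d_grHom i).map_proj]
    exact ⟨_, (J.obj i).isGrSub_gammaTorsion ha w hw n, rfl⟩

/-- The vanishing of the component `Hⁱ_𝔞(M)ₙ`. -/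
def GrMod.Vanishes (M : GrMod 𝒜) (a : Ideal R) (i : ℕ) (n : ℤ) : Prop :=
  M.injRes.Vanishes a i n

theorem GrMod.vanishes_iff {M : GrMod 𝒜} (J : GrInjRes M) {a : Ideal R} {i : ℕ} {n : ℤ} :
    M.Vanishes a i n ↔ J.Vanishes a i n := ⟨fun h => h.of_res, fun h => h.of_res⟩

theorem GrMod.vanishes_shift {M : GrMod 𝒜} {k : ℤ} {a : Ideal R} {i : ℕ} {n : ℤ} :
    (M.shift k).Vanishes a i n ↔ M.Vanishes a i (n + k) := by
  rw [GrMod.vanishes_iff (M.injRes.shift k)]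
  cases i <;> exact Iff.rfl

theorem grLocalCohomologyDeg_eq_bot_iff {M : GrMod 𝒜} {a : Ideal R} {i : ℕ} {n : ℤ} :
    grLocalCohomologyDeg M a i n = ⊥ ↔ M.Vanishes a i n := by
  rw [grLocalCohomologyDeg, AddSubgroup.map_eq_bot_iff]
  constructor
  · intro h z hz hn
    have := h (x := (⟨z, hz⟩ : M.injRes.cocycles a i)) hn
    have h2 := (Submodule.Quotient.mk_eq_zero (x := (⟨z, hz⟩ : M.injRes.cocycles a i)) _).mp this
    exact h2
  · rintro h ⟨z, hz⟩ hn
    exact (Submodule.Quotient.mk_eq_zero _).mpr (h z hz hn)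

/-- For a homogeneous ideal the cocycles and coboundaries are graded submodules, so a cocycle may be
tested component by component. -/
theorem subsingleton_grLocalCohomology_iff {M : GrMod 𝒜} {a : Ideal R} (ha : a.IsHomogeneous 𝒜)
    {i : ℕ} : Subsingleton (grLocalCohomology M a i) ↔ ∀ n, M.Vanishes a i n := by
  rw [Submodule.Quotient.subsingleton_iff, Submodule.comap_subtype_eq_top]
  constructor
  · intro h n z hz _
    exact h hz
  · intro h z hz
    exact (M.injRes.obj i).mem_of_proj_mem (S := (M.injRes.coboundaries a i).toAddSubgroup)
      fun n => h n _ (M.injRes.isGrSub_cocycles ha i z hz n) ((M.injRes.obj i).proj_mem z n)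

section ShortExact

variable {M' M M'' : GrMod 𝒜} {f : M' →ₗ[R] M} {g : M →ₗ[R] M''} {a : Ideal R} {i : ℕ} {n : ℤ}

theorem GrShortExact.vanishes_mid (h : GrShortExact f g) (ha : a.IsHomogeneous 𝒜)
    (h' : M'.Vanishes a i n) (h'' : M''.Vanishes a i n) : M.Vanishes a i n := by
  obtain ⟨φ⟩ := GrLift.nonempty M'.injRes M.injRes h.f_grHom
  obtain ⟨ψ⟩ := GrLift.nonempty M.injRes M''.injRes h.g_grHom
  intro z hz hn
  obtain ⟨w, hw, hb⟩ := (h.long_exact φ ψ).1 a i z hz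
    (h'' _ (ψ.map_cocycles hz) (ψ.grHom i n z hn))
  -- The cocycle w supplied by exactness need not be homogeneous; taking degree-n components of the
  -- relation replaces it by its component.
  have h1 := M.injRes.isGrSub_coboundaries ha i _ hb n
  rw [map_sub, (M.injRes.obj i).proj_of_mem hn, (φ.grHom i).map_proj] at h1
  have h2 := φ.map_coboundaries (h' _ (M'.injRes.isGrSub_cocycles ha i w hw n)
    ((M'.injRes.obj i).proj_mem w n))
  have := add_mem h1 h2
  rwa [sub_add_cancel] at this

theorem GrShortExact.vanishes_right (h : GrShortExact f g) (ha : a.IsHomogeneous 𝒜)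
    (h' : M'.Vanishes a (i + 1) n) (hM : M.Vanishes a i n) : M''.Vanishes a i n := by
  obtain ⟨φ⟩ := GrLift.nonempty M'.injRes M.injRes h.f_grHom
  obtain ⟨ψ⟩ := GrLift.nonempty M.injRes M''.injRes h.g_grHom
  obtain ⟨δ, hδ⟩ := (h.long_exact φ ψ).2.2
  obtain ⟨hδg, hδ⟩ := hδ i
  obtain ⟨h1, -, h3, -⟩ := hδ a
  intro z hz hn
  obtain ⟨w, hw, hb⟩ := h3 z hz (h' _ (h1 z hz) (hδg n z hn))
  have h1 := M''.injRes.isGrSub_coboundaries ha i _ hb n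
  rw [map_sub, (M''.injRes.obj i).proj_of_mem hn, (ψ.grHom i).map_proj] at h1
  have h2 := ψ.map_coboundaries (hM _ (M.injRes.isGrSub_cocycles ha i w hw n)
    ((M.injRes.obj i).proj_mem w n))
  have := add_mem h1 h2
  rwa [sub_add_cancel] at this

/-- An element of `Hⁱ⁺¹_𝔞(M')ₙ` that vanishes in `Hⁱ⁺¹_𝔞(M)ₙ` is zero if `Hⁱ_𝔞(M'')ₙ = 0`. -/
theorem GrShortExact.mem_coboundaries (h : GrShortExact f g) (ha : a.IsHomogeneous 𝒜)
    {J' : GrInjRes M'} {J : GrInjRes M} (φ : GrLift J' J f) (h'' : M''.Vanishes a i n)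
    {z : J'.obj (i + 1)} (hz : z ∈ J'.cocycles a (i + 1)) (hn : z ∈ (J'.obj (i + 1)).deg n)
    (hφ : φ.map (i + 1) z ∈ J.coboundaries a (i + 1)) : z ∈ J'.coboundaries a (i + 1) := by
  obtain ⟨ψ⟩ := GrLift.nonempty J M''.injRes h.g_grHom
  obtain ⟨δ, hδ⟩ := (h.long_exact φ ψ).2.2
  obtain ⟨hδg, hδ⟩ := hδ i
  obtain ⟨-, h2, -, h4⟩ := hδ a
  obtain ⟨w, hw, hb⟩ := h4 z hz hφ
  have h5 := J'.isGrSub_coboundaries ha (i + 1) _ hb n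
  rw [map_sub, (J'.obj (i + 1)).proj_of_mem hn, hδg.map_proj] at h5
  have h6 := h2 _ (h'' _ (M''.injRes.isGrSub_cocycles ha i w hw n)
    ((M''.injRes.obj i).proj_mem w n))
  have := add_mem h5 h6
  rwa [sub_add_cancel] at this

theorem GrShortExact.vanishes_left (h : GrShortExact f g) (ha : a.IsHomogeneous 𝒜)
    (hM : M.Vanishes a (i + 1) n) (h'' : M''.Vanishes a i n) : M'.Vanishes a (i + 1) n := by
  obtain ⟨φ⟩ := GrLift.nonempty M'.injRes M.injRes h.f_grHom
  intro z hz hn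
  exact h.mem_coboundaries ha φ h'' hz hn (hM _ (φ.map_cocycles hz) (φ.grHom _ n z hn))

/-- By left exactness of Γ, the augmentation identifies Γ(M) with the cocycles in degree 0. -/
theorem GrMod.vanishes_zero_iff {M : GrMod 𝒜} :
    M.Vanishes a 0 n ↔ ∀ x ∈ gammaTorsion a M, x ∈ M.deg n → x = 0 := by
  constructor
  · intro h x hx hn
    have := h (M.injRes.ε x) ⟨map_mem_gammaTorsion _ hx, M.injRes.d_ε x⟩ (M.injRes.ε_grHom n x hn)
    exact (map_eq_zero_iff _ M.injRes.ε_injective).mp this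
  · intro h z hz hn
    obtain ⟨x, hx⟩ := (M.injRes.exact_zero z).mp hz.2
    have hx' := M.injRes.ε_grHom.exists_of_map_eq hn hx
    have : M.proj n x = 0 := by
      refine h _ ?_ (M.proj_mem x n)
      obtain ⟨k, hk⟩ := hz.1
      refine ⟨k, fun r hr => M.injRes.ε_injective ?_⟩
      rw [map_smul, hx', hk r hr, map_zero]
    rw [← hx', this, map_zero]
    exact zero_mem _

theorem GrShortExact.vanishes_zero_left (h : GrShortExact f g)
    (hM : M.Vanishes a 0 n) : M'.Vanishes a 0 n := by
  rw [GrMod.vanishes_zero_iff] at hM ⊢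
  intro x hx hn
  exact (map_eq_zero_iff _ h.injective).mp (hM _ (map_mem_gammaTorsion f hx) (h.f_grHom n x hn))

end ShortExact

section SMul

variable {M : GrMod 𝒜} {a : Ideal R} {d : ℕ} {x : R} {i : ℕ} {n : ℤ}

theorem GrMod.vanishes_modSMul (ha : a.IsHomogeneous 𝒜) (hx : x ∈ 𝒜 d)
    (hreg : IsSMulRegular M x) (h1 : M.Vanishes a (i + 1) (n - d)) (h0 : M.Vanishes a i n) :
    (M.modSMul hx).Vanishes a i n :=
  (M.shortExact_modSMul hx hreg).vanishes_right ha (GrMod.vanishes_shift.mpr h1) h0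

theorem GrMod.vanishes_of_modSMul_left (ha : a.IsHomogeneous 𝒜) (hx : x ∈ 𝒜 d)
    (hreg : IsSMulRegular M x) (h1 : M.Vanishes a (i + 1) n)
    (h0 : (M.modSMul hx).Vanishes a i n) : M.Vanishes a (i + 1) (n - d) :=
  GrMod.vanishes_shift.mp ((M.shortExact_modSMul hx hreg).vanishes_left ha h1 h0)

theorem GrMod.vanishes_of_modSMul_mid (ha : a.IsHomogeneous 𝒜) (hx : x ∈ 𝒜 d)
    (hreg : IsSMulRegular M x) (h1 : M.Vanishes a i (n - d))
    (h0 : (M.modSMul hx).Vanishes a i n) : M.Vanishes a i n :=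
  (M.shortExact_modSMul hx hreg).vanishes_mid ha (GrMod.vanishes_shift.mpr h1) h0

theorem GrMod.vanishes_zero_of_regular (hxa : x ∈ a) (hreg : IsSMulRegular M x) :
    M.Vanishes a 0 n := by
  rw [GrMod.vanishes_zero_iff]
  intro m hm _
  obtain ⟨k, hk⟩ := exists_pow_smul_of_mem_gammaTorsion hxa hm
  exact hreg.pow k (by simpa using hk)

/-- The kernel of x : Hⁱ⁺¹(M)ₙ → Hⁱ⁺¹(M)ₙ₊d is the image of Hⁱ(M/xM)ₙ₊d. -/
theorem GrMod.mem_coboundaries_of_smul (ha : a.IsHomogeneous 𝒜) (hx : x ∈ 𝒜 d)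
    (hreg : IsSMulRegular M x) (J : GrInjRes M) (h0 : (M.modSMul hx).Vanishes a i ((d : ℤ) + n))
    {z : J.obj (i + 1)} (hz : z ∈ J.cocycles a (i + 1)) (hn : z ∈ (J.obj (i + 1)).deg n)
    (hb : x • z ∈ J.coboundaries a (i + 1)) : z ∈ J.coboundaries a (i + 1) :=
  (M.shortExact_modSMul hx hreg).mem_coboundaries ha (GrLift.smul J hx) h0 (z := z) hz
    (show z ∈ (J.obj (i + 1)).deg ((d : ℤ) + n + -d) by
      rwa [show (d : ℤ) + n + -d = n by ring]) hb

/-- If `x ∈ 𝔞` is `M`-regular, then `Hⁱ⁺¹_𝔞(M)ₙ` vanishes as soon as `Hⁱ_𝔞(M / x M)` vanishes in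
the degrees `n + d, n + 2 d, …`. -/
theorem GrMod.vanishes_succ_of_modSMul (ha : a.IsHomogeneous 𝒜) (hx : x ∈ 𝒜 d) (hxa : x ∈ a)
    (hreg : IsSMulRegular M x)
    (h0 : ∀ k : ℕ, (M.modSMul hx).Vanishes a i ((d : ℤ) + ((d * k : ℕ) + n))) :
    M.Vanishes a (i + 1) n := by
  intro z hz hn
  obtain ⟨k, hk⟩ := exists_pow_smul_of_mem_gammaTorsion hxa hz.1
  -- The class of z is killed by a power of x, since z is torsion for an ideal containing x.
  -- Multiplication by x is injective in each degree passed, so the power can be stripped off one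
  -- factor at a time.
  have key : ∀ k, x ^ k • z ∈ M.injRes.coboundaries a (i + 1) →
      z ∈ M.injRes.coboundaries a (i + 1) := by
    intro k
    induction k with
    | zero => intro h; simpa using h
    | succ k ih =>
      intro h
      refine ih (GrMod.mem_coboundaries_of_smul ha hx hreg M.injRes (h0 k)
        (Submodule.smul_mem _ _ hz) ?_ (by rwa [smul_smul, ← pow_succ']))
      refine (M.injRes.obj (i + 1)).smul_mem _ _ _ _ ?_ hn
      rw [mul_comm]
      exact SetLike.pow_mem_graded k hx
  exact key k (by rw [hk]; exact zero_mem _)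

end SMul

end Vanishing

/-! ### Torsion in graded injective modules; Artin–Rees. -/

theorem LinearMap.exists_eq_on_range {R : Type*} [CommRing R] {X Y E : Type*} [AddCommGroup X]
    [Module R X] [AddCommGroup Y] [Module R Y] [AddCommGroup E] [Module R E] (F : X →ₗ[R] Y)
    (G : X →ₗ[R] E) (h : ∀ x, F x = 0 → G x = 0) :
    ∃ f : LinearMap.range F →ₗ[R] E, ∀ x, f ⟨F x, x, rfl⟩ = G x := by
  refine ⟨((LinearMap.ker F).liftQ G h) ∘ₗ F.quotKerEquivRange.symm.toLinearMap, fun x => ?_⟩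
  have : F.quotKerEquivRange.symm ⟨F x, x, rfl⟩ = (LinearMap.ker F).mkQ x := by
    rw [LinearEquiv.symm_apply_eq]; rfl
  simp only [LinearMap.comp_apply, LinearEquiv.coe_coe, this]
  rfl

/-- Artin–Rees for powers of an ideal and a second ideal. -/
theorem Ideal.exists_pow_inf_le {R : Type*} [CommRing R] [IsNoetherianRing R] (b c : Ideal R)
    (s : ℕ) : ∃ t, b ^ t ⊓ c ≤ b ^ s * c := by
  obtain ⟨k, hk⟩ := b.exists_pow_inf_eq_pow_smul (M := R) c
  refine ⟨s + k, ?_⟩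
  have := hk (s + k) (Nat.le_add_left _ _)
  rw [Nat.add_sub_cancel, smul_eq_mul, Ideal.mul_top] at this
  rw [this, smul_eq_mul]
  exact Ideal.mul_mono_right inf_le_right

section InjectiveTorsion

variable {R : Type u} [CommRing R] {𝒜 : ℕ → AddSubgroup R} [GradedRing 𝒜]

/-- G on A and zero on B agree on A ∩ B, hence glue to A + B, and Baer's criterion represents the
result by an element. This is how elements with a prescribed action of A and killed by B are made.
-/
theorem IsGrInjective.exists_eq_smul_pair {E : GrMod 𝒜} (hE : IsGrInjective E) {A B : Ideal R}
    (hA : A.IsHomogeneous 𝒜) (hB : B.IsHomogeneous 𝒜) (n : ℤ) (G : A →ₗ[R] E)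
    (hG : ∀ (k : ℕ) (r : A), (r : R) ∈ 𝒜 k → G r ∈ E.deg ((k : ℤ) + n))
    (h0 : ∀ r : A, (r : R) ∈ B → G r = 0) :
    ∃ e ∈ E.deg n, (∀ r : A, (r : R) • e = G r) ∧ ∀ r ∈ B, r • e = 0 := by
  classical
  let F : A × B →ₗ[R] R := A.subtype.coprod B.subtype
  obtain ⟨f, hf⟩ := LinearMap.exists_eq_on_range F (G ∘ₗ LinearMap.fst R A B) (by
    rintro ⟨α, β⟩ h
    have h' : (α : R) + β = 0 := h
    refine h0 α ?_
    rw [eq_neg_of_add_eq_zero_left h']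
    exact neg_mem β.2)
  have hF : LinearMap.range F = A ⊔ B := Submodule.sup_eq_range A B |>.symm
  obtain ⟨e, hen, he⟩ := hE.exists_eq_smul (c := LinearMap.range F) (hF ▸ hA.sup hB) n f (by
    rintro k ⟨r, ⟨α, β⟩, hr⟩ hk
    have hr' : (α : R) + β = r := hr
    let α' : A := ⟨DirectSum.decompose 𝒜 (α : R) k, hA k α.2⟩
    let β' : B := ⟨DirectSum.decompose 𝒜 (β : R) k, hB k β.2⟩
    have h1 : F (α', β') = r := by
      change (DirectSum.decompose 𝒜 (α : R) k : R) + DirectSum.decompose 𝒜 (β : R) k = r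
      rw [← AddSubgroup.coe_add, ← DirectSum.add_apply, ← DirectSum.decompose_add, hr']
      exact DirectSum.decompose_of_mem_same 𝒜 hk
    have h2 : (⟨r, ⟨α, β⟩, hr⟩ : LinearMap.range F) = ⟨F (α', β'), _, rfl⟩ := Subtype.ext h1.symm
    rw [h2, hf]
    exact hG k α' (SetLike.coe_mem _))
  refine ⟨e, hen, fun r => ?_, fun r hr => ?_⟩
  · have h1 := hf (r, 0)
    rw [he] at h1
    have h2 : F (r, 0) = r := by
      change (r : R) + ((0 : B) : R) = r
      simp
    rw [← h2]
    exact h1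
  · have h1 := hf (0, ⟨r, hr⟩)
    rw [he] at h1
    have h2 : F (0, ⟨r, hr⟩) = r := by
      change ((0 : A) : R) + r = r
      simp
    rw [← h2]
    exact h1.trans (map_zero G)

variable [IsNoetherianRing R]

/-- The map `Γ_𝔟(E) → Γ_𝔟(E)ₓ` is surjective for an injective module `E`. -/
theorem IsGrInjective.exists_pow_smul_eq {E : GrMod 𝒜} (hE : IsGrInjective E) {b : Ideal R}
    (hb : b.IsHomogeneous 𝒜) {d : ℕ} {x : R} (hx : x ∈ 𝒜 d) (k : ℕ) {n : ℤ} {e : E}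
    (he : e ∈ gammaTorsion b E) (hn : e ∈ E.deg (((d * k : ℕ) : ℤ) + n)) :
    ∃ e' ∈ gammaTorsion b E, e' ∈ E.deg n ∧ ∃ m, x ^ (m + k) • e' = x ^ m • e := by
  classical
  obtain ⟨s, hs⟩ := he
  -- The annihilators of the powers of x stabilise at m. This makes x^(m+k) r ↦ r x^m e well defined
  -- on the ideal (x^(m+k)).
  obtain ⟨m, hm⟩ := monotone_stabilizes_iff_noetherian.mpr (inferInstance : IsNoetherian R R)
    ⟨fun m => LinearMap.ker (LinearMap.lsmul R R (x ^ m)), fun m m' h r hr => by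
      have hr' : x ^ m * r = 0 := hr
      change x ^ m' * r = 0
      rw [← Nat.sub_add_cancel h, pow_add, mul_assoc, hr', mul_zero]⟩
  have hm' : ∀ r, x ^ (m + k) * r = 0 → x ^ m * r = 0 := by
    intro r hr
    have : r ∈ LinearMap.ker (LinearMap.lsmul R R (x ^ (m + k))) := hr
    have h2 := hm (m + k) (Nat.le_add_right _ _)
    exact h2.ge this
  -- Artin–Rees: a multiple of x^(m+k) in 𝔟^t has a cofactor in 𝔟^s, which kills e. So the map can
  -- be extended by zero on 𝔟^t, and the representing element is 𝔟-torsion.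
  obtain ⟨t, ht⟩ := Ideal.exists_pow_inf_le b (Ideal.span {x ^ (m + k)}) s
  let F : R →ₗ[R] R := LinearMap.lsmul R R (x ^ (m + k))
  have hFr : ∀ r, F r = x ^ (m + k) * r := fun r => rfl
  have hF : LinearMap.range F = Ideal.span {x ^ (m + k)} := by
    ext r
    rw [Ideal.mem_span_singleton', LinearMap.mem_range]
    exact exists_congr fun u => by rw [hFr, mul_comm]
  obtain ⟨G, hG⟩ := LinearMap.exists_eq_on_range F (LinearMap.toSpanSingleton R E (x ^ m • e))
    (fun r hr => by
      rw [LinearMap.toSpanSingleton_apply, smul_smul, mul_comm, hm' r hr, zero_smul])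
  have hxD : x ^ (m + k) ∈ 𝒜 (d * (m + k)) := by
    rw [mul_comm]; exact SetLike.pow_mem_graded _ hx
  have hxm : x ^ m ∈ 𝒜 (d * m) := by
    rw [mul_comm]; exact SetLike.pow_mem_graded _ hx
  obtain ⟨e', hn', he', hb'⟩ := hE.exists_eq_smul_pair (A := LinearMap.range F) (B := b ^ t)
    (hF ▸ Ideal.homogeneous_span 𝒜 _ (by
      rintro _ rfl
      exact ⟨_, hxD⟩)) (hb.pow t) n G (by
      rintro j ⟨r, u, hr⟩ hj
      replace hj : r ∈ 𝒜 j := hj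
      by_cases hjD : d * (m + k) ≤ j
      · obtain ⟨l, rfl⟩ := Nat.exists_eq_add_of_le hjD
        have h1 : F (DirectSum.decompose 𝒜 u l) = r := by
          rw [← DirectSum.decompose_of_mem_same 𝒜 hj, ← hr, hFr, hFr,
            DirectSum.coe_decompose_mul_add_of_left_mem 𝒜 hxD]
        have h2 : (⟨r, u, hr⟩ : LinearMap.range F) = ⟨F (DirectSum.decompose 𝒜 u l), _, rfl⟩ :=
          Subtype.ext h1.symm
        rw [h2, hG, LinearMap.toSpanSingleton_apply]
        have h3 := E.smul_mem l _ _ _ (SetLike.coe_mem (DirectSum.decompose 𝒜 u l))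
          (E.smul_mem (d * m) _ _ _ hxm hn)
        convert h3 using 2
        push_cast
        ring
      · have h1 : r = 0 := by
          rw [← DirectSum.decompose_of_mem_same 𝒜 hj, ← hr, hFr,
            DirectSum.coe_decompose_mul_of_left_mem_of_not_le 𝒜 hxD hjD]
        have h2 : (⟨r, u, hr⟩ : LinearMap.range F) = 0 := Subtype.ext h1
        rw [h2, map_zero]
        exact zero_mem _) (by
      rintro ⟨r, u, hr⟩ hrb
      have h1 : r ∈ b ^ s * Ideal.span {x ^ (m + k)} := ht ⟨hrb, hF ▸ ⟨u, hr⟩⟩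
      rw [Ideal.mem_mul_span_singleton] at h1
      obtain ⟨v, hv, hvr⟩ := h1
      have h2 : (⟨r, u, hr⟩ : LinearMap.range F) = ⟨F v, v, rfl⟩ :=
        Subtype.ext (hvr.symm.trans (mul_comm _ _))
      rw [h2, hG, LinearMap.toSpanSingleton_apply, smul_comm, hs v hv, smul_zero])
  refine ⟨e', ⟨t, hb'⟩, hn', m, ?_⟩
  have h1 := he' ⟨F 1, 1, rfl⟩
  rw [hG, LinearMap.toSpanSingleton_apply, one_smul] at h1
  rw [← h1]
  change _ = (x ^ (m + k) * 1) • e'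
  rw [mul_one]

/-- `Γ_{𝔞 ∩ 𝔟}(E) = Γ_𝔞(E) + Γ_𝔟(E)` for an injective module `E`. -/
theorem IsGrInjective.exists_add_eq {E : GrMod 𝒜} (hE : IsGrInjective E) {a b : Ideal R}
    (ha : a.IsHomogeneous 𝒜) (hb : b.IsHomogeneous 𝒜) {n : ℤ} {w : E}
    (hw : w ∈ gammaTorsion (a ⊓ b) E) (hn : w ∈ E.deg n) :
    ∃ v ∈ gammaTorsion b E, w - v ∈ gammaTorsion a E := by
  obtain ⟨k, hk⟩ := hw
  -- By Artin–Rees 𝔞^t ∩ 𝔟^k ⊆ 𝔞^k 𝔟^k ⊆ (𝔞 ∩ 𝔟)^k, which kills w. Hence some v acts like w on 𝔞^t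
  -- and is killed by 𝔟^k.
  obtain ⟨t, ht⟩ := Ideal.exists_pow_inf_le a (b ^ k) k
  obtain ⟨v, -, h1, h2⟩ := hE.exists_eq_smul_pair (ha.pow t) (hb.pow k) n
    ((LinearMap.toSpanSingleton R E w) ∘ₗ (a ^ t).subtype)
    (fun j r hr => E.smul_mem j n _ _ hr hn) (fun r hr => by
      refine hk _ ?_
      have h3 := ht ⟨r.2, hr⟩
      rw [← mul_pow] at h3
      exact Ideal.pow_right_mono Ideal.mul_le_inf k h3)
  refine ⟨v, ⟨k, h2⟩, t, fun r hr => ?_⟩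
  have h3 : r • v = r • w := h1 ⟨r, hr⟩
  rw [smul_sub, h3, sub_self]

end InjectiveTorsion

/-! ### Local cohomology by induction on the generators of the ideal. -/

section Generators

variable {R : Type u} [CommRing R] {𝒜 : ℕ → AddSubgroup R} [GradedRing 𝒜]
  {M : GrMod 𝒜} {b : Ideal R} {d : ℕ} {x : R} {i : ℕ} {n : ℤ}

theorem Ideal.isHomogeneous_ofList {xs : List R}
    (hxs : ∀ x ∈ xs, SetLike.IsHomogeneousElem 𝒜 x) : (Ideal.ofList xs).IsHomogeneous 𝒜 :=
  Ideal.homogeneous_span 𝒜 _ hxs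

theorem GrMod.Vanishes.zero_anti {c : Ideal R} (h : M.Vanishes b 0 n) (hbc : b ≤ c) :
    M.Vanishes c 0 n := by
  rw [GrMod.vanishes_zero_iff] at h ⊢
  exact fun x hx hn => h x (gammaTorsion_anti hbc M hx) hn

theorem GrInjRes.exists_homogeneous_of_mem_coboundaries (J : GrInjRes M)
    (hb : b.IsHomogeneous 𝒜) {z : J.obj (i + 1)} (hz : z ∈ J.coboundaries b (i + 1))
    (hn : z ∈ (J.obj (i + 1)).deg n) :
    ∃ w ∈ gammaTorsion b (J.obj i), w ∈ (J.obj i).deg n ∧ J.d i w = z := by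
  obtain ⟨w, hw, hwz⟩ := hz
  exact ⟨_, (J.obj i).isGrSub_gammaTorsion hb w hw n, (J.obj i).proj_mem w n,
    (J.d_grHom i).exists_of_map_eq hn hwz⟩

theorem GrMod.vanishes_bot_succ : M.Vanishes ⊥ (i + 1) n := by
  rintro z hz -
  obtain ⟨w, rfl⟩ := (M.injRes.exact_succ i z).mp hz.2
  exact ⟨w, by rw [gammaTorsion_bot]; trivial, rfl⟩

variable [IsNoetherianRing R]

/-- Enlarging the ideal by `x`: the exact sequence
`Hⁱ_𝔟(M)ₓ → Hⁱ⁺¹_{𝔟 + (x)}(M) → Hⁱ⁺¹_𝔟(M)`. -/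
theorem GrMod.vanishes_sup_span_succ (hb : b.IsHomogeneous 𝒜) (hx : x ∈ 𝒜 d)
    (h : M.Vanishes b (i + 1) n)
    (ht : ∀ k : ℕ, ∀ z ∈ M.injRes.cocycles b i,
      z ∈ (M.injRes.obj i).deg (((d * k : ℕ) : ℤ) + n) →
      ∃ m, x ^ m • z ∈ M.injRes.coboundaries b i) :
    M.Vanishes (b ⊔ Ideal.span {x}) (i + 1) n := by
  intro z hz hn
  obtain ⟨hzΓ, hzd⟩ := hz
  rw [gammaTorsion_sup] at hzΓ
  obtain ⟨hzb, hzx⟩ := hzΓ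
  obtain ⟨w, hw, hwn, rfl⟩ := M.injRes.exists_homogeneous_of_mem_coboundaries hb
    (h z ⟨hzb, hzd⟩ hn) hn
  obtain ⟨k, hk⟩ := mem_gammaTorsion_span_singleton.mp hzx
  have hpow : ∀ k, x ^ k ∈ 𝒜 (d * k) := fun k => by
    rw [mul_comm]; exact SetLike.pow_mem_graded _ hx
  have hc : x ^ k • w ∈ M.injRes.cocycles b i := by
    refine ⟨Submodule.smul_mem _ _ hw, ?_⟩
    change M.injRes.d i (x ^ k • w) = 0
    rw [map_smul, hk]
  have hcn := (M.injRes.obj i).smul_mem _ _ _ _ (hpow k) hwn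
  obtain ⟨m, hm⟩ := ht k _ hc hcn
  suffices ∃ w' ∈ gammaTorsion b (M.injRes.obj i), M.injRes.d i w' = M.injRes.d i w ∧
      ∃ l, x ^ l • w' = 0 by
    obtain ⟨w', hw', hdw, hl⟩ := this
    refine ⟨w', ?_, hdw⟩
    rw [gammaTorsion_sup]
    exact ⟨hw', mem_gammaTorsion_span_singleton.mpr hl⟩
  rw [smul_smul, ← pow_add] at hm
  cases i with
  | zero => exact ⟨w, hw, rfl, _, hm⟩
  | succ i =>
    obtain ⟨v, hv, hvn, hdv⟩ := M.injRes.exists_homogeneous_of_mem_coboundaries hb hm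
      ((M.injRes.obj (i + 1)).smul_mem _ _ _ _ (hpow (m + k)) hwn)
    -- As x^(m+k) w = d v, the element w becomes d(v / x^(m+k)) after inverting x. The fraction is
    -- represented by v' in Γ_𝔟, and w - d v' has the same differential as w and is x-torsion.
    obtain ⟨v', hv', -, l, hl⟩ := (M.injRes.inj i).exists_pow_smul_eq hb hx (m + k) hv hvn
    refine ⟨w - M.injRes.d i v', sub_mem hw (map_mem_gammaTorsion _ hv'), ?_, l + (m + k), ?_⟩
    · rw [map_sub, M.injRes.d_d, sub_zero]
    · rw [smul_sub, ← map_smul, hl, map_smul, hdv, smul_smul, ← pow_add, sub_self]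

/-- The second hypothesis forces the degree-n component of the localisation Hʲ_𝔟(M)ₓ to vanish: its
elements are fractions z / x^k with z of degree dk + n, and each z is killed by a power of x. -/
theorem GrMod.vanishes_sup_span (hb : b.IsHomogeneous 𝒜) (hx : x ∈ 𝒜 d)
    (h : M.Vanishes b i n)
    (ht : ∀ j < i, ∀ k : ℕ, ∃ m : ℕ, M.Vanishes b j (((d * m : ℕ) : ℤ) + (((d * k : ℕ) : ℤ) + n))) :
    M.Vanishes (b ⊔ Ideal.span {x}) i n := by
  cases i with
  | zero => exact h.zero_anti le_sup_left
  | succ i =>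
    refine GrMod.vanishes_sup_span_succ hb hx h fun k z hz hzn => ?_
    obtain ⟨m, hm⟩ := ht i (Nat.lt_succ_self i) k
    refine ⟨m, hm _ (Submodule.smul_mem _ _ hz) ((M.injRes.obj i).smul_mem _ _ _ _ ?_ hzn)⟩
    rw [mul_comm]
    exact SetLike.pow_mem_graded _ hx

/-- Each new generator raises the top possible index by at most one, since Hⁱ⁺¹ for the larger ideal
is governed by Hⁱ and Hⁱ⁺¹ for the smaller one. -/
theorem GrMod.vanishes_ofList_of_length_lt {xs : List R}
    (hxs : ∀ x ∈ xs, SetLike.IsHomogeneousElem 𝒜 x) :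
    ∀ i, xs.length < i → ∀ n, M.Vanishes (Ideal.ofList xs) i n := by
  induction xs with
  | nil =>
    intro i hi n
    obtain ⟨i, rfl⟩ := Nat.exists_eq_succ_of_ne_zero (Nat.pos_iff_ne_zero.mp hi)
    rw [Ideal.ofList_nil]
    exact GrMod.vanishes_bot_succ
  | cons x xs ih =>
    intro i hi n
    obtain ⟨i, rfl⟩ := Nat.exists_eq_succ_of_ne_zero (Nat.ne_zero_of_lt hi)
    have hxs' : ∀ y ∈ xs, SetLike.IsHomogeneousElem 𝒜 y := fun y hy =>
      hxs y (List.mem_cons_of_mem _ hy)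
    obtain ⟨d, hd⟩ := hxs x List.mem_cons_self
    rw [List.length_cons] at hi
    rw [Ideal.ofList_cons, sup_comm]
    refine GrMod.vanishes_sup_span_succ (Ideal.isHomogeneous_ofList hxs') hd
      (ih hxs' _ (by omega) n) fun k z hz hzn => ⟨0, ?_⟩
    rw [pow_zero, one_smul]
    exact ih hxs' _ (by omega) _ z hz hzn

/-- Enlarging the ideal cannot create cohomology below the first nonvanishing index, because the
neighbouring terms have index at most i. -/
theorem GrMod.vanishes_sup_ofList_of_lt (hb : b.IsHomogeneous 𝒜) {xs : List R}
    (hxs : ∀ x ∈ xs, SetLike.IsHomogeneousElem 𝒜 x) {c : ℕ}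
    (h : ∀ i < c, ∀ n, M.Vanishes b i n) :
    ∀ i < c, ∀ n, M.Vanishes (b ⊔ Ideal.ofList xs) i n := by
  induction xs with
  | nil => simpa [Ideal.ofList_nil] using h
  | cons x xs ih =>
    intro i hi n
    have hxs' : ∀ y ∈ xs, SetLike.IsHomogeneousElem 𝒜 y := fun y hy =>
      hxs y (List.mem_cons_of_mem _ hy)
    obtain ⟨d, hd⟩ := hxs x List.mem_cons_self
    rw [Ideal.ofList_cons, sup_comm (Ideal.span _), ← sup_assoc]
    exact GrMod.vanishes_sup_span (hb.sup (Ideal.isHomogeneous_ofList hxs')) hd (ih hxs' i hi n)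
      fun j hj k => ⟨0, ih hxs' j (by omega) _⟩

/-- If `M` is bounded above, then its local cohomology vanishes in the degrees where `M` does. -/
theorem GrMod.vanishes_ofList_of_deg_eq_bot {q : ℤ} (hq : ∀ m > q, M.deg m = ⊥) {xs : List R}
    (hxs : ∀ x ∈ xs, SetLike.IsHomogeneousElem 𝒜 x) :
    ∀ i n, M.deg n = ⊥ → M.Vanishes (Ideal.ofList xs) i n := by
  induction xs with
  | nil =>
    intro i n hn
    rw [Ideal.ofList_nil]
    cases i with
    | zero =>
      rw [GrMod.vanishes_zero_iff]
      intro x _ hx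
      rw [hn] at hx
      exact hx
    | succ i => exact GrMod.vanishes_bot_succ
  | cons x xs ih =>
    intro i n hn
    have hxs' : ∀ y ∈ xs, SetLike.IsHomogeneousElem 𝒜 y := fun y hy =>
      hxs y (List.mem_cons_of_mem _ hy)
    obtain ⟨d, hd⟩ := hxs x List.mem_cons_self
    rw [Ideal.ofList_cons, sup_comm]
    refine GrMod.vanishes_sup_span (Ideal.isHomogeneous_ofList hxs') hd (ih hxs' i n hn)
      fun j _ k => ?_
    -- A generator of degree 0 keeps the degree n, where M is zero. One of positive degree pushes
    -- every element above the bound q.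
    rcases Nat.eq_zero_or_pos d with rfl | hd0
    · exact ⟨0, by simpa using ih hxs' j n hn⟩
    · refine ⟨(q - n + 1).toNat, ih hxs' j _ (hq _ ?_)⟩
      have h1 : (q - n + 1).toNat ≤ d * (q - n + 1).toNat := Nat.le_mul_of_pos_left _ hd0
      omega

/-- The higher local cohomology of a torsion module vanishes. -/
theorem GrMod.vanishes_ofList_of_torsion {xs : List R}
    (hxs : ∀ x ∈ xs, SetLike.IsHomogeneousElem 𝒜 x)
    (ht : ∀ x ∈ xs, ∀ y : M, ∃ k : ℕ, x ^ k • y = 0) :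
    ∀ i n, M.Vanishes (Ideal.ofList xs) (i + 1) n := by
  induction xs with
  | nil =>
    intro i n
    rw [Ideal.ofList_nil]
    exact GrMod.vanishes_bot_succ
  | cons x xs ih =>
    intro i n
    have hxs' : ∀ y ∈ xs, SetLike.IsHomogeneousElem 𝒜 y := fun y hy =>
      hxs y (List.mem_cons_of_mem _ hy)
    have ih' := ih hxs' fun y hy => ht y (List.mem_cons_of_mem _ hy)
    obtain ⟨d, hd⟩ := hxs x List.mem_cons_self
    rw [Ideal.ofList_cons, sup_comm]
    refine GrMod.vanishes_sup_span_succ (Ideal.isHomogeneous_ofList hxs') hd (ih' i n)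
      fun k z hz hzn => ?_
    -- For i = 0 the localisation term comes from M itself, where x acts nilpotently on each
    -- element. For larger i it already vanishes by induction.
    cases i with
    | zero =>
      obtain ⟨y, rfl⟩ := (M.injRes.exact_zero z).mp hz.2
      obtain ⟨m, hm⟩ := ht x List.mem_cons_self y
      refine ⟨m, ?_⟩
      rw [← map_smul, hm, map_zero]
      exact zero_mem _
    | succ i =>
      refine ⟨0, ?_⟩
      rw [pow_zero, one_smul]
      exact ih' i _ z hz hzn

end Generators

/-! ### The ring R, prime avoidance and regular elements. -/

section Algebra

variable {R : Type u} [CommRing R] {𝒜 : ℕ → AddSubgroup R} [GradedRing 𝒜]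

/-- The irrelevant ideal `R₊`. -/
abbrev posIdeal (𝒜 : ℕ → AddSubgroup R) [GradedRing 𝒜] : Ideal R :=
  (HomogeneousIdeal.irrelevant 𝒜).toIdeal

theorem posIdeal_isHomogeneous : (posIdeal 𝒜).IsHomogeneous 𝒜 :=
  (HomogeneousIdeal.irrelevant 𝒜).isHomogeneous

theorem mem_posIdeal_of_mem {d : ℕ} (hd : 0 < d) {x : R} (hx : x ∈ 𝒜 d) : x ∈ posIdeal 𝒜 :=
  HomogeneousIdeal.mem_irrelevant_of_mem 𝒜 hd hx

/-- Modulo the ideal of the generators every element of R is congruent to one of degree 0, and the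
only element of degree 0 in R₊ is zero. -/
theorem posIdeal_eq_span {s : Finset R} (hs : ∀ x ∈ s, x ∈ 𝒜 1)
    (htop : Algebra.adjoin (𝒜 0) (s : Set R) = ⊤) : posIdeal 𝒜 = Ideal.span (s : Set R) := by
  have hle : Ideal.span (s : Set R) ≤ posIdeal 𝒜 :=
    Ideal.span_le.mpr fun x hx => mem_posIdeal_of_mem one_pos (hs x hx)
  refine le_antisymm (fun r hr => ?_) hle
  have key : ∀ r : R, ∃ c ∈ 𝒜 0, r - c ∈ Ideal.span (s : Set R) := by
    intro r
    have hr : r ∈ Algebra.adjoin (𝒜 0) (s : Set R) := by rw [htop]; trivial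
    induction hr using Algebra.adjoin_induction with
    | mem x hx => exact ⟨0, zero_mem _, by rw [sub_zero]; exact Ideal.subset_span hx⟩
    | algebraMap c => exact ⟨c, c.2, by simp⟩
    | add x y _ _ hx hy =>
      obtain ⟨c, hc, h1⟩ := hx
      obtain ⟨c', hc', h2⟩ := hy
      refine ⟨c + c', add_mem hc hc', ?_⟩
      rw [add_sub_add_comm]
      exact add_mem h1 h2
    | mul x y _ _ hx hy =>
      obtain ⟨c, hc, h1⟩ := hx
      obtain ⟨c', hc', h2⟩ := hy
      refine ⟨c * c', by simpa using SetLike.GradedMul.mul_mem hc hc', ?_⟩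
      rw [show x * y - c * c' = y * (x - c) + c * (y - c') by ring]
      exact add_mem (Ideal.mul_mem_left _ _ h1) (Ideal.mul_mem_left _ _ h2)
  obtain ⟨c, hc, h⟩ := key r
  have h1 : c ∈ posIdeal 𝒜 := by
    have := sub_mem hr (hle h)
    rwa [sub_sub_cancel] at this
  have h2 : c = 0 := by
    have h3 := (HomogeneousIdeal.mem_irrelevant_iff 𝒜 c).mp h1
    rwa [GradedRing.proj_apply, DirectSum.decompose_of_mem_same 𝒜 hc] at h3
  rwa [h2, sub_zero] at h

theorem IsStandardGraded.exists_list (hR : IsStandardGraded 𝒜) :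
    ∃ xs : List R, (∀ x ∈ xs, x ∈ 𝒜 1) ∧ posIdeal 𝒜 = Ideal.ofList xs := by
  obtain ⟨s, hs, htop⟩ := hR
  refine ⟨s.toList, fun x hx => hs x (Finset.mem_toList.mp hx), ?_⟩
  rw [posIdeal_eq_span hs htop, Ideal.ofList]
  congr 1
  ext x
  simp

theorem IsStandardGraded.isNoetherianRing [IsNoetherianRing (𝒜 0)] (hR : IsStandardGraded 𝒜) :
    IsNoetherianRing R := by
  obtain ⟨s, -, htop⟩ := hR
  have : Algebra.FiniteType (𝒜 0) R := ⟨⟨s, htop⟩⟩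
  exact Algebra.FiniteType.isNoetherianRing (𝒜 0) R

theorem IsStandardGraded.mem_posIdeal_pow (hR : IsStandardGraded 𝒜) (l : ℕ) :
    ∀ r ∈ 𝒜 l, r ∈ posIdeal 𝒜 ^ l := by
  classical
  obtain ⟨s, hs, htop⟩ := hR
  have hspan := posIdeal_eq_span hs htop
  induction l with
  | zero => simp
  | succ l ih =>
    intro r hr
    have h1 : r ∈ Ideal.span (s : Set R) := hspan ▸ mem_posIdeal_of_mem (Nat.succ_pos l) hr
    obtain ⟨c, hc⟩ := Submodule.mem_span_finset'.mp h1
    rw [← DirectSum.decompose_of_mem_same 𝒜 hr, ← hc, DirectSum.decompose_sum, DirectSum.sum_apply,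
      AddSubgroup.val_finsetSum]
    refine Ideal.sum_mem _ fun x _ => ?_
    rw [smul_eq_mul, DirectSum.coe_decompose_mul_add_of_right_mem 𝒜 (hs x x.2), pow_succ]
    refine Ideal.mul_mem_mul (ih _ (SetLike.coe_mem _)) ?_
    rw [hspan]
    exact Ideal.subset_span x.2

/-- Homogeneous prime avoidance, in all large degrees. -/
theorem exists_homogeneous_avoid (S : Finset (Ideal R)) (hS : ∀ P ∈ S, P.IsPrime)
    (h1 : ∀ P ∈ S, ∃ l ∈ 𝒜 1, l ∉ P) :
    ∃ d₀ : ℕ, ∀ d ≥ d₀, ∃ x ∈ 𝒜 d, ∀ P ∈ S, x ∉ P := by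
  classical
  induction hn : S.card using Nat.strong_induction_on generalizing S with
  | _ N ih =>
  -- The primes need not be homogeneous, so inclusion is tested on homogeneous elements only. A
  -- prime dominated in this sense can be discarded.
  by_cases hanti : ∃ P ∈ S, ∃ P' ∈ S, P ≠ P' ∧ ∀ x, SetLike.IsHomogeneousElem 𝒜 x → x ∈ P → x ∈ P'
  · obtain ⟨P, hP, P', hP', hne, hsub⟩ := hanti
    obtain ⟨d₀, hd₀⟩ := ih (S.erase P).card (hn ▸ Finset.card_erase_lt_of_mem hP) (S.erase P)
      (fun Q hQ => hS Q (Finset.mem_of_mem_erase hQ))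
      (fun Q hQ => h1 Q (Finset.mem_of_mem_erase hQ)) rfl
    refine ⟨d₀, fun d hd => ?_⟩
    obtain ⟨x, hx, hxS⟩ := hd₀ d hd
    refine ⟨x, hx, fun Q hQ hxQ => ?_⟩
    by_cases hQP : Q = P
    · subst hQP
      exact hxS P' (Finset.mem_erase.mpr ⟨hne.symm, hP'⟩) (hsub x ⟨d, hx⟩ hxQ)
    · exact hxS Q (Finset.mem_erase.mpr ⟨hQP, hQ⟩) hxQ
  · push Not at hanti
    have hu : ∀ P ∈ S, ∃ w, SetLike.IsHomogeneousElem 𝒜 w ∧ w ∉ P ∧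
        ∀ P' ∈ S, P' ≠ P → w ∈ P' := by
      intro P hP
      have : ∀ P', ∃ y, P' ∈ S → P' ≠ P → (SetLike.IsHomogeneousElem 𝒜 y ∧ y ∈ P' ∧ y ∉ P) := by
        intro P'
        by_cases h : P' ∈ S ∧ P' ≠ P
        · obtain ⟨y, hy⟩ := hanti P' h.1 P hP h.2
          exact ⟨y, fun _ _ => hy⟩
        · exact ⟨0, fun h2 h3 => absurd ⟨h2, h3⟩ h⟩
      choose y hy using this
      have hPp := hS P hP
      refine ⟨∏ Q ∈ S.erase P, y Q, ?_, ?_, ?_⟩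
      · refine Finset.prod_induction _ (SetLike.IsHomogeneousElem 𝒜)
          (fun a b => SetLike.IsHomogeneousElem.mul) (SetLike.isHomogeneousElem_one 𝒜) ?_
        intro Q hQ
        exact (hy Q (Finset.mem_of_mem_erase hQ) (Finset.ne_of_mem_erase hQ)).1
      · rw [hPp.prod_mem_iff]
        rintro ⟨Q, hQ, hQP⟩
        exact (hy Q (Finset.mem_of_mem_erase hQ) (Finset.ne_of_mem_erase hQ)).2.2 hQP
      · intro P' hP' hne
        exact Ideal.mem_of_dvd _ (Finset.dvd_prod_of_mem y (Finset.mem_erase.mpr ⟨hne, hP'⟩))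
          (hy P' hP' hne).2.1
    have hu' : ∀ P : Ideal R, ∃ (w : R) (e : ℕ) (l : R), P ∈ S → w ∈ 𝒜 e ∧ w ∉ P ∧
        (∀ P' ∈ S, P' ≠ P → w ∈ P') ∧ l ∈ 𝒜 1 ∧ l ∉ P := by
      intro P
      by_cases hP : P ∈ S
      · obtain ⟨w, ⟨e, he⟩, hw1, hw2⟩ := hu P hP
        obtain ⟨l, hl, hlP⟩ := h1 P hP
        exact ⟨w, e, l, fun _ => ⟨he, hw1, hw2, hl, hlP⟩⟩
      · exact ⟨0, 0, 0, fun h => absurd h hP⟩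
    choose w e l hw using hu'
    -- Each w P avoids P and lies in all other primes. A power of the linear form l P adjusts its
    -- degree to d, and exactly one summand then survives modulo each P.
    refine ⟨S.sup e, fun d hd => ⟨∑ P ∈ S, w P * l P ^ (d - e P), ?_, ?_⟩⟩
    · refine sum_mem fun P hP => ?_
      have he : e P ≤ d := (Finset.le_sup hP).trans hd
      have h2 := SetLike.pow_mem_graded (d - e P) (hw P hP).2.2.2.1
      have h3 := SetLike.GradedMul.mul_mem (hw P hP).1 h2
      rwa [smul_eq_mul, mul_one, Nat.add_sub_cancel' he] at h3
    · intro P hP hmem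
      have hPp := hS P hP
      rw [← Finset.add_sum_erase _ _ hP] at hmem
      have h2 : ∑ Q ∈ S.erase P, w Q * l Q ^ (d - e Q) ∈ P :=
        P.sum_mem fun Q hQ => P.mul_mem_right _ ((hw Q (Finset.mem_of_mem_erase hQ)).2.2.1 P hP
          (Finset.ne_of_mem_erase hQ).symm)
      have h3 := (P.add_mem_iff_left h2).mp hmem
      rcases hPp.mem_or_mem h3 with h4 | h4
      · exact (hw P hP).2.1 h4
      · exact (hw P hP).2.2.2.2 (hPp.mem_of_pow_mem _ h4)

theorem isSMulRegular_of_notMem_associatedPrimes [IsNoetherianRing R] {M : Type*} [AddCommGroup M]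
    [Module R M] {x : R} (h : ∀ P ∈ associatedPrimes R M, x ∉ P) : IsSMulRegular M x := by
  rw [isSMulRegular_iff_right_eq_zero_of_smul]
  intro m hm
  by_contra hne
  have : x ∈ ⋃ p ∈ associatedPrimes R M, (p : Set R) := by
    rw [biUnion_associatedPrimes_eq_zero_divisors]
    exact ⟨m, hne, hm⟩
  obtain ⟨P, hP, hxP⟩ := Set.mem_iUnion₂.mp this
  exact h P hP hxP

theorem exists_eq_annihilator_of_mem_associatedPrimes {M : Type*} [AddCommGroup M]
    [Module R M] [IsNoetherianRing R] {P : Ideal R} (hP : P ∈ associatedPrimes R M) :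
    ∃ m : M, m ≠ 0 ∧ ∀ r ∈ P, r • m = 0 := by
  rw [AssociatedPrimes.mem_iff, isAssociatedPrime_iff] at hP
  obtain ⟨h, m, rfl⟩ := hP
  exact ⟨m, by rintro rfl; exact h.ne_top (by simp), fun r hr => by simpa using hr⟩

/-- An associated prime containing R₊ would annihilate a nonzero R₊-torsion element. So every
associated prime misses a form of degree one, and prime avoidance applies. All large degrees are
needed, to have regular elements in two consecutive degrees. -/
theorem IsStandardGraded.exists_regular [IsNoetherianRing R] (hR : IsStandardGraded 𝒜)
    (M : Type u) [AddCommGroup M] [Module R M] [Module.Finite R M]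
    (htf : gammaTorsion (posIdeal 𝒜) M = ⊥) :
    ∃ d₀ : ℕ, ∀ d ≥ d₀, ∃ x ∈ 𝒜 d, IsSMulRegular M x := by
  obtain ⟨s, hs, htop⟩ := hR
  have hfin := associatedPrimes.finite R M
  obtain ⟨d₀, hd₀⟩ := exists_homogeneous_avoid (𝒜 := 𝒜) hfin.toFinset
    (fun P hP => ((hfin.mem_toFinset).mp hP).isPrime) (by
      intro P hP
      by_contra! hcon
      obtain ⟨m, hm, hPm⟩ := exists_eq_annihilator_of_mem_associatedPrimes
        ((hfin.mem_toFinset).mp hP)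
      have hle : posIdeal 𝒜 ≤ P := by
        rw [posIdeal_eq_span hs htop]
        exact Ideal.span_le.mpr fun x hx => hcon x (hs x hx)
      have : m ∈ gammaTorsion (posIdeal 𝒜) M := ⟨1, fun r hr => hPm r (hle (by simpa using hr))⟩
      rw [htf] at this
      exact hm this)
  refine ⟨d₀, fun d hd => ?_⟩
  obtain ⟨x, hx, hxP⟩ := hd₀ d hd
  exact ⟨x, hx, isSMulRegular_of_notMem_associatedPrimes fun P hP =>
    hxP P ((hfin.mem_toFinset).mpr hP)⟩

/-- A power of 𝔞 moving m into Γ_𝔞(M) is finitely generated, so one further power of 𝔞 kills all the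
resulting multiples of m. -/
theorem gammaTorsion_quotient_eq_bot [IsNoetherianRing R] (a : Ideal R) {M : Type u}
    [AddCommGroup M] [Module R M] (P : Submodule R M) (hP : P = gammaTorsion a M) :
    gammaTorsion a (M ⧸ P) = ⊥ := by
  subst hP
  rw [eq_bot_iff]
  rintro x ⟨k, hk⟩
  obtain ⟨m, rfl⟩ := Submodule.mkQ_surjective _ x
  obtain ⟨T, hT⟩ := IsNoetherian.noetherian (a ^ k)
  have h1 : ∀ t ∈ T, ∃ l : ℕ, ∀ r ∈ a ^ l, r • t • m = 0 := by
    intro t ht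
    have h2 := hk t (hT ▸ Submodule.subset_span ht)
    rw [← map_smul] at h2
    exact (Submodule.Quotient.mk_eq_zero _).mp h2
  choose! l hl using h1
  refine (Submodule.Quotient.mk_eq_zero _).mpr ⟨T.sup l + k, fun r hr => ?_⟩
  rw [pow_add] at hr
  refine Submodule.mul_induction_on hr (fun p hp q hq => ?_) (fun p q hp hq => by
    rw [add_smul, hp, hq, add_zero])
  rw [← hT] at hq
  induction hq using Submodule.span_induction with
  | mem t ht =>
    rw [mul_smul]
    exact hl t ht p (Ideal.pow_le_pow_right (Finset.le_sup ht) hp)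
  | zero => simp
  | add y z _ _ hy hz => rw [mul_add, add_smul, hy, hz, add_zero]
  | smul c y _ hy => rw [smul_eq_mul, mul_left_comm, mul_smul, hy, smul_zero]

theorem exists_pow_smul_eq_zero_of_finite (a : Ideal R) (M : Type u) [AddCommGroup M] [Module R M]
    [Module.Finite R M] (h : gammaTorsion a M = ⊤) : ∃ k : ℕ, ∀ r ∈ a ^ k, ∀ m : M, r • m = 0 := by
  obtain ⟨T, hT⟩ := Module.Finite.fg_top (R := R) (M := M)
  have h1 : ∀ t ∈ T, ∃ l : ℕ, ∀ r ∈ a ^ l, r • t = 0 := fun t _ =>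
    (h ▸ Submodule.mem_top : t ∈ gammaTorsion a M)
  choose! l hl using h1
  refine ⟨T.sup l, fun r hr m => ?_⟩
  have hm : m ∈ Submodule.span R (T : Set M) := by rw [hT]; trivial
  induction hm using Submodule.span_induction with
  | mem t ht => exact hl t ht r (Ideal.pow_le_pow_right (Finset.le_sup ht) hr)
  | zero => exact smul_zero r
  | add y z _ _ hy hz => rw [smul_add, hy, hz, add_zero]
  | smul c y _ hy => rw [smul_comm, hy, smul_zero]

end Algebra

/-! ### Degree bounds for finite modules and nonzero quotients M/xM. -/

section Bounds

variable {R : Type u} [CommRing R] {𝒜 : ℕ → AddSubgroup R} (M : GrMod 𝒜)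

theorem GrMod.deg_grCoker_eq_bot {M N : GrMod 𝒜} {f : M →ₗ[R] N} {hf : IsGrHom f} {n : ℤ}
    (h : N.deg n = ⊥) : (grCoker f hf).deg n = ⊥ := by
  change (N.deg n).map _ = ⊥
  rw [h, AddSubgroup.map_bot]

theorem GrMod.deg_sub_eq_bot (M : GrMod 𝒜) {P : Submodule R M} (hP : M.IsGrSub P) {m : ℤ}
    (h : M.deg m = ⊥) : (M.sub P hP).deg m = ⊥ := by
  rw [eq_bot_iff]
  rintro ⟨x, hx⟩ hxm
  have h1 : x ∈ M.deg m := hxm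
  rw [h] at h1
  exact Subtype.ext h1

theorem GrMod.exists_mem_ne_zero {n : ℤ} (h : M.deg n ≠ ⊥) : ∃ m ∈ M.deg n, m ≠ 0 := by
  by_contra! hcon
  exact h (eq_bot_iff.mpr fun m hm => hcon m hm)

theorem GrMod.deg_eq_bot_of_proj {n : ℤ} (h : ∀ x, M.proj n x = 0) : M.deg n = ⊥ := by
  rw [eq_bot_iff]
  intro x hx
  have := h x
  rwa [M.proj_of_mem hx] at this

theorem GrMod.exists_finset_bounds [Module.Finite R M] :
    ∃ (T : Finset M) (p q : ℤ), Submodule.span R (T : Set M) = ⊤ ∧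
      (∀ t ∈ T, ∀ n < p, M.proj n t = 0) ∧ ∀ t ∈ T, ∀ n > q, M.proj n t = 0 := by
  classical
  obtain ⟨T, hT⟩ := Module.Finite.fg_top (R := R) (M := M)
  let S : Finset ℤ := T.biUnion fun t => (M.comps t).support
  have hS : ∀ t ∈ T, ∀ n, M.proj n t ≠ 0 → n ∈ S := fun t ht n hn =>
    Finset.mem_biUnion.mpr ⟨t, ht, Finsupp.mem_support_iff.mpr hn⟩
  obtain ⟨p, hp⟩ := S.bddBelow
  obtain ⟨q, hq⟩ := S.bddAbove
  refine ⟨T, p, q, hT, fun t ht n hn => ?_, fun t ht n hn => ?_⟩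
  · by_contra h
    exact absurd (hp (hS t ht n h)) (not_le.mpr hn)
  · by_contra h
    exact absurd (hq (hS t ht n h)) (not_le.mpr hn)

theorem GrMod.exists_deg_ne_bot [Nontrivial M] : ∃ n, M.deg n ≠ ⊥ := by
  obtain ⟨x, hx⟩ := exists_ne (0 : M)
  by_contra! h
  refine hx (M.eq_zero_of_proj fun n => ?_)
  have := M.proj_mem x n
  rwa [h n] at this

theorem GrMod.nontrivial_modSMul_of_ne {d : ℕ} {x : R} (hx : x ∈ 𝒜 d)
    (h : ∃ m : M, ∀ y : M, x • y ≠ m) : Nontrivial (M.modSMul hx) := by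
  refine Submodule.Quotient.nontrivial_iff.mpr fun htop => ?_
  obtain ⟨m, hm⟩ := h
  have : m ∈ LinearMap.range (LinearMap.lsmul R M x) := by
    have h2 : m ∈ (⊤ : Submodule R M) := trivial
    rw [← htop] at h2
    exact h2
  obtain ⟨y, hy⟩ := this
  exact hm y hy

/-- Induction on finite graded modules along proper quotients. -/
theorem GrMod.noetherian_induction [IsNoetherianRing R] {p : GrMod 𝒜 → Prop}
    (h : ∀ (M : GrMod 𝒜) [Module.Finite R M], (∀ (N : GrMod 𝒜) [Module.Finite R N]
      (g : M →ₗ[R] N), Function.Surjective g → ¬ Function.Injective g → p N) → p M)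
    (M : GrMod 𝒜) [Module.Finite R M] : p M := by
  have key : ∀ K : Submodule R M, ∀ (N : GrMod 𝒜) (g : M →ₗ[R] N), Function.Surjective g →
      LinearMap.ker g = K → p N := by
    intro K
    induction K using WellFoundedGT.induction with
    | _ K ih =>
    intro N g hg hK
    have : Module.Finite R N := Module.Finite.of_surjective g hg
    refine h N fun L _ g' hg' hinj => ih (LinearMap.ker (g' ∘ₗ g)) ?_ L (g' ∘ₗ g) (hg'.comp hg) rfl
    rw [← hK]
    refine lt_of_le_of_ne (fun x hx => ?_) fun heq => hinj ?_
    · have hx' : g x = 0 := hx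
      change g' (g x) = 0
      rw [hx', map_zero]
    · rw [injective_iff_map_eq_zero]
      intro y hy
      obtain ⟨x, rfl⟩ := hg y
      have : x ∈ LinearMap.ker (g' ∘ₗ g) := hy
      rw [← heq] at this
      exact this
  exact key _ M LinearMap.id Function.surjective_id rfl

variable [GradedRing 𝒜]

/-- The degree-n part of M is generated additively by the products of R_l with the degree n - l
components of the generators. -/
theorem GrMod.proj_eq_zero_of_smul (T : Set M) (hT : Submodule.span R T = ⊤) {n : ℤ}
    (h : ∀ t ∈ T, ∀ (l : ℕ) (r : R), r ∈ 𝒜 l → r • M.proj (n - l) t = 0) (x : M) :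
    M.proj n x = 0 := by
  classical
  suffices ∀ r : R, M.proj n (r • x) = 0 by simpa using this 1
  have hx : x ∈ Submodule.span R T := by rw [hT]; trivial
  induction hx using Submodule.span_induction with
  | mem t ht =>
    intro r
    rw [← DirectSum.sum_support_decompose 𝒜 r, Finset.sum_smul, map_sum]
    refine Finset.sum_eq_zero fun l _ => ?_
    rw [M.proj_smul_eq (SetLike.coe_mem _)]
    exact h t ht l _ (SetLike.coe_mem _)
  | zero => simp
  | add y z _ _ hy hz => intro r; rw [smul_add, map_add, hy, hz, add_zero]
  | smul c y _ hy => intro r; rw [smul_smul]; exact hy _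

theorem GrMod.exists_bddBelow [Module.Finite R M] : ∃ p : ℤ, ∀ n < p, M.deg n = ⊥ := by
  obtain ⟨T, p, q, hT, hp, -⟩ := M.exists_finset_bounds
  refine ⟨p, fun n hn => M.deg_eq_bot_of_proj (M.proj_eq_zero_of_smul T hT ?_)⟩
  intro t ht l r _
  rw [hp t ht _ (by omega), smul_zero]

/-- One power R₊^k kills M, and R_l ⊆ R₊^l. Beyond k degrees above the generators nothing is left.
-/
theorem GrMod.exists_bddAbove_of_torsion [Module.Finite R M] (hR : IsStandardGraded 𝒜)
    (h : gammaTorsion (posIdeal 𝒜) M = ⊤) : ∃ q : ℤ, ∀ n > q, M.deg n = ⊥ := by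
  obtain ⟨T, p, q, hT, -, hq⟩ := M.exists_finset_bounds
  obtain ⟨k, hk⟩ := exists_pow_smul_eq_zero_of_finite _ M h
  refine ⟨q + k, fun n hn => M.deg_eq_bot_of_proj (M.proj_eq_zero_of_smul T hT ?_)⟩
  intro t ht l r hr
  by_cases hl : n - l > q
  · rw [hq t ht _ hl, smul_zero]
  · exact hk r (Ideal.pow_le_pow_right (by omega) (hR.mem_posIdeal_pow l r hr)) _

theorem GrMod.exists_deg_ne_bot_gt [Nontrivial M] {d : ℕ} (hd : 0 < d) {x : R} (hx : x ∈ 𝒜 d)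
    (hreg : IsSMulRegular M x) (q : ℤ) : ∃ n > q, M.deg n ≠ ⊥ := by
  obtain ⟨n, hn⟩ := M.exists_deg_ne_bot
  obtain ⟨m, hm, hm0⟩ := M.exists_mem_ne_zero hn
  let k := (q - n + 1).toNat
  have h1 : k ≤ k * d := Nat.le_mul_of_pos_right _ hd
  refine ⟨((k * d : ℕ) : ℤ) + n, by omega, fun h => ?_⟩
  have h2 := M.smul_mem (k * d) n (x ^ k) m (SetLike.pow_mem_graded k hx) hm
  rw [h] at h2
  exact hm0 (hreg.pow k (by simpa using h2))

instance {M N : GrMod 𝒜} (f : M →ₗ[R] N) (hf : IsGrHom f) [Module.Finite R N] :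
    Module.Finite R (grCoker f hf) :=
  inferInstanceAs (Module.Finite R (N ⧸ LinearMap.range f))

instance {d : ℕ} {x : R} (hx : x ∈ 𝒜 d) [Module.Finite R M] :
    Module.Finite R (M.modSMul hx) :=
  inferInstanceAs (Module.Finite R (M ⧸ LinearMap.range (LinearMap.lsmul R M x)))

/-- The lowest nonzero component of M cannot be reached by multiplication with an element of
positive degree. -/
theorem GrMod.nontrivial_modSMul_of_pos [Module.Finite R M] [Nontrivial M] {d : ℕ} (hd : 0 < d)
    {x : R} (hx : x ∈ 𝒜 d) : Nontrivial (M.modSMul hx) := by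
  obtain ⟨p, hp⟩ := M.exists_bddBelow
  obtain ⟨n, hn, hmin⟩ := Int.exists_least_of_bdd (P := fun n => M.deg n ≠ ⊥)
    ⟨p, fun n hn => not_lt.mp fun h => hn (hp n h)⟩ M.exists_deg_ne_bot
  obtain ⟨m, hm, hm0⟩ := M.exists_mem_ne_zero hn
  refine M.nontrivial_modSMul_of_ne hx ⟨m, fun y hy => hm0 ?_⟩
  rw [← M.proj_of_mem hm, ← hy, M.proj_smul_eq hx]
  have h1 : M.deg (n - d) = ⊥ := by
    by_contra h
    have := hmin _ h
    omega
  have h2 := M.proj_mem y (n - d)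
  rw [h1] at h2
  rw [show M.proj (n - d) y = 0 from h2, smul_zero]

/-- Nakayama in a graded setting: if xM = M, some r ≡ 1 mod x kills M. The degree-0 component of r
also kills each Mₙ, and it is a unit of the local ring R₀. -/
theorem GrMod.nontrivial_modSMul_of_not_isUnit [IsLocalRing (𝒜 0)] [Module.Finite R M]
    [Nontrivial M] {x : 𝒜 0} (hx : ¬ IsUnit x) : Nontrivial (M.modSMul x.2) := by
  apply M.nontrivial_modSMul_of_ne
  by_contra! hcon
  obtain ⟨r, hr, hrM⟩ := Submodule.exists_sub_one_mem_and_smul_eq_zero_of_fg_of_le_smul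
    (Ideal.span {(x : R)}) (⊤ : Submodule R M) Module.Finite.fg_top (by
      intro m _
      obtain ⟨y, rfl⟩ := hcon m
      exact Submodule.smul_mem_smul (Ideal.mem_span_singleton_self _) trivial)
  obtain ⟨t, ht⟩ := Ideal.mem_span_singleton'.mp hr
  obtain ⟨n, hn⟩ := M.exists_deg_ne_bot
  refine hn (eq_bot_iff.mpr fun m hm => ?_)
  let t₀ : 𝒜 0 := DirectSum.decompose 𝒜 t 0
  have h1 : IsUnit (1 + t₀ * x) := by
    have h2 : t₀ * x ∈ IsLocalRing.maximalIdeal (𝒜 0) :=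
      Ideal.mul_mem_left _ _ ((IsLocalRing.mem_maximalIdeal _).mpr hx)
    by_contra h3
    have h4 := sub_mem ((IsLocalRing.mem_maximalIdeal _).mpr h3) h2
    rw [add_sub_cancel_right] at h4
    exact (IsLocalRing.maximalIdeal.isMaximal (𝒜 0)).ne_top ((Ideal.eq_top_iff_one _).mpr h4)
  have key : ((1 + t₀ * x : 𝒜 0) : R) • m = 0 := by
    have h2 : M.proj n (r • m) = 0 := by rw [hrM m trivial, map_zero]
    have h3 : r = 1 + t * x := by rw [ht]; ring
    have hcomp : ∀ t : R, M.proj n (t • m) = (DirectSum.decompose 𝒜 t 0 : R) • m := by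
      intro t
      induction t using DirectSum.Decomposition.inductionOn 𝒜 with
      | zero => simp
      | @homogeneous i s =>
        rw [M.proj_smul_eq s.2]
        by_cases hi : i = 0
        · subst hi
          rw [DirectSum.decompose_of_mem_same 𝒜 s.2, Nat.cast_zero, sub_zero, M.proj_of_mem hm]
        · rw [DirectSum.decompose_of_mem_ne 𝒜 s.2 hi, zero_smul,
            M.proj_of_mem_ne hm (by omega), smul_zero]
      | add a b ha hb =>
        rw [add_smul, map_add, ha, hb, DirectSum.decompose_add, DirectSum.add_apply,
          AddSubgroup.coe_add, add_smul]
    rw [h3, add_smul, one_smul, map_add, M.proj_of_mem hm, mul_comm, mul_smul,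
      M.proj_smul_eq x.2, Nat.cast_zero, sub_zero, hcomp] at h2
    change ((1 : R) + (t₀ : R) * x) • m = 0
    rw [add_smul, one_smul, mul_comm, mul_smul]
    exact h2
  obtain ⟨w, hw⟩ := h1
  have h5 : ((↑w⁻¹ : 𝒜 0) : R) * ((1 + t₀ * x : 𝒜 0) : R) = 1 := by
    rw [← hw]
    exact congrArg Subtype.val (Units.inv_mul w)
  have h6 := congrArg (fun y => ((↑w⁻¹ : 𝒜 0) : R) • y) key
  simp only [smul_smul, h5, one_smul, smul_zero] at h6
  exact h6

end Bounds

/-! ### Reduction to torsion-free modules and to M/xM. -/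

section Devissage

variable {R : Type u} [CommRing R] {𝒜 : ℕ → AddSubgroup R} [GradedRing 𝒜]

/-- The graded submodule `Γ_{R₊}(M)`. -/
noncomputable abbrev GrMod.torsionPart (M : GrMod 𝒜) : GrMod 𝒜 :=
  M.sub (gammaTorsion (posIdeal 𝒜) M) (M.isGrSub_gammaTorsion posIdeal_isHomogeneous)

/-- The graded module `M / Γ_{R₊}(M)`. -/
noncomputable def GrMod.torsionFreePart (M : GrMod 𝒜) : GrMod 𝒜 :=
  grCoker (M := M.torsionPart) (N := M) (gammaTorsion (posIdeal 𝒜) M).subtype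
    (M.sub_subtype_grHom _ _)

theorem GrMod.shortExact_torsion (M : GrMod 𝒜) :
    GrShortExact (M' := M.torsionPart) (M := M) (M'' := M.torsionFreePart)
      (gammaTorsion (posIdeal 𝒜) M).subtype
      (LinearMap.range (gammaTorsion (posIdeal 𝒜) M).subtype).mkQ :=
  GrShortExact.coker (M' := M.torsionPart) _ Subtype.val_injective

instance (M : GrMod 𝒜) [Module.Finite R M] : Module.Finite R M.torsionFreePart :=
  inferInstanceAs (Module.Finite R
    (M ⧸ LinearMap.range (gammaTorsion (posIdeal 𝒜) M).subtype))

theorem gammaTorsion_torsionPart_eq_top (M : GrMod 𝒜) :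
    gammaTorsion (posIdeal 𝒜) M.torsionPart = ⊤ := by
  rw [eq_top_iff]
  rintro ⟨x, k, hk⟩ -
  exact ⟨k, fun r hr => Subtype.ext (hk r hr)⟩

theorem GrMod.vanishes_of_subsingleton [IsNoetherianRing R] {M : GrMod 𝒜} [Subsingleton M]
    {xs : List R} (hxs : ∀ x ∈ xs, SetLike.IsHomogeneousElem 𝒜 x) (i : ℕ) (n : ℤ) :
    M.Vanishes (Ideal.ofList xs) i n := by
  have h : ∀ n, M.deg n = ⊥ := fun n => eq_bot_iff.mpr fun x _ => Subsingleton.elim x 0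
  exact GrMod.vanishes_ofList_of_deg_eq_bot (q := 0) (fun m _ => h m) hxs i n (h n)

theorem Ideal.IsHomogeneous.exists_eq_ofList [IsNoetherianRing R] {b : Ideal R}
    (hb : b.IsHomogeneous 𝒜) :
    ∃ xs : List R, (∀ x ∈ xs, SetLike.IsHomogeneousElem 𝒜 x) ∧ b = Ideal.ofList xs := by
  classical
  obtain ⟨T, hT⟩ := IsNoetherian.noetherian b
  let S : Finset R := T.biUnion fun t =>
    (DirectSum.decompose 𝒜 t).support.image fun i => (DirectSum.decompose 𝒜 t i : R)
  have hS : ∀ x, x ∈ S → ∃ t ∈ T, ∃ i, (DirectSum.decompose 𝒜 t i : R) = x := by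
    intro x hx
    obtain ⟨t, ht, hx⟩ := Finset.mem_biUnion.mp hx
    obtain ⟨i, -, rfl⟩ := Finset.mem_image.mp hx
    exact ⟨t, ht, i, rfl⟩
  have hlist : Ideal.ofList S.toList = Ideal.span (S : Set R) := by
    rw [Ideal.ofList]; congr 1; ext x; simp
  refine ⟨S.toList, fun x hx => ?_, ?_⟩
  · obtain ⟨t, -, i, rfl⟩ := hS x (Finset.mem_toList.mp hx)
    exact ⟨i, SetLike.coe_mem _⟩
  · rw [hlist]
    apply le_antisymm
    · rw [← hT]
      refine Ideal.span_le.mpr fun t ht => ?_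
      rw [SetLike.mem_coe, ← DirectSum.sum_support_decompose 𝒜 t]
      refine Ideal.sum_mem _ fun i hi => Ideal.subset_span ?_
      exact Finset.mem_biUnion.mpr ⟨t, ht, Finset.mem_image_of_mem _ hi⟩
    · refine Ideal.span_le.mpr fun x hx => ?_
      obtain ⟨t, ht, i, rfl⟩ := hS x hx
      exact hb i (hT ▸ Ideal.subset_span ht)

variable [IsNoetherianRing R]

theorem gammaTorsion_torsionFreePart_eq_bot (M : GrMod 𝒜) :
    gammaTorsion (posIdeal 𝒜) M.torsionFreePart = ⊥ :=
  gammaTorsion_quotient_eq_bot (posIdeal 𝒜) (M := M)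
    (LinearMap.range (gammaTorsion (posIdeal 𝒜) M).subtype) (Submodule.range_subtype _)

instance (M : GrMod 𝒜) [Module.Finite R M] : Module.Finite R M.torsionPart :=
  inferInstanceAs (Module.Finite R (gammaTorsion (posIdeal 𝒜) M))

/-- Induction on finite graded modules: pass to `M / Γ_{R₊}(M)`, and to `M / x M` for a regular
homogeneous element `x` of positive degree. -/
theorem GrMod.graded_induction (hR : IsStandardGraded 𝒜) {p : GrMod 𝒜 → Prop}
    (h0 : ∀ (M : GrMod 𝒜) [Subsingleton M], p M)
    (h1 : ∀ (M : GrMod 𝒜) [Module.Finite R M], gammaTorsion (posIdeal 𝒜) M ≠ ⊥ →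
      p M.torsionFreePart → p M)
    (h2 : ∀ (M : GrMod 𝒜) [Module.Finite R M] [Nontrivial M],
      (∃ d₀ > 0, ∀ d ≥ d₀, ∃ x ∈ 𝒜 d, IsSMulRegular M x) →
      (∀ (d : ℕ) (x : R) (hx : x ∈ 𝒜 d), IsSMulRegular M x → 0 < d → p (M.modSMul hx)) → p M)
    (M : GrMod 𝒜) [Module.Finite R M] : p M := by
  refine GrMod.noetherian_induction (fun M _ ih => ?_) M
  by_cases hΓ : gammaTorsion (posIdeal 𝒜) M = ⊥
  · rcases subsingleton_or_nontrivial M with hM | hM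
    · exact h0 M
    · obtain ⟨d₀, hd₀⟩ := hR.exists_regular M hΓ
      refine h2 M ⟨d₀ + 1, Nat.succ_pos _, fun d hd => hd₀ d (by omega)⟩ fun d x hx hreg hd => ?_
      refine ih (M.modSMul hx) (LinearMap.range (LinearMap.lsmul R M x)).mkQ
        (Submodule.mkQ_surjective _) fun hinj => ?_
      obtain ⟨m, hm⟩ := exists_ne (0 : M)
      have h3 : x • m = 0 := hinj ((Submodule.Quotient.mk_eq_zero _).mpr ⟨m, rfl⟩)
      exact hm (hreg (by simpa using h3))
  · refine h1 M hΓ (ih M.torsionFreePart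
      (LinearMap.range (gammaTorsion (posIdeal 𝒜) M).subtype).mkQ
      (Submodule.mkQ_surjective _) fun hinj => hΓ (eq_bot_iff.mpr fun m hm => ?_))
    exact hinj ((Submodule.Quotient.mk_eq_zero _).mpr ⟨⟨m, hm⟩, rfl⟩)

theorem GrMod.exists_vanishes_of_torsion {b : Ideal R} (hb : b.IsHomogeneous 𝒜)
    (hR : IsStandardGraded 𝒜) (N : GrMod 𝒜)
    [Module.Finite R N] (h : gammaTorsion (posIdeal 𝒜) N = ⊤) :
    ∃ p q : ℤ, ∀ i n, (n < p ∨ q < n) → N.Vanishes b i n := by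
  obtain ⟨xs, hxs, rfl⟩ := hb.exists_eq_ofList
  obtain ⟨p, hp⟩ := N.exists_bddBelow
  obtain ⟨q, hq⟩ := N.exists_bddAbove_of_torsion hR h
  exact ⟨p, q, fun i n hn => GrMod.vanishes_ofList_of_deg_eq_bot hq hxs i n
    (hn.elim (hp n) (hq n))⟩

end Devissage

/-! ### Behaviour of the components in large and in small degrees. -/

/-- Every m ≥ d² is a nonnegative combination of d and d + 1: with r = m mod d, m = (m / d - r) d +
r (d + 1). So one instance propagates to all sufficiently small degrees. -/
theorem Int.forall_lt_of_sub_closed {V : ℤ → Prop} {d : ℕ} (hd : 0 < d) {N n₀ : ℤ} (hn₀ : n₀ < N)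
    (h₀ : V n₀) (h₁ : ∀ n < N, V n → V (n - d)) (h₂ : ∀ n < N, V n → V (n - (d + 1 : ℕ))) :
    ∃ N₀, ∀ n < N₀, V n := by
  have k₁ : ∀ k : ℕ, ∀ n < N, V n → V (n - (k * d : ℕ)) := by
    intro k
    induction k with
    | zero => intro n _ h; simpa using h
    | succ k ih =>
      intro n hn h
      have := h₁ _ (by omega) (ih n hn h)
      convert this using 1
      push_cast; ring
  have k₂ : ∀ k : ℕ, ∀ n < N, V n → V (n - (k * (d + 1) : ℕ)) := by
    intro k
    induction k with
    | zero => intro n _ h; simpa using h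
    | succ k ih =>
      intro n hn h
      have := h₂ _ (by omega) (ih n hn h)
      convert this using 1
      push_cast; ring
  refine ⟨n₀ - (d * d : ℕ), fun n hn => ?_⟩
  obtain ⟨m, hm⟩ := Int.eq_ofNat_of_zero_le (show 0 ≤ n₀ - n by omega)
  have hm' : d * d ≤ m := by omega
  have h1 := Nat.div_add_mod m d
  have h2 := Nat.mod_lt m hd
  have h3 : d ≤ m / d := (Nat.le_div_iff_mul_le hd).mpr hm'
  obtain ⟨e, he⟩ := Nat.exists_eq_add_of_le (h2.le.trans h3)
  have h4 := k₂ (m % d) _ (show n₀ - (e * d : ℕ) < N by omega) (k₁ e n₀ hn₀ h₀)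
  have h5 : m = e * d + m % d * (d + 1) := by
    calc m = d * (m / d) + m % d := h1.symm
      _ = d * (m % d + e) + m % d := by rw [← he]
      _ = e * d + m % d * (d + 1) := by ring
  convert h4 using 1
  omega

section Asymptotics

variable {R : Type u} [CommRing R] {𝒜 : ℕ → AddSubgroup R} [GradedRing 𝒜]

theorem GrMod.exists_vanishes_zero_lt {b : Ideal R} (M : GrMod 𝒜) [Module.Finite R M] :
    ∃ N₀ : ℤ, ∀ n < N₀, M.Vanishes b 0 n := by
  obtain ⟨p, hp⟩ := M.exists_bddBelow
  refine ⟨p, fun n hn => GrMod.vanishes_zero_iff.mpr fun x _ hx => ?_⟩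
  rw [hp n hn] at hx
  exact hx

variable [IsNoetherianRing R]

/-- `Hⁱ_𝔟(M)ₙ = 0` for `n ≫ 0`. -/
theorem GrMod.exists_vanishes_gt (hR : IsStandardGraded 𝒜) {b : Ideal R}
    (hb : b.IsHomogeneous 𝒜) (hpos : posIdeal 𝒜 ≤ b) (M : GrMod 𝒜) [Module.Finite R M] :
    ∀ i, ∃ q : ℤ, ∀ n > q, M.Vanishes b i n := by
  refine GrMod.graded_induction hR (p := fun M => ∀ i, ∃ q : ℤ, ∀ n > q, M.Vanishes b i n)
    ?_ ?_ ?_ M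
  · intro M _ i
    obtain ⟨xs, hxs, rfl⟩ := hb.exists_eq_ofList
    exact ⟨0, fun n _ => GrMod.vanishes_of_subsingleton hxs i n⟩
  · intro M _ _ ih i
    obtain ⟨q, hq⟩ := ih i
    obtain ⟨_, q', hq'⟩ := GrMod.exists_vanishes_of_torsion hb hR M.torsionPart
      (gammaTorsion_torsionPart_eq_top M)
    exact ⟨max q q', fun n hn => M.shortExact_torsion.vanishes_mid hb
      (hq' i n (Or.inr (lt_of_le_of_lt (le_max_right _ _) hn)))
      (hq n (lt_of_le_of_lt (le_max_left _ _) hn))⟩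
  · rintro M _ _ ⟨d, hd, hreg⟩ ih i
    obtain ⟨x, hx, hxr⟩ := hreg d le_rfl
    have hxb : x ∈ b := hpos (mem_posIdeal_of_mem hd hx)
    cases i with
    | zero => exact ⟨0, fun n _ => GrMod.vanishes_zero_of_regular hxb hxr⟩
    | succ i =>
      obtain ⟨q, hq⟩ := ih d x hx hxr hd i
      exact ⟨q, fun n hn => GrMod.vanishes_succ_of_modSMul hb hx hxb hxr fun k =>
        hq _ (by omega)⟩

/-- The first local cohomology module that does not vanish in all small degrees is either
nonzero in all small degrees or zero in all small degrees. -/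
theorem GrMod.vanishes_dichotomy (hR : IsStandardGraded 𝒜) {b : Ideal R}
    (hb : b.IsHomogeneous 𝒜) (g : ℕ) :
    ∀ (M : GrMod 𝒜) [Module.Finite R M], (∀ i < g, ∃ N₀ : ℤ, ∀ n < N₀, M.Vanishes b i n) →
      (∃ N₀ : ℤ, ∀ n < N₀, M.Vanishes b g n) ∨ ∃ N₀ : ℤ, ∀ n < N₀, ¬ M.Vanishes b g n := by
  induction g with
  | zero => intro M _ _; exact Or.inl M.exists_vanishes_zero_lt
  | succ g ih =>
    intro M _ hM
    obtain ⟨p, _, hp⟩ := GrMod.exists_vanishes_of_torsion hb hR M.torsionPart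
      (gammaTorsion_torsionPart_eq_top M)
    have hT : ∀ i < g + 1, ∃ N₀ : ℤ, ∀ n < N₀, M.torsionFreePart.Vanishes b i n := by
      intro i hi
      obtain ⟨N₀, hN₀⟩ := hM i hi
      exact ⟨min p N₀, fun n hn => M.shortExact_torsion.vanishes_right hb
        (hp _ n (Or.inl (lt_of_lt_of_le hn (min_le_left _ _))))
        (hN₀ n (lt_of_lt_of_le hn (min_le_right _ _)))⟩
    have hiff : ∀ n < p, (M.Vanishes b (g + 1) n ↔ M.torsionFreePart.Vanishes b (g + 1) n) :=
      fun n hn => ⟨fun h => M.shortExact_torsion.vanishes_right hb (hp _ n (Or.inl hn)) h,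
        fun h => M.shortExact_torsion.vanishes_mid hb (hp _ n (Or.inl hn)) h⟩
    suffices (∃ N₀ : ℤ, ∀ n < N₀, M.torsionFreePart.Vanishes b (g + 1) n) ∨
        ∃ N₀ : ℤ, ∀ n < N₀, ¬ M.torsionFreePart.Vanishes b (g + 1) n by
      rcases this with ⟨N₀, h⟩ | ⟨N₀, h⟩
      · exact Or.inl ⟨min p N₀, fun n hn => (hiff n (lt_of_lt_of_le hn (min_le_left _ _))).mpr
          (h n (lt_of_lt_of_le hn (min_le_right _ _)))⟩
      · exact Or.inr ⟨min p N₀, fun n hn hv => h n (lt_of_lt_of_le hn (min_le_right _ _))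
          ((hiff n (lt_of_lt_of_le hn (min_le_left _ _))).mp hv)⟩
    generalize hTdef : M.torsionFreePart = T at hT
    have hTf : Module.Finite R T := hTdef ▸ inferInstance
    obtain ⟨d₀, hd₀⟩ := hR.exists_regular T (hTdef ▸ gammaTorsion_torsionFreePart_eq_bot M)
    -- By induction H^g(T/xT) is eventually zero or eventually nonzero. If zero, x is injective on
    -- H^(g+1)(T) in small degrees, so vanishing descends by d. If nonzero, it embeds in H^(g+1)(T)
    -- shifted by d, because H^g(T) is zero there.
    have step : ∀ (d : ℕ) (x : R) (_ : x ∈ 𝒜 d) (_ : IsSMulRegular T x),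
        (∃ N₀ : ℤ, ∀ n < N₀, ¬ T.Vanishes b (g + 1) n) ∨
        ∃ N₀ : ℤ, ∀ n < N₀, T.Vanishes b (g + 1) n → T.Vanishes b (g + 1) (n - d) := by
      intro d x hx hreg
      rcases ih (T.modSMul hx) (by
        intro i hi
        obtain ⟨N₀, h₀⟩ := hT i (by omega)
        obtain ⟨N₁, h₁⟩ := hT (i + 1) (by omega)
        exact ⟨min N₀ N₁, fun n hn => GrMod.vanishes_modSMul hb hx hreg (h₁ _ (by omega))
          (h₀ _ (by omega))⟩) with ⟨N₀, h₀⟩ | ⟨N₀, h₀⟩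
      · exact Or.inr ⟨N₀, fun n hn hv =>
          GrMod.vanishes_of_modSMul_left hb hx hreg hv (h₀ n hn)⟩
      · obtain ⟨N₁, h₁⟩ := hT g (by omega)
        refine Or.inl ⟨min N₀ N₁ - d, fun n hn hv => h₀ (n + d) (by omega) ?_⟩
        exact GrMod.vanishes_modSMul hb hx hreg (by rwa [add_sub_cancel_right]) (h₁ _ (by omega))
    -- Two consecutive positive degrees: vanishing in a single small degree then spreads to all
    -- smaller ones up to a finite gap.
    obtain ⟨x, hx, hxr⟩ := hd₀ (d₀ + 1) (by omega)
    obtain ⟨y, hy, hyr⟩ := hd₀ (d₀ + 1 + 1) (by omega)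
    rcases step _ x hx hxr with h | ⟨N₁, h₁⟩
    · exact Or.inr h
    rcases step _ y hy hyr with h | ⟨N₂, h₂⟩
    · exact Or.inr h
    by_cases hex : ∃ n < min N₁ N₂, T.Vanishes b (g + 1) n
    · obtain ⟨n₀, hn₀, hv⟩ := hex
      exact Or.inl (Int.forall_lt_of_sub_closed (Nat.succ_pos d₀) hn₀ hv
        (fun n hn => h₁ n (lt_of_lt_of_le hn (min_le_left _ _)))
        (fun n hn => h₂ n (lt_of_lt_of_le hn (min_le_right _ _))))
    · push Not at hex
      exact Or.inr ⟨_, hex⟩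

theorem GrMod.vanishes_posIdeal_of_torsion (hR : IsStandardGraded 𝒜) {N : GrMod 𝒜}
    (h : gammaTorsion (posIdeal 𝒜) N = ⊤) (i : ℕ) (n : ℤ) :
    N.Vanishes (posIdeal 𝒜) (i + 1) n := by
  obtain ⟨xs, hxs, he⟩ := hR.exists_list
  rw [he]
  refine GrMod.vanishes_ofList_of_torsion (fun x hx => ⟨1, hxs x hx⟩) (fun x hx y => ?_) i n
  have hy : y ∈ gammaTorsion (posIdeal 𝒜) N := h ▸ Submodule.mem_top
  exact exists_pow_smul_of_mem_gammaTorsion (mem_posIdeal_of_mem one_pos (hxs x hx)) hy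

/-- The top local cohomology module with respect to `R₊`, if it has positive index, is nonzero in
all small degrees. -/
theorem GrMod.exists_not_vanishes_lt (hR : IsStandardGraded 𝒜) (c : ℕ) (M : GrMod 𝒜)
    [Module.Finite R M] : (∀ i > c + 1, ∀ n, M.Vanishes (posIdeal 𝒜) i n) →
      (∃ n, ¬ M.Vanishes (posIdeal 𝒜) (c + 1) n) →
      ∃ N₀ : ℤ, ∀ n < N₀, ¬ M.Vanishes (posIdeal 𝒜) (c + 1) n := by
  have hp := posIdeal_isHomogeneous (𝒜 := 𝒜)
  refine GrMod.graded_induction hR (p := fun M =>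
    (∀ i > c + 1, ∀ n, M.Vanishes (posIdeal 𝒜) i n) →
      (∃ n, ¬ M.Vanishes (posIdeal 𝒜) (c + 1) n) →
      ∃ N₀ : ℤ, ∀ n < N₀, ¬ M.Vanishes (posIdeal 𝒜) (c + 1) n) ?_ ?_ ?_ M
  · rintro M _ - ⟨n, hn⟩
    obtain ⟨xs, hxs, he⟩ := hp.exists_eq_ofList
    exact absurd (he ▸ GrMod.vanishes_of_subsingleton hxs _ n) hn
  · intro M _ _ ih hM hex
    have hΓ := GrMod.vanishes_posIdeal_of_torsion hR (gammaTorsion_torsionPart_eq_top M)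
    have hiff : ∀ i n, M.Vanishes (posIdeal 𝒜) (i + 1) n ↔
        M.torsionFreePart.Vanishes (posIdeal 𝒜) (i + 1) n := fun i n =>
      ⟨fun h => M.shortExact_torsion.vanishes_right hp (hΓ _ n) h,
        fun h => M.shortExact_torsion.vanishes_mid hp (hΓ _ n) h⟩
    simp only [hiff] at hex ⊢
    refine ih (fun i hi n => ?_) hex
    obtain ⟨j, rfl⟩ := Nat.exists_eq_succ_of_ne_zero (Nat.ne_zero_of_lt hi)
    exact (hiff j n).mp (hM _ hi n)
  · rintro M _ _ ⟨d, hd, hreg⟩ ih hM ⟨n₀, hn₀⟩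
    -- H^(c+1)(M) maps onto H^(c+1)(M/xM), since H^(c+2)(M) = 0. If the latter is nonzero, induction
    -- applies to it. Otherwise x is surjective on H^(c+1)(M), and nonvanishing descends by e.
    have step : ∀ (e : ℕ) (x : R) (_ : x ∈ 𝒜 e) (_ : IsSMulRegular M x) (_ : 0 < e),
        (∃ N₀ : ℤ, ∀ n < N₀, ¬ M.Vanishes (posIdeal 𝒜) (c + 1) n) ∨
        ∀ n, ¬ M.Vanishes (posIdeal 𝒜) (c + 1) n → ¬ M.Vanishes (posIdeal 𝒜) (c + 1) (n - e) := by
      intro e x hx hxr he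
      by_cases hex : ∃ n, ¬ (M.modSMul hx).Vanishes (posIdeal 𝒜) (c + 1) n
      · obtain ⟨N₀, h₀⟩ := ih e x hx hxr he (fun i hi n =>
          GrMod.vanishes_modSMul hp hx hxr (hM _ (by omega) _) (hM i hi n)) hex
        exact Or.inl ⟨N₀, fun n hn hv => h₀ n hn
          (GrMod.vanishes_modSMul hp hx hxr (hM _ (by omega) _) hv)⟩
      · push Not at hex
        exact Or.inr fun n hn hv => hn (GrMod.vanishes_of_modSMul_mid hp hx hxr hv (hex n))
    obtain ⟨x, hx, hxr⟩ := hreg d le_rfl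
    obtain ⟨y, hy, hyr⟩ := hreg (d + 1) (by omega)
    rcases step _ x hx hxr hd with h | h₁
    · exact h
    rcases step _ y hy hyr (by omega) with h | h₂
    · exact h
    exact Int.forall_lt_of_sub_closed (V := fun n => ¬ M.Vanishes (posIdeal 𝒜) (c + 1) n) hd
      (lt_add_one n₀) hn₀ (fun n _ => h₁ n) (fun n _ => h₂ n)

/-- Either R₊-torsion gives H⁰ ≠ 0, or M/xM is nonzero for a regular x of positive degree, and its
cohomology is squeezed between two terms Hⁱ(M) and Hⁱ⁺¹(M). -/
theorem GrMod.exists_not_vanishes (hR : IsStandardGraded 𝒜) (M : GrMod 𝒜)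
    [Module.Finite R M] : Nontrivial M → ∃ i n, ¬ M.Vanishes (posIdeal 𝒜) i n := by
  have hp := posIdeal_isHomogeneous (𝒜 := 𝒜)
  refine GrMod.graded_induction hR (p := fun M =>
    Nontrivial M → ∃ i n, ¬ M.Vanishes (posIdeal 𝒜) i n) ?_ ?_ ?_ M
  · intro M hM hM'
    exact absurd hM' (not_nontrivial_iff_subsingleton.mpr hM)
  · intro M _ hΓ _ _
    by_contra! hcon
    refine hΓ (eq_bot_iff.mpr fun x hx => M.eq_zero_of_proj fun n => ?_)
    exact GrMod.vanishes_zero_iff.mp (hcon 0 n) _ (M.isGrSub_gammaTorsion hp x hx n)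
      (M.proj_mem x n)
  · rintro M _ _ ⟨d, hd, hreg⟩ ih _
    obtain ⟨x, hx, hxr⟩ := hreg d le_rfl
    obtain ⟨i, n, h⟩ := ih d x hx hxr hd (M.nontrivial_modSMul_of_pos hd hx)
    by_contra! hcon
    exact h (GrMod.vanishes_modSMul hp hx hxr (hcon _ _) (hcon _ _))

end Asymptotics

/-! ### Truncation by degree. -/

section Truncation

variable {R : Type u} [CommRing R] {𝒜 : ℕ → AddSubgroup R} [GradedRing 𝒜]

/-- The submodule `⨁ k ≥ n, Mₖ`. -/
def GrMod.truncGE (M : GrMod 𝒜) (n : ℤ) : Submodule R M where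
  carrier := {x | ∀ k < n, M.proj k x = 0}
  zero_mem' := fun k _ => map_zero _
  add_mem' := fun hx hy k hk => by rw [map_add, hx k hk, hy k hk, add_zero]
  smul_mem' := fun r x hx k hk => by
    classical
    rw [← DirectSum.sum_support_decompose 𝒜 r, Finset.sum_smul, map_sum]
    refine Finset.sum_eq_zero fun l _ => ?_
    rw [M.proj_smul_eq (SetLike.coe_mem _), hx _ (by omega), smul_zero]

theorem GrMod.isGrSub_truncGE (M : GrMod 𝒜) (n : ℤ) : M.IsGrSub (M.truncGE n) := by
  intro x hx m k hk
  by_cases h : k = m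
  · subst h
    rw [hx k hk, map_zero]
  · exact M.proj_of_mem_ne (M.proj_mem x m) h

theorem GrMod.deg_sub_truncGE (M : GrMod 𝒜) (n m : ℤ) (h : m < n) :
    (M.sub (M.truncGE n) (M.isGrSub_truncGE n)).deg m = ⊥ := by
  rw [eq_bot_iff]
  rintro ⟨x, hx⟩ hxm
  have h1 : x ∈ M.deg m := hxm
  have h2 := hx m h
  rw [M.proj_of_mem h1] at h2
  exact Subtype.ext h2

theorem GrMod.mem_truncGE (M : GrMod 𝒜) {n m : ℤ} (h : n ≤ m) {x : M} (hx : x ∈ M.deg m) :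
    x ∈ M.truncGE n := fun _ hk => M.proj_of_mem_ne hx (by omega)

end Truncation

/-! ### Modules whose local cohomology vanishes in small degrees. -/

section FinitenessDimension

variable {R : Type u} [CommRing R] {𝒜 : ℕ → AddSubgroup R} [GradedRing 𝒜] [IsNoetherianRing R]

/-- A nonzero module concentrated in a single degree has nonzero local cohomology with respect to
`𝔞 + R₊`. -/
theorem GrMod.exists_not_vanishes_of_concentrated [IsLocalRing (𝒜 0)] {a : Ideal R}
    (ha : a.IsHomogeneous 𝒜) (ha' : a ≠ ⊤) (n : ℤ) (M : GrMod 𝒜) [Module.Finite R M] :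
    (∀ k, k ≠ n → M.deg k = ⊥) → Nontrivial M → ∃ i, ¬ M.Vanishes (a ⊔ posIdeal 𝒜) i n := by
  have hb := ha.sup (posIdeal_isHomogeneous (𝒜 := 𝒜))
  refine GrMod.noetherian_induction (p := fun M => (∀ k, k ≠ n → M.deg k = ⊥) → Nontrivial M →
    ∃ i, ¬ M.Vanishes (a ⊔ posIdeal 𝒜) i n) (fun M _ ih hM _ => ?_) M
  have hMn : ∀ m : M, m ∈ M.deg n := fun m => M.mem_deg_of_proj fun k hk => by
    have := M.proj_mem m k
    rwa [hM k hk] at this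
  have hhom : ∀ (l : ℕ) (r : R), 0 < l → r ∈ 𝒜 l → ∀ m : M, r • m = 0 := by
    intro l r hl hr m
    have := M.smul_mem l n r m hr (hMn m)
    rwa [hM _ (by omega)] at this
  have hpos : ∀ r ∈ posIdeal 𝒜, ∀ m : M, r • m = 0 := by
    classical
    intro r hr m
    rw [← DirectSum.sum_support_decompose 𝒜 r, Finset.sum_smul]
    refine Finset.sum_eq_zero fun l _ => ?_
    rcases Nat.eq_zero_or_pos l with rfl | hl
    · have := (HomogeneousIdeal.mem_irrelevant_iff 𝒜 r).mp hr
      rw [GradedRing.proj_apply] at this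
      rw [this, zero_smul]
    · exact hhom l _ hl (SetLike.coe_mem _) m
  let a₀ : Ideal (𝒜 0) := a.comap (algebraMap (𝒜 0) R)
  have ha₀ : ∀ y : 𝒜 0, y ∈ a₀ → ¬ IsUnit y := by
    intro y hy hunit
    exact ha' (Ideal.eq_top_of_isUnit_mem _ hy (hunit.map (algebraMap (𝒜 0) R)))
  -- R₊ acts as zero on M, so only `a₀` matters. Either it kills a nonzero element, which lies in
  -- H⁰, or prime avoidance on contracted associated primes finds an M-regular nonunit y in `a₀`.
  -- Then M/yM is a nonzero proper quotient.
  by_cases htor : ∃ m : M, m ≠ 0 ∧ ∀ y : 𝒜 0, y ∈ a₀ → (y : R) • m = 0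
  · classical
    obtain ⟨m, hm, hy⟩ := htor
    refine ⟨0, fun hv => hm (GrMod.vanishes_zero_iff.mp hv m ?_ (hMn m))⟩
    rw [gammaTorsion_sup]
    refine ⟨⟨1, fun r hr => ?_⟩, ⟨1, fun r hr => hpos r (by simpa using hr) m⟩⟩
    rw [pow_one] at hr
    rw [← DirectSum.sum_support_decompose 𝒜 r, Finset.sum_smul]
    refine Finset.sum_eq_zero fun l _ => ?_
    rcases Nat.eq_zero_or_pos l with rfl | hl
    · exact hy _ (ha 0 hr)
    · exact hhom l _ hl (SetLike.coe_mem _) m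
  · have hfin := associatedPrimes.finite R M
    have hav : ∃ y ∈ a₀, ∀ P ∈ associatedPrimes R M, (y : R) ∉ P := by
      by_contra! hcon
      have h1 := (Ideal.subset_union_prime_finite hfin (f := fun P : Ideal R =>
        P.comap (algebraMap (𝒜 0) R)) (I := a₀) ⊥ ⊥ (fun P hP _ _ => by
          have := IsAssociatedPrime.isPrime hP
          exact Ideal.comap_isPrime _ _)).mp (fun y hy => by
            obtain ⟨P, hP, hyP⟩ := hcon y hy
            exact Set.mem_iUnion₂.mpr ⟨P, hP, hyP⟩)
      obtain ⟨P, hP, hle⟩ := h1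
      obtain ⟨m, hm, hPm⟩ := exists_eq_annihilator_of_mem_associatedPrimes hP
      exact htor ⟨m, hm, fun y hy => hPm _ (hle hy)⟩
    obtain ⟨y, hy, hyP⟩ := hav
    have hreg : IsSMulRegular M (y : R) := isSMulRegular_of_notMem_associatedPrimes hyP
    obtain ⟨i, hi⟩ := ih (M.modSMul y.2) (LinearMap.range (LinearMap.lsmul R M (y : R))).mkQ
      (Submodule.mkQ_surjective _) (fun hinj => by
        obtain ⟨m, hm⟩ := exists_ne (0 : M)
        have h3 : (y : R) • m = 0 := hinj ((Submodule.Quotient.mk_eq_zero _).mpr ⟨m, rfl⟩)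
        exact hm (hreg (by simpa using h3)))
      (fun k hk => GrMod.deg_grCoker_eq_bot (hM k hk))
      (M.nontrivial_modSMul_of_not_isUnit (ha₀ y hy))
    by_contra! hcon
    exact hi (GrMod.vanishes_modSMul hb y.2 hreg (by simpa using hcon (i + 1)) (hcon i))

/-- For modules bounded above, cohomology in degree n sees only the component of degree n: L / L_{≥
n} and L_{≥ n+1} contribute nothing there. This reduces L to a module concentrated in degree n. -/
theorem GrMod.exists_not_vanishes_of_bddAbove [IsLocalRing (𝒜 0)] {a : Ideal R}
    (ha : a.IsHomogeneous 𝒜) (ha' : a ≠ ⊤) (L : GrMod 𝒜) [Module.Finite R L] {q : ℤ}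
    (hq : ∀ m > q, L.deg m = ⊥) {n : ℤ} (hn : L.deg n ≠ ⊥) :
    ∃ i, ¬ L.Vanishes (a ⊔ posIdeal 𝒜) i n := by
  have hb := ha.sup (posIdeal_isHomogeneous (𝒜 := 𝒜))
  obtain ⟨xs, hxs, he⟩ := hb.exists_eq_ofList
  have hbot : ∀ (N : GrMod 𝒜) (q : ℤ), (∀ m > q, N.deg m = ⊥) → N.deg n = ⊥ →
      ∀ i, N.Vanishes (a ⊔ posIdeal 𝒜) i n := by
    intro N q hq hN i
    rw [he]
    exact GrMod.vanishes_ofList_of_deg_eq_bot hq hxs i n hN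
  by_contra! hcon
  let L₁ := L.sub (L.truncGE n) (L.isGrSub_truncGE n)
  have hL₁q : ∀ m > q, L₁.deg m = ⊥ := fun m hm => L.deg_sub_eq_bot _ (hq m hm)
  have hL₁n : ∀ m < n, L₁.deg m = ⊥ := fun m hm => L.deg_sub_truncGE n m hm
  have hL₁f : Module.Finite R L₁ := inferInstanceAs (Module.Finite R (L.truncGE n))
  have hse := GrShortExact.coker (L.sub_subtype_grHom (L.truncGE n) (L.isGrSub_truncGE n))
    Subtype.val_injective
  have hL₁ : ∀ i, L₁.Vanishes (a ⊔ posIdeal 𝒜) i n := by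
    intro i
    cases i with
    | zero => exact hse.vanishes_zero_left (hcon 0)
    | succ i =>
      refine hse.vanishes_left hb (hcon _) (hbot _ q (fun m hm =>
        GrMod.deg_grCoker_eq_bot (hq m hm)) ?_ i)
      rw [eq_bot_iff]
      rintro _ ⟨x, hx, rfl⟩
      exact (Submodule.Quotient.mk_eq_zero _).mpr ⟨⟨x, L.mem_truncGE le_rfl hx⟩, rfl⟩
  let L₂ := L₁.sub (L₁.truncGE (n + 1)) (L₁.isGrSub_truncGE (n + 1))
  have hse₂ := GrShortExact.coker
    (L₁.sub_subtype_grHom (L₁.truncGE (n + 1)) (L₁.isGrSub_truncGE (n + 1))) Subtype.val_injective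
  have hL₂ : ∀ i, L₂.Vanishes (a ⊔ posIdeal 𝒜) i n :=
    hbot L₂ q (fun m hm => L₁.deg_sub_eq_bot _ (hL₁q m hm))
      (L₁.deg_sub_truncGE _ _ (lt_add_one n))
  obtain ⟨i, hi⟩ := GrMod.exists_not_vanishes_of_concentrated ha ha' n
    (grCoker (M := L₂) (N := L₁) (L₁.truncGE (n + 1)).subtype (L₁.sub_subtype_grHom _ _)) (by
      intro k hk
      rcases lt_or_gt_of_ne hk with hk | hk
      · exact GrMod.deg_grCoker_eq_bot (hL₁n k hk)
      · rw [eq_bot_iff]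
        rintro _ ⟨x, hx, rfl⟩
        exact (Submodule.Quotient.mk_eq_zero _).mpr
          ⟨⟨x, L₁.mem_truncGE (Int.add_one_le_of_lt hk) hx⟩, rfl⟩) (by
      obtain ⟨m, hm, hm0⟩ := L.exists_mem_ne_zero hn
      let m₁ : L₁ := ⟨m, L.mem_truncGE le_rfl hm⟩
      have hm₁ : m₁ ∈ L₁.deg n := hm
      refine ⟨⟨(LinearMap.range (L₁.truncGE (n + 1)).subtype).mkQ m₁, 0, fun h => ?_⟩⟩
      obtain ⟨⟨y, hy⟩, hym⟩ := (Submodule.Quotient.mk_eq_zero _).mp h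
      have h1 : y = m₁ := hym
      subst h1
      have h2 := hy n (lt_add_one n)
      rw [L₁.proj_of_mem hm₁] at h2
      exact hm0 (congrArg Subtype.val h2))
  exact hi (hse₂.vanishes_right hb (hL₂ _) (hL₁ i))

/-- If `Hⁱ_{𝔞 + R₊}(M)ₙ = 0` for all `i` and `n ≪ 0`, then `M` is `R₊`-torsion. -/
theorem GrMod.gammaTorsion_eq_top_of_vanishes [IsLocalRing (𝒜 0)] (hR : IsStandardGraded 𝒜)
    {a : Ideal R} (ha : a.IsHomogeneous 𝒜) (ha' : a ≠ ⊤) (M : GrMod 𝒜) [Module.Finite R M] :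
    (∀ i, ∃ N₀ : ℤ, ∀ n < N₀, M.Vanishes (a ⊔ posIdeal 𝒜) i n) →
      gammaTorsion (posIdeal 𝒜) M = ⊤ := by
  have hb := ha.sup (posIdeal_isHomogeneous (𝒜 := 𝒜))
  refine GrMod.graded_induction hR (p := fun M =>
    (∀ i, ∃ N₀ : ℤ, ∀ n < N₀, M.Vanishes (a ⊔ posIdeal 𝒜) i n) →
      gammaTorsion (posIdeal 𝒜) M = ⊤) ?_ ?_ ?_ M
  · intro M _ _
    exact eq_top_iff.mpr fun x _ => by rw [Subsingleton.elim x 0]; exact zero_mem _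
  · intro M _ _ ih hM
    obtain ⟨p, _, hp⟩ := GrMod.exists_vanishes_of_torsion hb hR M.torsionPart
      (gammaTorsion_torsionPart_eq_top M)
    have h1 := ih fun i => by
      obtain ⟨N₀, h₀⟩ := hM i
      exact ⟨min p N₀, fun n hn => M.shortExact_torsion.vanishes_right hb
        (hp _ n (Or.inl (lt_of_lt_of_le hn (min_le_left _ _))))
        (h₀ n (lt_of_lt_of_le hn (min_le_right _ _)))⟩
    rw [gammaTorsion_torsionFreePart_eq_bot] at h1
    refine eq_top_iff.mpr fun x _ => ?_
    have h2 : (LinearMap.range (gammaTorsion (posIdeal 𝒜) M).subtype).mkQ x = 0 := by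
      have h3 : (show M.torsionFreePart from
          (LinearMap.range (gammaTorsion (posIdeal 𝒜) M).subtype).mkQ x) ∈
          (⊤ : Submodule R M.torsionFreePart) := trivial
      rw [← h1] at h3
      exact h3
    obtain ⟨y, rfl⟩ := (Submodule.Quotient.mk_eq_zero _).mp h2
    exact y.2
  · rintro M _ _ ⟨d, hd, hreg⟩ ih hM
    exfalso
    obtain ⟨x, hx, hxr⟩ := hreg d le_rfl
    obtain ⟨xs, hxs, he⟩ := hb.exists_eq_ofList
    have hlarge : ∀ i > xs.length, ∀ n, M.Vanishes (a ⊔ posIdeal 𝒜) i n := fun i hi n => by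
      rw [he]
      exact GrMod.vanishes_ofList_of_length_lt hxs i hi n
    choose q hq using GrMod.exists_vanishes_gt hR hb le_sup_right M
    choose N hN using hM
    obtain ⟨Q, hQ⟩ := ((Finset.range (xs.length + 1)).image q).bddAbove
    obtain ⟨P, hP⟩ := ((Finset.range (xs.length + 1)).image N).bddBelow
    have hQ' : ∀ i, ∀ n > Q, M.Vanishes (a ⊔ posIdeal 𝒜) i n := by
      intro i n hn
      by_cases hi : i < xs.length + 1
      · exact hq i n (lt_of_le_of_lt
          (hQ (Finset.mem_image_of_mem q (Finset.mem_range.mpr hi))) hn)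
      · exact hlarge i (by omega) n
    have hP' : ∀ i, ∀ n < P, M.Vanishes (a ⊔ posIdeal 𝒜) i n := by
      intro i n hn
      by_cases hi : i < xs.length + 1
      · exact hN i n (lt_of_lt_of_le hn
          (hP (Finset.mem_image_of_mem N (Finset.mem_range.mpr hi))))
      · exact hlarge i (by omega) n
    -- Choose n above all the cohomology of M, and a power y of x whose degree D puts n - D below
    -- both the cohomology and M. Then (M/yM)ₙ = Mₙ ≠ 0, while both neighbours of Hⁱ(M/yM)ₙ vanish.
    obtain ⟨n, hnQ, hn⟩ := M.exists_deg_ne_bot_gt hd hx hxr Q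
    obtain ⟨p, hp⟩ := M.exists_bddBelow
    let m := (n - min P p + 1).toNat
    have hmd : m + 1 ≤ (m + 1) * d := Nat.le_mul_of_pos_right _ hd
    have hxm : x ^ (m + 1) ∈ 𝒜 ((m + 1) * d) := SetLike.pow_mem_graded (m + 1) hx
    have hxmr : IsSMulRegular M (x ^ (m + 1)) := hxr.pow _
    have hlow : n - ((m + 1) * d : ℕ) < min P p := by omega
    have hLv : ∀ i, (M.modSMul hxm).Vanishes (a ⊔ posIdeal 𝒜) i n := fun i =>
      GrMod.vanishes_modSMul hb hxm hxmr
        (hP' _ _ (lt_of_lt_of_le hlow (min_le_left _ _))) (hQ' i n hnQ)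
    -- The induction hypothesis makes M/yM torsion, hence bounded above, so that its nonzero
    -- component in degree n contradicts the vanishing of `hLv`.
    have hLt := ih _ _ hxm hxmr (by omega) fun i => ⟨P, fun k hk =>
      GrMod.vanishes_modSMul hb hxm hxmr (hP' _ _ (by omega)) (hP' _ _ hk)⟩
    obtain ⟨q', hq'⟩ := (M.modSMul hxm).exists_bddAbove_of_torsion hR hLt
    obtain ⟨i, hi⟩ := GrMod.exists_not_vanishes_of_bddAbove ha ha' (M.modSMul hxm) hq' (n := n) (by
      intro hbot
      obtain ⟨w, hw, hw0⟩ := M.exists_mem_ne_zero hn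
      have h1 : (show M.modSMul hxm from
          (LinearMap.range (LinearMap.lsmul R M (x ^ (m + 1)))).mkQ w) ∈ (M.modSMul hxm).deg n :=
        ⟨w, hw, rfl⟩
      rw [hbot] at h1
      obtain ⟨y, hy⟩ := (Submodule.Quotient.mk_eq_zero _).mp h1
      have hy' : x ^ (m + 1) • y = w := hy
      refine hw0 ?_
      rw [← M.proj_of_mem hw, ← hy', M.proj_smul_eq hxm]
      have h2 := M.proj_mem y (n - ((m + 1) * d : ℕ))
      rw [hp _ (lt_of_lt_of_le hlow (min_le_right _ _))] at h2
      rw [show M.proj (n - ((m + 1) * d : ℕ)) y = 0 from h2, smul_zero])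
    exact hi (hLv i)

end FinitenessDimension

/-! ### Nilpotent action of R₊ on local cohomology. -/

section Annihilation

variable {R : Type u} [CommRing R] {𝒜 : ℕ → AddSubgroup R}

/-- The element `r` annihilates the cohomology of `Γ_𝔟(J)` in degree `i`. -/
def GrInjRes.Kills {M : GrMod 𝒜} (J : GrInjRes M) (b : Ideal R) (i : ℕ) (r : R) : Prop :=
  ∀ z ∈ J.cocycles b i, r • z ∈ J.coboundaries b i

/-- r sends a class of M'' into the kernel of the connecting map, that is, the image of Hⁱ(M), and s
kills that image. -/
theorem GrShortExact.kills_right {M' M M'' : GrMod 𝒜} {f : M' →ₗ[R] M} {g : M →ₗ[R] M''}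
    (h : GrShortExact f g) (J' : GrInjRes M') (J : GrInjRes M) (J'' : GrInjRes M'') {b : Ideal R}
    {i : ℕ} {r s : R} (h' : J'.Kills b (i + 1) r) (hM : J.Kills b i s) : J''.Kills b i (s * r) := by
  obtain ⟨φ⟩ := GrLift.nonempty J' J h.f_grHom
  obtain ⟨ψ⟩ := GrLift.nonempty J J'' h.g_grHom
  obtain ⟨δ, hδ⟩ := (h.long_exact φ ψ).2.2
  obtain ⟨h1, -, h3, -⟩ := (hδ i).2 b
  intro z hz
  have h4 := h' _ (h1 z hz)
  rw [← map_smul] at h4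
  obtain ⟨w, hw, hwz⟩ := h3 (r • z) (Submodule.smul_mem _ r hz) h4
  have h5 := ψ.map_coboundaries (hM w hw)
  rw [map_smul] at h5
  have := add_mem (Submodule.smul_mem _ s hwz) h5
  rwa [smul_sub, sub_add_cancel, smul_smul] at this

variable [GradedRing 𝒜]

/-- Every homogeneous element of positive degree acts nilpotently on the local cohomology. -/
def GrMod.PosNilpotent (M : GrMod 𝒜) (b : Ideal R) : Prop :=
  ∀ (i d : ℕ) (x : R), x ∈ 𝒜 d → 0 < d → ∃ k : ℕ, M.injRes.Kills b i (x ^ k)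

/-- A high power of x moves every degree of the interval [p, q] beyond q. -/
theorem GrInjRes.kills_pow_of_bounded {M : GrMod 𝒜} (J : GrInjRes M) {b : Ideal R}
    (hb : b.IsHomogeneous 𝒜) {p q : ℤ} {i : ℕ}
    (h : ∀ n, (n < p ∨ q < n) → J.Vanishes b i n) {d : ℕ} {x : R} (hx : x ∈ 𝒜 d) (hd : 0 < d) :
    ∃ k : ℕ, J.Kills b i (x ^ k) := by
  let k := (q - p + 1).toNat
  have hk : k ≤ k * d := Nat.le_mul_of_pos_right _ hd
  have hxk : x ^ k ∈ 𝒜 (k * d) := SetLike.pow_mem_graded k hx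
  refine ⟨k, fun z hz => ?_⟩
  refine (J.obj i).mem_of_proj_mem (S := (J.coboundaries b i).toAddSubgroup) fun n => ?_
  rw [(J.obj i).proj_smul_eq hxk]
  have hzc := J.isGrSub_cocycles hb i z hz (n - (k * d : ℕ))
  have hzn := (J.obj i).proj_mem z (n - (k * d : ℕ))
  by_cases hn : n - (k * d : ℕ) < p
  · exact Submodule.smul_mem _ _ (h _ (Or.inl hn) _ hzc hzn)
  · refine h n (Or.inr (by omega)) _ (Submodule.smul_mem _ _ hzc) ?_
    have := (J.obj i).smul_mem _ _ _ _ hxk hzn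
    rwa [add_sub_cancel] at this

theorem GrMod.PosNilpotent.modSMul {M : GrMod 𝒜} {b : Ideal R} (h : M.PosNilpotent b) {d : ℕ}
    {x : R} (hx : x ∈ 𝒜 d) (hreg : IsSMulRegular M x) : (M.modSMul hx).PosNilpotent b := by
  intro i e y hy he
  obtain ⟨k, hk⟩ := h i e y hy he
  obtain ⟨l, hl⟩ := h (i + 1) e y hy he
  exact ⟨k + l, pow_add y k l ▸ (M.shortExact_modSMul hx hreg).kills_right
    (M.injRes.shift (-d)) M.injRes _ (fun z hz => hl z hz) hk⟩

variable [IsNoetherianRing R]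

/-- If y kills Hⁱ(M), then Hⁱ(M) embeds in Hⁱ(M/yM), to which induction applies because nilpotency
passes to M/yM. The torsion part is harmless, having cohomology in a bounded range. -/
theorem GrMod.exists_vanishes_lt_of_posNilpotent (hR : IsStandardGraded 𝒜) {b : Ideal R}
    (hb : b.IsHomogeneous 𝒜) (M : GrMod 𝒜) [Module.Finite R M] :
    M.PosNilpotent b → ∀ i, ∃ N₀ : ℤ, ∀ n < N₀, M.Vanishes b i n := by
  refine GrMod.graded_induction hR (p := fun M =>
    M.PosNilpotent b → ∀ i, ∃ N₀ : ℤ, ∀ n < N₀, M.Vanishes b i n) ?_ ?_ ?_ M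
  · intro M _ _ i
    obtain ⟨xs, hxs, rfl⟩ := hb.exists_eq_ofList
    exact ⟨0, fun n _ => GrMod.vanishes_of_subsingleton hxs i n⟩
  · intro M _ _ ih hM i
    obtain ⟨p, q, hp⟩ := GrMod.exists_vanishes_of_torsion hb hR M.torsionPart
      (gammaTorsion_torsionPart_eq_top M)
    obtain ⟨N₀, h₀⟩ := ih (by
      intro i e y hy he
      obtain ⟨k, hk⟩ := hM i e y hy he
      obtain ⟨l, hl⟩ := M.torsionPart.injRes.kills_pow_of_bounded hb (hp (i + 1)) hy he
      exact ⟨k + l, pow_add y k l ▸ M.shortExact_torsion.kills_right _ _ _ hl hk⟩) i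
    exact ⟨min p N₀, fun n hn => M.shortExact_torsion.vanishes_mid hb
      (hp _ n (Or.inl (lt_of_lt_of_le hn (min_le_left _ _))))
      (h₀ n (lt_of_lt_of_le hn (min_le_right _ _)))⟩
  · rintro M _ _ ⟨d, hd, hreg⟩ ih hM i
    obtain ⟨x, hx, hxr⟩ := hreg d le_rfl
    obtain ⟨k, hk⟩ := hM i d x hx hd
    -- The exponent k + 1 keeps the degree positive even when k = 0.
    have hy : x ^ (k + 1) ∈ 𝒜 ((k + 1) * d) := SetLike.pow_mem_graded (k + 1) hx
    have hyr : IsSMulRegular M (x ^ (k + 1)) := hxr.pow _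
    obtain ⟨N₀, h₀⟩ := ih _ _ hy hyr (Nat.mul_pos k.succ_pos hd) (hM.modSMul hy hyr) i
    refine ⟨N₀, fun n hn z hz hzn => ?_⟩
    have hse := M.shortExact_modSMul hy hyr
    obtain ⟨ψ⟩ := GrLift.nonempty M.injRes (M.modSMul hy).injRes hse.g_grHom
    obtain ⟨w, hw, hwz⟩ := (hse.long_exact (GrLift.smul M.injRes hy) ψ).1 b i z hz
      (h₀ n hn _ (ψ.map_cocycles hz) (ψ.grHom i n z hzn))
    replace hwz : z - x ^ (k + 1) • (show M.injRes.obj i from w) ∈ M.injRes.coboundaries b i := hwz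
    have h1 : x ^ (k + 1) • (show M.injRes.obj i from w) ∈ M.injRes.coboundaries b i := by
      rw [pow_succ', mul_smul]
      exact Submodule.smul_mem _ _ (hk w hw)
    have := add_mem hwz h1
    rwa [sub_add_cancel] at this

theorem GrMod.gammaTorsion_eq_top_of_le_radical [IsLocalRing (𝒜 0)] (hR : IsStandardGraded 𝒜)
    {a : Ideal R} (ha : a.IsHomogeneous 𝒜) (ha' : a ≠ ⊤) (M : GrMod 𝒜) [Module.Finite R M]
    (h : ∀ i, posIdeal 𝒜 ≤
      (Module.annihilator R (grLocalCohomology M (a ⊔ posIdeal 𝒜) i)).radical) :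
    gammaTorsion (posIdeal 𝒜) M = ⊤ := by
  refine M.gammaTorsion_eq_top_of_vanishes hR ha ha'
    (M.exists_vanishes_lt_of_posNilpotent hR (ha.sup posIdeal_isHomogeneous) ?_)
  intro i d x hx hd
  obtain ⟨k, hk⟩ := h i (mem_posIdeal_of_mem hd hx)
  refine ⟨k, fun z hz => ?_⟩
  have h1 := Module.mem_annihilator.mp hk (Submodule.Quotient.mk ⟨z, hz⟩)
  rw [← Submodule.Quotient.mk_smul] at h1
  exact (Submodule.Quotient.mk_eq_zero
    (x := (x ^ k • ⟨z, hz⟩ : M.injRes.cocycles (a ⊔ posIdeal 𝒜) i)) _).mp h1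

end Annihilation

/-! ### Regular sequences, linkage and Mayer–Vietoris. -/

section Linkage

variable {R : Type u} [CommRing R] {𝒜 : ℕ → AddSubgroup R} [GradedRing 𝒜]

open scoped Pointwise in
/-- The identification of `M / x M` with Mathlib's quotient. -/
noncomputable def GrMod.quotSMulTopEquiv (M : GrMod 𝒜) {d : ℕ} {x : R} (hx : x ∈ 𝒜 d) :
    QuotSMulTop x M ≃ₗ[R] M.modSMul hx :=
  Submodule.quotEquivOfEq (x • (⊤ : Submodule R M)) (LinearMap.range (LinearMap.lsmul R M x)) (by
    ext m
    rw [Submodule.mem_smul_pointwise_iff_exists, LinearMap.mem_range]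
    simp)

/-- The grade bound: each regular element of 𝔢 shifts the vanishing range from M/rM to M by one
index. -/
theorem GrMod.vanishes_lt_of_isWeaklyRegular {e : Ideal R} (he : e.IsHomogeneous 𝒜)
    (rs : List R) : ∀ (M : GrMod 𝒜), (∀ r ∈ rs, SetLike.IsHomogeneousElem 𝒜 r) →
      (∀ r ∈ rs, r ∈ e) → RingTheory.Sequence.IsWeaklyRegular M rs →
      ∀ i < rs.length, ∀ n, M.Vanishes e i n := by
  induction rs with
  | nil => intro M _ _ _ i hi; exact absurd hi (Nat.not_lt_zero i)
  | cons r rs ih =>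
    intro M hhom hmem hreg i hi n
    obtain ⟨d, hd⟩ := hhom r List.mem_cons_self
    obtain ⟨hr, hrs⟩ := (RingTheory.Sequence.isWeaklyRegular_cons_iff M r rs).mp hreg
    have hre := hmem r List.mem_cons_self
    cases i with
    | zero => exact GrMod.vanishes_zero_of_regular hre hr
    | succ i =>
      refine GrMod.vanishes_succ_of_modSMul he hd hre hr fun k => ih (M.modSMul hd)
        (fun y hy => hhom y (List.mem_cons_of_mem _ hy))
        (fun y hy => hmem y (List.mem_cons_of_mem _ hy))
        (((M.quotSMulTopEquiv hd).isWeaklyRegular_congr rs).mp hrs) i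
        (by rw [List.length_cons] at hi; omega) _

variable [IsNoetherianRing R]

/-- After dividing by the whole sequence the module is 𝔢-torsion and has only H⁰; each regular
element restored raises the top index by at most one. The square 𝔢² is what linkage provides for 𝔢 =
𝔞 ∩ R₊. -/
theorem GrMod.vanishes_gt_of_isWeaklyRegular {e : Ideal R} (he : e.IsHomogeneous 𝒜)
    (rs : List R) : ∀ (M : GrMod 𝒜), (∀ r ∈ rs, SetLike.IsHomogeneousElem 𝒜 r) →
      (∀ r ∈ rs, r ∈ e) → RingTheory.Sequence.IsWeaklyRegular M rs →
      (∀ s ∈ e ^ 2, ∀ m : M, s • m ∈ Ideal.ofList rs • (⊤ : Submodule R M)) →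
      ∀ i > rs.length, ∀ n, M.Vanishes e i n := by
  induction rs with
  | nil =>
    intro M _ _ _ htor i hi n
    obtain ⟨i, rfl⟩ := Nat.exists_eq_succ_of_ne_zero (Nat.ne_zero_of_lt hi)
    obtain ⟨xs, hxs, hxe⟩ := he.exists_eq_ofList
    rw [hxe]
    refine GrMod.vanishes_ofList_of_torsion hxs (fun x hx m => ⟨2, ?_⟩) i n
    have hxe' : x ∈ e := hxe ▸ Ideal.subset_span hx
    have := htor (x ^ 2) (Ideal.pow_mem_pow hxe' 2) m
    rw [Ideal.ofList_nil, Submodule.bot_smul] at this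
    exact this
  | cons r rs ih =>
    intro M hhom hmem hreg htor i hi n
    obtain ⟨i, rfl⟩ := Nat.exists_eq_succ_of_ne_zero (Nat.ne_zero_of_lt hi)
    obtain ⟨d, hd⟩ := hhom r List.mem_cons_self
    obtain ⟨hr, hrs⟩ := (RingTheory.Sequence.isWeaklyRegular_cons_iff M r rs).mp hreg
    have hre := hmem r List.mem_cons_self
    refine GrMod.vanishes_succ_of_modSMul he hd hre hr fun k => ih (M.modSMul hd)
      (fun y hy => hhom y (List.mem_cons_of_mem _ hy))
      (fun y hy => hmem y (List.mem_cons_of_mem _ hy))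
      (((M.quotSMulTopEquiv hd).isWeaklyRegular_congr rs).mp hrs) ?_ i
      (by rw [List.length_cons] at hi; omega) _
    intro s hs m
    let π : M →ₗ[R] M.modSMul hd := (LinearMap.range (LinearMap.lsmul R M r)).mkQ
    obtain ⟨m, rfl⟩ : ∃ m', π m' = m := Submodule.mkQ_surjective _ m
    have h1 := Submodule.mem_map_of_mem (f := π) (htor s hs m)
    rw [map_smul, Ideal.ofList_cons, Submodule.sup_smul, Submodule.map_sup, Submodule.map_smul'',
      Submodule.map_smul''] at h1
    refine SetLike.le_def.mp (sup_le ?_ (Submodule.smul_mono le_rfl le_top)) h1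
    rw [Submodule.smul_le]
    rintro t ht _ ⟨y, -, rfl⟩
    obtain ⟨c, rfl⟩ := Ideal.mem_span_singleton'.mp ht
    have h2 : π (r • y) = 0 := (Submodule.Quotient.mk_eq_zero _).mpr ⟨y, rfl⟩
    rw [mul_smul, ← map_smul, h2, smul_zero]
    exact zero_mem _

/-- The part `Hⁱ_{𝔞 + 𝔟}(M) → Hⁱ_𝔟(M) → Hⁱ_{𝔞 ∩ 𝔟}(M)` of the Mayer–Vietoris sequence. -/
theorem GrMod.vanishes_of_sup_of_inf {M : GrMod 𝒜} {a b : Ideal R} (ha : a.IsHomogeneous 𝒜)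
    (hb : b.IsHomogeneous 𝒜) {i : ℕ} {n : ℤ} (hinf : M.Vanishes (a ⊓ b) (i + 1) n)
    (hsup : M.Vanishes (a ⊔ b) (i + 1) n) : M.Vanishes b (i + 1) n := by
  intro y hy hyn
  have hy' : y ∈ M.injRes.cocycles (a ⊓ b) (i + 1) :=
    ⟨gammaTorsion_anti inf_le_right _ hy.1, hy.2⟩
  obtain ⟨w, hw, hwn, rfl⟩ := M.injRes.exists_homogeneous_of_mem_coboundaries (ha.inf hb)
    (hinf y hy' hyn) hyn
  -- Split w into an 𝔞-torsion and a 𝔟-torsion part. The differential of the 𝔞-part differs from the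
  -- 𝔟-torsion cocycle dw by a 𝔟-torsion coboundary, so it is a cocycle for 𝔞 + 𝔟.
  obtain ⟨v, hv, hwv⟩ := (M.injRes.inj i).exists_add_eq ha hb hw hwn
  have hv' := (M.injRes.obj i).isGrSub_gammaTorsion hb v hv n
  have hwv' := (M.injRes.obj i).isGrSub_gammaTorsion ha _ hwv n
  rw [map_sub, (M.injRes.obj i).proj_of_mem hwn] at hwv'
  have hvn := (M.injRes.obj i).proj_mem v n
  generalize (M.injRes.obj i).proj n v = v' at hv' hwv' hvn
  have hc : M.injRes.d i (w - v') ∈ M.injRes.cocycles (a ⊔ b) (i + 1) := by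
    refine ⟨?_, M.injRes.d_d i _⟩
    rw [gammaTorsion_sup]
    refine ⟨map_mem_gammaTorsion _ hwv', ?_⟩
    rw [map_sub]
    exact sub_mem hy.1 (map_mem_gammaTorsion _ hv')
  obtain ⟨x, hx, hdx⟩ := hsup _ hc (M.injRes.d_grHom i n _ (sub_mem hwn hvn))
  refine ⟨x + v', add_mem (gammaTorsion_anti le_sup_right _ hx) hv', ?_⟩
  rw [map_add, hdx, map_sub, sub_add_cancel]

end Linkage

/-! ### The main theorem. -/

section Main

variable {R : Type u} [CommRing R] {𝒜 : ℕ → AddSubgroup R} [GradedRing 𝒜]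

/-- Jumps from zero to nonzero can occur only between the two stable ranges; the lower end N₀ - 1
allows for the step from n to n + 1. -/
theorem isTame_grLocalCohomologyDeg {M : GrMod 𝒜} {b : Ideal R} {c : ℕ} {q N₀ : ℤ}
    (hq : ∀ n > q, M.Vanishes b c n)
    (hN : (∀ n < N₀, M.Vanishes b c n) ∨ ∀ n < N₀, ¬ M.Vanishes b c n) :
    IsTame (grLocalCohomologyDeg M b c) := by
  refine (Set.finite_Icc (N₀ - 1) q).subset ?_
  rintro n ⟨h1, h2⟩
  rw [grLocalCohomologyDeg_eq_bot_iff] at h1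
  rw [Ne, grLocalCohomologyDeg_eq_bot_iff] at h2
  constructor
  · by_contra hn
    rcases hN with h | h
    · exact h2 (h _ (by omega))
    · exact h _ (by omega) h1
  · by_contra hn
    exact h2 (hq _ (by omega))

theorem cohomDim_eq_of_isGreatest {M : GrMod 𝒜} {b : Ideal R} {c : ℕ}
    (hc : IsGreatest {i | Nontrivial (grLocalCohomology M b i)} c) :
    cohomDim b M = ((c : ℕ∞) : WithBot ℕ∞) := by
  refine le_antisymm (iSup₂_le fun i hi => ?_) (le_iSup₂_of_le c hc.1 le_rfl)
  exact_mod_cast hc.2 hi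

end Main

theorem mainTheorem2 {R : Type u} [CommRing R] (𝒜 : ℕ → AddSubgroup R) [GradedRing 𝒜]
    [IsNoetherianRing (𝒜 0)] [IsLocalRing (𝒜 0)] (hR : IsStandardGraded 𝒜)
    (M : GrMod 𝒜) [Module.Finite R M] [Nontrivial M]
    (a : Ideal R) (ha : a.IsHomogeneous 𝒜) (ha' : a ≠ ⊤)
    (hcd : cohomDim (HomogeneousIdeal.irrelevant 𝒜).toIdeal M ≠ 0)
    (h : IsRelativeCM (HomogeneousIdeal.irrelevant 𝒜).toIdeal M ∨
      ∃ I : Ideal R, IsHLinked 𝒜 M I a (HomogeneousIdeal.irrelevant 𝒜).toIdeal) :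
    finitenessDim (HomogeneousIdeal.irrelevant 𝒜).toIdeal
        (a ⊔ (HomogeneousIdeal.irrelevant 𝒜).toIdeal) M < ⊤ ∧
      ∃ c : ℕ, cohomDim (HomogeneousIdeal.irrelevant 𝒜).toIdeal M = ((c : ℕ∞) : WithBot ℕ∞) ∧
        IsTame (grLocalCohomologyDeg M (a ⊔ (HomogeneousIdeal.irrelevant 𝒜).toIdeal) c) := by
  have : IsNoetherianRing R := hR.isNoetherianRing
  have hp := posIdeal_isHomogeneous (𝒜 := 𝒜)
  have hb := ha.sup hp
  have hvan : ∀ i, ¬ Nontrivial (grLocalCohomology M (posIdeal 𝒜) i) ↔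
      ∀ n, M.Vanishes (posIdeal 𝒜) i n := fun i => by
    rw [not_nontrivial_iff_subsingleton, subsingleton_grLocalCohomology_iff hp]
  obtain ⟨c, hc⟩ : ∃ c, IsGreatest {i | Nontrivial (grLocalCohomology M (posIdeal 𝒜) i)} c := by
    obtain ⟨xs, hxs, he⟩ := hp.exists_eq_ofList
    obtain ⟨i, n, hi⟩ := M.exists_not_vanishes hR inferInstance
    refine BddAbove.exists_isGreatest_of_nonempty ⟨xs.length, fun j hj => ?_⟩
      ⟨i, by_contra fun hn => hi ((hvan i).mp hn n)⟩
    by_contra hlt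
    refine (hvan j).mpr (fun n => ?_) hj
    rw [he]
    exact GrMod.vanishes_ofList_of_length_lt hxs j (not_le.mp hlt) n
  have hcdc := cohomDim_eq_of_isGreatest hc
  have hc0 : c ≠ 0 := by
    rintro rfl
    exact hcd hcdc
  obtain ⟨c, rfl⟩ := Nat.exists_eq_succ_of_ne_zero hc0
  have hne : ∃ n, ¬ M.Vanishes (posIdeal 𝒜) (c + 1) n := by
    by_contra! hcon
    exact (hvan _).mpr hcon hc.1
  have htop : ∀ i > c + 1, ∀ n, M.Vanishes (posIdeal 𝒜) i n := fun i hi =>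
    (hvan i).mp fun hi' => absurd (hc.2 hi') (not_le.mpr hi)
  refine ⟨?_, c + 1, hcdc, ?_⟩
  · obtain ⟨i, hi⟩ : ∃ i, ¬ posIdeal 𝒜 ≤
        (Module.annihilator R (grLocalCohomology M (a ⊔ posIdeal 𝒜) i)).radical := by
      by_contra! hcon
      obtain ⟨n, hn⟩ := hne
      exact hn (GrMod.vanishes_posIdeal_of_torsion hR
        (M.gammaTorsion_eq_top_of_le_radical hR ha ha' hcon) c n)
    refine lt_of_le_of_lt (iSup₂_le fun k hk => ?_) (ENat.natCast_lt_top i)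
    by_contra hlt
    exact hi (hk i (by exact_mod_cast not_le.mp hlt))
  · obtain ⟨q, hq⟩ := M.exists_vanishes_gt hR hb le_sup_right (c + 1)
    -- When `hlow` holds, c + 1 is the first index for 𝔞 + R₊ that can be nonzero, and neither
    -- alternative of the hypothesis is needed.
    by_cases hlow : ∀ i < c + 1, ∀ n, M.Vanishes (posIdeal 𝒜) i n
    · obtain ⟨xs, hxs, he⟩ := ha.exists_eq_ofList
      have hlow' := GrMod.vanishes_sup_ofList_of_lt hp hxs hlow
      rw [← he, sup_comm] at hlow'
      rcases M.vanishes_dichotomy hR hb (c + 1) fun i hi => ⟨0, fun n _ => hlow' i hi n⟩ with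
        ⟨N₀, h₀⟩ | ⟨N₀, h₀⟩
      · exact isTame_grLocalCohomologyDeg hq (Or.inl h₀)
      · exact isTame_grLocalCohomologyDeg hq (Or.inr h₀)
    · rcases h with ⟨m, hm⟩ | ⟨I, hI⟩
      · refine absurd (fun i hi => (subsingleton_grLocalCohomology_iff hp).mp (hm i ?_)) hlow
        rintro rfl
        obtain ⟨n, hn⟩ := hne
        exact hn ((subsingleton_grLocalCohomology_iff hp).mp (hm _ (by omega)) n)
      · obtain ⟨rs, hrs, hreg, rfl⟩ := hI.exists_regular
        have hmem : ∀ r ∈ rs, r ∈ a ⊓ posIdeal 𝒜 := fun r hr => hI.le_inf (Ideal.subset_span hr)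
        have hgrade := GrMod.vanishes_lt_of_isWeaklyRegular hp rs M hrs
          (fun r hr => (hmem r hr).2) hreg.toIsWeaklyRegular
        -- The sequence lies in R₊, so a length of at least c + 1 would force the excluded vanishing
        -- below c + 1.
        have hlen : rs.length < c + 1 := by
          by_contra hle
          exact hlow fun i hi n => hgrade i (by omega) n
        have hinf := GrMod.vanishes_gt_of_isWeaklyRegular (ha.inf hp) rs M hrs hmem
          hreg.toIsWeaklyRegular (by
            intro s hs m
            rw [pow_two] at hs
            -- (𝔞 ∩ R₊)² ⊆ 𝔞 R₊, and linkage gives 𝔞 (R₊ M) = 𝔞 (IM : 𝔞) ⊆ IM.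
            have hs' := Ideal.mul_mono inf_le_left inf_le_right hs
            refine Submodule.mul_induction_on hs' (fun x hx y hy => ?_) (fun x y hx hy => by
              rw [add_smul]; exact add_mem hx hy)
            have h1 : y • m ∈ posIdeal 𝒜 • (⊤ : Submodule R M) :=
              Submodule.smul_mem_smul hy trivial
            rw [hI.right_eq] at h1
            rw [mul_smul]
            exact h1 x hx) (c + 1) hlen
        obtain ⟨N₀, h₀⟩ := M.exists_not_vanishes_lt hR c htop hne
        exact isTame_grLocalCohomologyDeg hq (Or.inr fun n hn hv =>
          h₀ n hn (GrMod.vanishes_of_sup_of_inf ha hp (hinf n) hv))
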